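/- Let $\mathcal H=\mathbb C\times\mathbb R$ be the Heisenberg group with $(z,u)\cdot(z',u')=(z+z',\,u+u'-\tfrac12\operatorname{Im}(z\overline{z'}))$, contact form $\theta=du+\tfrac12\operatorname{Im}(z\,d\bar z)$, and Korányi distance $d_{\mathcal H}(p,q)=\|p^{-1}q\|$, where $\|(z,u)\|=(|z|^4+16u^2)^{1/4}$. Identify $\mathcal H\cup\{\infty\}$ with the unit sphere $S^3=\partial B$ of $\mathbb C^2$, where $B$ is the open unit ball, by letting $\infty$ correspond to $(0,1)$ and $(z,u)$ to the point $(\zeta_1,\zeta_2)\in S^3$ with $z=\frac{\zeta_1}{i(\zeta_2-1)}$ and $-4u+i|z|^2=\frac{\zeta_2+1}{i(\zeta_2-1)}$. A Legendrian knot $K\subset\mathcal H\cup\{\infty\}$ is a smoothly immersed closed curve in $S^3$ without self-intersections that is tangent to the contact distribution ($\ker\theta$ on $\mathcal H$). It is called open if it passes through $\infty$, and closed otherwise. Its arc length element, written $dp$, is the Euclidean arc length of its projection to $\mathbb C$. The energy $E(K)$ of a closed Legendrian knot $K$ is $B_K(-2)$, where $B_K$ is the meromorphic continuation to $\mathbb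 C$ of $$B_K(\zeta)=\iint_{K\times K}d_{\mathcal H}(p,q)^{\zeta}\,dp\,dq,\qquad \operatorname{Re}\zeta>-1.$$ The energy of an open Legendrian knot $K$ is $$E(K)=\int_K V(K;p)\,dp,\qquad V(K;p)=\lim_{\varepsilon\to+0}\Bigl(\int_{\{q\in K:\ d_{\mathcal H}(p,q)\ge\varepsilon\}}\frac{dq}{d_{\mathcal H}(p,q)^2}-\frac2\varepsilon\Bigr).$$ An $\mathbb R$-circle is a subset of $\mathcal H\cup\{\infty\}=\partial B$ which is the intersection of $\partial B$ with the closure of a complete totally geodesic totally real surface in $B$, where $B$ carries the complex hyperbolic metric. Theorem. For every Legendrian knot $K$ in $\mathcal H\cup\{\infty\}$, closed or open, the energy $E(K)$ is a well-defined real number, $E(K)\ge 0$, and $E(K)=0$ if and only if $K$ is an $\mathbb R$-circle. Moreover every $\mathbb R$-circle is a Legendrian knot, so that the minimum value $0$ is attained exactly at the $\mathbb R$-circles. -/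

import Mathlib

open MeasureTheory Filter Topology
open scoped ContDiff ComplexConjugate

noncomputable section

namespace LegendrianEnergy

/-! The Heisenberg group, with points `(z, u)`. -/

/-- The underlying space `ℂ × ℝ` of the 3-dimensional Heisenberg group. -/
abbrev Heis : Type := ℂ × ℝ

/-- The group law `(z, u) (z', u') = (z + z', u + u' - Im (z * conj z') / 2)`. -/
def heisMul (p q : Heis) : Heis :=
  (p.1 + q.1, p.2 + q.2 - (1 / 2) * (p.1 * conj q.1).im)

/-- The inverse for `heisMul`, the neutral element being `(0, 0)`. -/
def heisInv (p : Heis) : Heis := (-p.1, -p.2)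

/-- The Korányi norm `((x² + y²)² + 16 u²)^(1/4)` of `(x + i y, u)`. -/
def koranyiNorm (p : Heis) : ℝ :=
  ((p.1.re ^ 2 + p.1.im ^ 2) ^ 2 + 16 * p.2 ^ 2) ^ (1 / 4 : ℝ)

/-- The Korányi distance. -/
def koranyiDist (p q : Heis) : ℝ := koranyiNorm (heisMul (heisInv p) q)

/-- The value at the tangent vector `v` of the contact form `du + Im (z * d(conj z)) / 2` at `p`. -/
def contactForm (p v : Heis) : ℝ := v.2 + (1 / 2) * (p.1 * conj v.1).im

/-! The one-point compactification of the Heisenberg group as the unit sphere of `ℂ²`. -/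

/-- The standard Hermitian product of `ℂ²`. -/
def herm (a b : ℂ × ℂ) : ℂ := a.1 * conj b.1 + a.2 * conj b.2

/-- The squared Hermitian norm of `ℂ²`. -/
def hermSq (a : ℂ × ℂ) : ℝ := ‖a.1‖ ^ 2 + ‖a.2‖ ^ 2

/-- The identification of the Heisenberg group with the unit sphere of `ℂ²` minus `(0, 1)`:
the point `(z, w)` with `w = -4u + i|z|²` of the boundary of the Siegel domain, followed by the
inverse of the Cayley transform
`(ζ₁, ζ₂) ↦ (ζ₁ / (i (ζ₂ - 1)), (ζ₂ + 1) / (i (ζ₂ - 1)))`,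
which is `(z, w) ↦ (2iz / (iw - 1), (iw + 1) / (iw - 1))`. -/
def heisToSphere (p : Heis) : ℂ × ℂ :=
  let w : ℂ := -4 * (p.2 : ℂ) + Complex.I * ((‖p.1‖ ^ 2 : ℝ) : ℂ)
  (2 * Complex.I * p.1 / (Complex.I * w - 1), (Complex.I * w + 1) / (Complex.I * w - 1))

/-- The identification of the one-point compactification of the Heisenberg group with the unit
sphere of `ℂ²`; the point `∞` corresponds to `(0, 1)`. -/
def toSphere (p : OnePoint Heis) : ℂ × ℂ := p.elim (0, 1) heisToSphere

/-- The underlying point of the Heisenberg group, with the dummy value `0` at `∞`. -/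
def finitePart (p : OnePoint Heis) : Heis := p.elim 0 id

/-- A (parametrized) smooth Legendrian knot in the one-point compactification of the Heisenberg
group: a periodic curve, injective on a period, which is a smooth immersion for the smooth
structure of the sphere, and tangent to the contact distribution. (Tangency is demanded at the
points of the Heisenberg group; at the only possible passage through `∞` in each period it then
holds as well, by continuity.) -/
structure LegendrianKnot where
  /-- The parametrization. -/
  curve : ℝ → OnePoint Heis
  /-- Its period. -/
  period : ℝ
  period_pos : 0 < period
  periodic : Function.Periodic curve period
  injOn : Set.InjOn curve (Set.Ico 0 period)
  smooth : ContDiff ℝ ∞ (fun t => toSphere (curve t))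
  immersed : ∀ t, deriv (fun s => toSphere (curve s)) t ≠ 0
  legendrian : ∀ t, curve t ≠ OnePoint.infty →
    contactForm (finitePart (curve t)) (deriv (fun s => finitePart (curve s)) t) = 0

namespace LegendrianKnot

variable (K : LegendrianKnot)

/-- The knot as a subset. -/
def carrier : Set (OnePoint Heis) := Set.range K.curve

/-- The arc-length measure of the knot (minus `∞`), as a measure on the Heisenberg group. The
length of a horizontal vector is the Euclidean length of its projection to `ℂ`. -/
def arcLength : Measure Heis :=
  ((volume.restrict (Set.Ico 0 K.period)).withDensity
    (fun t => ENNReal.ofReal ‖(deriv (fun s => finitePart (K.curve s)) t).1‖)).map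
      (fun t => finitePart (K.curve t))

/-- The integral of `d(p, q)^ζ` over `K × K`, for the product of the arc-length measures. -/
def betaIntegral (ζ : ℂ) : ℂ :=
  ∫ x : Heis × Heis, ((koranyiDist x.1 x.2 : ℝ) : ℂ) ^ ζ ∂(K.arcLength.prod K.arcLength)

/-- `B` is a meromorphic continuation to the whole plane of the beta function of `K`, which is
given by the integral of `d(p, q)^ζ` for `Re ζ > -1`. -/
def IsBetaFunction (B : ℂ → ℂ) : Prop :=
  MeromorphicOn B Set.univ ∧ ∀ ζ : ℂ, -1 < ζ.re → B ζ = K.betaIntegral ζ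

/-- `v` is the potential `V(K; p)`, the limit for `ε → +0` of the integral of `1 / d(p, q)²` over
the `q ∈ K` at distance at least `ε` from `p`, minus `2 / ε`. -/
def HasPotential (p : Heis) (v : ℝ) : Prop :=
  Tendsto (fun ε : ℝ =>
      (∫ q in {q : Heis | ε ≤ koranyiDist p q}, 1 / koranyiDist p q ^ 2 ∂K.arcLength) - 2 / ε)
    (𝓝[>] 0) (𝓝 v)

/-- `e` is the energy of `K`: the value at `-2` of the (continued) beta function if `K` does not
pass through `∞`, the integral of the potential if it does. -/
def HasEnergy (e : ℝ) : Prop :=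
  (OnePoint.infty ∉ K.carrier ∧
    ∃ B : ℂ → ℂ, K.IsBetaFunction B ∧ AnalyticAt ℂ B (-2) ∧ B (-2) = (e : ℂ)) ∨
  (OnePoint.infty ∈ K.carrier ∧
    ∃ V : Heis → ℝ, (∀ p : Heis, (p : OnePoint Heis) ∈ K.carrier → K.HasPotential p (V p)) ∧
      Integrable V K.arcLength ∧ ∫ p, V p ∂K.arcLength = e)

end LegendrianKnot

/-! The complex hyperbolic plane and its totally real totally geodesic surfaces. -/

/-- The open unit ball of `ℂ²` for the Hermitian norm. -/
def unitBall : Set (ℂ × ℂ) := {a | hermSq a < 1}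

/-- The complex hyperbolic (Bergman) distance on the unit ball, normalized so that the sectional
curvature is between `-4` and `-1`. -/
def hypDist (a b : ℂ × ℂ) : ℝ :=
  Real.arcosh (‖1 - herm a b‖ / Real.sqrt ((1 - hermSq a) * (1 - hermSq b)))

/-- Complete unit-speed geodesics of the complex hyperbolic plane; in this simply connected
complete space of negative curvature these are the isometric embeddings of the real line. -/
def IsGeodesic (σ : ℝ → ℂ × ℂ) : Prop :=
  (∀ t, σ t ∈ unitBall) ∧ ∀ s t, hypDist (σ s) (σ t) = |s - t|

/-- `S` is a smooth embedded totally real surface: near each of its points `p`, it is the zero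
set of a smooth submersion `f` to the plane, and its tangent space `T = ker df(p)` satisfies
`T ∩ iT = 0`. -/
def IsTotallyRealSurface (S : Set (ℂ × ℂ)) : Prop :=
  ∀ p ∈ S, ∃ (W : Set (ℂ × ℂ)) (f : ℂ × ℂ → ℝ × ℝ), IsOpen W ∧ p ∈ W ∧ ContDiffOn ℝ ∞ f W ∧
    S ∩ W = {a ∈ W | f a = 0} ∧ Function.Surjective (fderiv ℝ f p) ∧
    ∀ v : ℂ × ℂ, fderiv ℝ f p v = 0 → fderiv ℝ f p (Complex.I • v) = 0 → v = 0

/-- `S` is totally geodesic and complete: it contains the whole geodesic through any two distinct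
points of `S`. -/
def IsTotallyGeodesic (S : Set (ℂ × ℂ)) : Prop :=
  ∀ σ : ℝ → ℂ × ℂ, IsGeodesic σ → ∀ s t, s ≠ t → σ s ∈ S → σ t ∈ S → ∀ r, σ r ∈ S

/-- An `ℝ`-circle: the intersection of the unit sphere, identified with the one-point
compactification of the Heisenberg group, and the closure of a complete totally geodesic totally
real surface in the unit ball. -/
def IsRCircle (C : Set (OnePoint Heis)) : Prop :=
  ∃ S : Set (ℂ × ℂ), S.Nonempty ∧ S ⊆ unitBall ∧ IsTotallyRealSurface S ∧
    IsTotallyGeodesic S ∧ C = {p | toSphere p ∈ closure S}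

end LegendrianEnergy

end

/-!
The energy of a Legendrian knot is the integral of a nonnegative continuous density over the torus,
and this density vanishes exactly for `ℝ`-circles.

A knot is regarded as a loop `γ` in the unit sphere of `ℂ²` (`LegendrianLoop`); being Legendrian
means `⟨γ', γ⟩ = 0`. The squared Korányi distance of two of its points is, up to a factor depending
on each point separately, the modulus of `gap s t = 1 - ⟨γ s, γ t⟩`. The mixed second derivative
`cross = ½ ∂ₛ ∂ₜ log gap` satisfies `|cross| ds dt = dp dq / d(p, q)²` (`norm_cross_eq`), and on the
diagonal it differs from `1 / (s - t)²` by a smooth function (`cross_eq`). Hence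
`density = |cross| - Re cross` is nonnegative, continuous and periodic in both variables. Since
`Re cross` is a derivative, its integral only produces boundary terms; by periodicity these cancel
against the counterterms of the regularization (`integral_regCross`).

For an open knot the truncated integrals of `1 / d²` therefore converge after subtraction of
`2 / ε`, and the integral of the potential is that of the density
(`LegendrianKnot.hasEnergy_iff_of_mem`).
For a closed knot the beta function is, in coordinates symmetric about the diagonal, an integral of
`x ^ ζ exp (ζ k) m` with smooth `k` and `m` that are even in `x`. Integration by parts raises the
power of `x` and gives the meromorphic continuation; evenness makes the numerator of the pole at
`-2` vanish and identifies the value there as a finite part (`exists_meromorphic_continuation`),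
which is again the integral of the density (`LegendrianKnot.hasEnergy_iff_of_notMem`).

The totally real totally geodesic surfaces are the images of the real points of the ball under the
projective unitary group of a form of signature `(2, 1)`: after moving a point of the surface to the
origin, where the geodesics are straight lines, the surface fills its tangent plane, and that plane
is unitarily equivalent to the real one (`exists_eq_image_realBall`). So `ℝ`-circles are the images
of the real points of the sphere (`isRCircle_iff`).

If the density vanishes, then `cross` is real, so the mixed derivative of `arg gap` vanishes and the
points of the knot have lifts to `ℂ³` with real indefinite products (`LegendrianLoop.exists_phase`).
Three of them span a real frame, with respect to which the knot is a real curve in the sphere; a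
closed injective curve in a circle is the whole circle (`LegendrianLoop.exists_range_eq`).
Conversely, on an `ℝ`-circle `gap` is real up to factors in one variable, so `cross` is real; it has
no zeros and is positive near the diagonal (`LegendrianLoop.density_eq_zero_of_subset`).
-/

open MeasureTheory Filter Topology
open scoped ContDiff ComplexConjugate

noncomputable section

namespace LegendrianEnergy

/-! ### Smooth division by a coordinate -/

theorem contDiff_integral_unitInterval {E : Type} [NormedAddCommGroup E] [NormedSpace ℝ E]
    [ProperSpace E] (n : ℕ) :
    ∀ {F : Type} [NormedAddCommGroup F] [NormedSpace ℝ F] [CompleteSpace F] {f : E × ℝ → F},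
      ContDiff ℝ n f → ContDiff ℝ n (fun x => ∫ θ in (0 : ℝ)..1, f (x, θ)) := by
  induction n with
  | zero =>
    intro F _ _ _ f hf
    rw [Nat.cast_zero, contDiff_zero] at *
    exact intervalIntegral.continuous_parametric_intervalIntegral_of_continuous'
      (f := fun x θ => f (x, θ)) hf 0 1
  | succ n ih =>
    intro F _ _ _ f hf
    have hf' : ContDiff ℝ ((n : WithTop ℕ∞) + 1) f := by exact_mod_cast hf
    have hd := (contDiff_succ_iff_fderiv.1 hf').2.2
    have hdiff : Differentiable ℝ f := hf'.differentiable (by simp)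
    have hg : ContDiff ℝ n
        (fun p : E × ℝ => (fderiv ℝ f p).comp (ContinuousLinearMap.inl ℝ E ℝ)) :=
      hd.clm_comp contDiff_const
    have key := contDiff_succ_iff_hasFDerivAt (𝕜 := ℝ) (n := n)
      (f := fun x => ∫ θ in (0 : ℝ)..1, f (x, θ))
    rw [Nat.cast_succ]
    refine key.2 ⟨fun x => ∫ θ in (0 : ℝ)..1,
      (fderiv ℝ f (x, θ)).comp (ContinuousLinearMap.inl ℝ E ℝ), ih hg, fun x => ?_⟩
    obtain ⟨C, hC⟩ := ((isCompact_closedBall x 1).prod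
      (isCompact_Icc (a := (0 : ℝ)) (b := 1))).exists_bound_of_continuousOn
      hg.continuous.continuousOn
    refine (intervalIntegral.hasFDerivAt_integral_of_dominated_of_fderiv_le (𝕜 := ℝ)
      (F := fun x θ => f (x, θ))
      (F' := fun x θ => (fderiv ℝ f (x, θ)).comp (ContinuousLinearMap.inl ℝ E ℝ))
      (bound := fun _ => C) (Metric.ball_mem_nhds x one_pos) ?_ ?_ ?_ ?_ ?_ ?_)
    · refine Eventually.of_forall fun y => Continuous.aestronglyMeasurable ?_
      exact hf.continuous.comp (by fun_prop)
    · exact Continuous.intervalIntegrable (hf.continuous.comp (by fun_prop)) _ _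
    · exact Continuous.aestronglyMeasurable (hg.continuous.comp (by fun_prop))
    · refine Eventually.of_forall fun θ hθ y hy => hC (y, θ) ⟨Metric.ball_subset_closedBall hy, ?_⟩
      rw [Set.uIoc_of_le zero_le_one] at hθ
      exact ⟨hθ.1.le, hθ.2⟩
    · exact intervalIntegrable_const
    · refine Eventually.of_forall fun θ _ y _ => ?_
      have h1 := (hdiff (y, θ)).hasFDerivAt
      have h2 : HasFDerivAt (fun z : E => (z, θ)) (ContinuousLinearMap.inl ℝ E ℝ) y :=
        hasFDerivAt_prodMk_left y θ
      exact h1.comp y h2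

/-- Hadamard's lemma with a parameter. -/
theorem exists_smooth_div {f : ℝ × ℝ → ℂ} (hf : ContDiff ℝ ∞ f) (h0 : ∀ τ, f (0, τ) = 0) :
    ∃ h : ℝ × ℝ → ℂ, ContDiff ℝ ∞ h ∧ ∀ x τ, f (x, τ) = x * h (x, τ) := by
  have hd : ContDiff ℝ ∞ (fun p : ℝ × ℝ => fderiv ℝ f p (1, 0)) :=
    (hf.fderiv_right (m := ∞) (by simp)).clm_apply contDiff_const
  have hc : ContDiff ℝ ∞ (fun p : (ℝ × ℝ) × ℝ => fderiv ℝ f (p.2 * p.1.1, p.1.2) (1, 0)) :=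
    hd.comp (g := fun p : ℝ × ℝ => fderiv ℝ f p (1, 0))
      (f := fun p : (ℝ × ℝ) × ℝ => (p.2 * p.1.1, p.1.2)) (by fun_prop)
  refine ⟨fun p => ∫ θ in (0 : ℝ)..1, fderiv ℝ f (θ * p.1, p.2) (1, 0), ?_, fun x τ => ?_⟩
  · rw [contDiff_infty]
    exact fun n => contDiff_integral_unitInterval n
      (f := fun p : (ℝ × ℝ) × ℝ => fderiv ℝ f (p.2 * p.1.1, p.1.2) (1, 0)) (contDiff_infty.1 hc n)
  · have hdiff : Differentiable ℝ f := hf.differentiable (by simp)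
    have hder : ∀ θ ∈ Set.uIcc (0 : ℝ) 1, HasDerivAt (fun θ : ℝ => f (θ * x, τ))
        ((x : ℂ) * fderiv ℝ f (θ * x, τ) (1, 0)) θ := by
      intro θ _
      have h1 := (hdiff (θ * x, τ)).hasFDerivAt
      have h2 : HasDerivAt (fun θ : ℝ => (θ * x, τ)) (x, (0 : ℝ)) θ := by
        have := ((hasDerivAt_id θ).mul_const x).prodMk (hasDerivAt_const θ τ)
        simpa using this
      have h3 := h1.comp_hasDerivAt θ h2
      refine h3.congr_deriv ?_
      have : ((x, 0) : ℝ × ℝ) = x • (1, 0) := by simp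
      rw [this, map_smul]; simp
    have := intervalIntegral.integral_eq_sub_of_hasDerivAt hder
      (Continuous.intervalIntegrable ?_ _ _)
    · rw [intervalIntegral.integral_const_mul] at this
      simp only [one_mul, zero_mul, h0, sub_zero] at this
      exact this.symm
    · exact continuous_const.mul (hd.continuous.comp (by fun_prop))

theorem exists_smooth_div_sq {f : ℝ × ℝ → ℂ} (hf : ContDiff ℝ ∞ f) (h0 : ∀ τ, f (0, τ) = 0)
    (f₁ : ℝ × ℝ → ℂ) (h1 : ∀ x τ, HasDerivAt (fun x => f (x, τ)) (f₁ (x, τ)) x)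
    (h10 : ∀ τ, f₁ (0, τ) = 0) (f₂ : ℝ → ℂ)
    (h2 : ∀ τ, HasDerivAt (fun x => f₁ (x, τ)) (f₂ τ) 0) :
    ∃ h : ℝ × ℝ → ℂ, ContDiff ℝ ∞ h ∧ (∀ x τ, f (x, τ) = x ^ 2 * h (x, τ)) ∧
      ∀ τ, h (0, τ) = f₂ τ / 2 := by
  obtain ⟨k, hk, hfk⟩ := exists_smooth_div hf h0
  have hder : ∀ x τ, HasDerivAt (fun x : ℝ => k (x, τ)) (fderiv ℝ k (x, τ) (1, 0)) x := by
    intro x τ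
    have h2 : HasDerivAt (fun x : ℝ => (x, τ)) ((1 : ℝ), (0 : ℝ)) x :=
      (hasDerivAt_id x).prodMk (hasDerivAt_const x τ)
    exact ((hk.differentiable (by simp)) (x, τ)).hasFDerivAt.comp_hasDerivAt x h2
  have hf1 : ∀ x τ, f₁ (x, τ) = k (x, τ) + x * fderiv ℝ k (x, τ) (1, 0) := by
    intro x τ
    have h3 := ((hasDerivAt_id x).ofReal_comp).mul (hder x τ)
    have hfun : (fun x : ℝ => f (x, τ)) = (fun y : ℝ => ((id y : ℝ) : ℂ)) * fun x => k (x, τ) := by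
      funext x; simp [hfk]
    have h4 := h1 x τ
    rw [hfun] at h4
    simpa using h4.unique h3
  have hk0 : ∀ τ, k (0, τ) = 0 := by
    intro τ
    have := hf1 0 τ
    simpa [h10] using this.symm
  obtain ⟨h, hh, hkh⟩ := exists_smooth_div hk hk0
  refine ⟨h, hh, fun x τ => by rw [hfk, hkh]; ring, fun τ => ?_⟩
  -- `f₁ = x * (h + ∂ₓ k)`, and both `h` and `∂ₓ k` equal `∂ₓ k (0, τ)` at `x = 0`.
  have hh0 : h (0, τ) = fderiv ℝ k (0, τ) (1, 0) := by
    refine HasDerivAt.unique (f := fun x : ℝ => k (x, τ)) (x := 0) ?_ (hder 0 τ)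
    rw [hasDerivAt_iff_tendsto_slope]
    have hcont : Tendsto (fun x : ℝ => h (x, τ)) (𝓝[≠] 0) (𝓝 (h (0, τ))) :=
      (Continuous.tendsto (hh.continuous.comp (by fun_prop)) 0).mono_left nhdsWithin_le_nhds
    refine hcont.congr' ?_
    filter_upwards [self_mem_nhdsWithin] with x hx
    have hx' : (x : ℂ) ≠ 0 := by exact_mod_cast hx
    simp [slope_def_module, hkh]
    field_simp
  have hc : Continuous fun x : ℝ => fderiv ℝ k (x, τ) (1, 0) :=
    ((hk.fderiv_right (m := ∞) (by simp)).clm_apply contDiff_const).continuous.comp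
      (g := fun p : ℝ × ℝ => fderiv ℝ k p (1, 0)) (by fun_prop)
  have : f₂ τ = h (0, τ) + fderiv ℝ k (0, τ) (1, 0) := by
    refine (h2 τ).unique ?_
    rw [hasDerivAt_iff_tendsto_slope]
    have hcont : Tendsto (fun x : ℝ => h (x, τ) + fderiv ℝ k (x, τ) (1, 0)) (𝓝[≠] 0)
        (𝓝 (h (0, τ) + fderiv ℝ k (0, τ) (1, 0))) :=
      (Continuous.tendsto ((hh.continuous.comp (by fun_prop)).add hc) 0).mono_left
        nhdsWithin_le_nhds
    refine hcont.congr' ?_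
    filter_upwards [self_mem_nhdsWithin] with x hx
    have hx' : (x : ℂ) ≠ 0 := by exact_mod_cast hx
    simp [slope_def_module, hf1, hkh]
    field_simp
  rw [this, ← hh0]; ring

/-! ### Legendrian loops in the unit sphere -/

/-- A smooth immersed closed curve in the unit sphere of `ℂ²`, injective on a period, whose
velocity is Hermitian-orthogonal to its position. The real part of `⟨γ', γ⟩ = 0` says that the curve
stays on the sphere, the imaginary part that it is tangent to the contact distribution. -/
structure LegendrianLoop (γ : ℝ → ℂ × ℂ) (P : ℝ) : Prop where
  period_pos : 0 < P
  periodic : Function.Periodic γ P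
  injOn : Set.InjOn γ (Set.Ico 0 P)
  smooth : ContDiff ℝ ∞ γ
  immersed : ∀ t, deriv γ t ≠ 0
  onSphere : ∀ t, hermSq (γ t) = 1
  horizontal : ∀ t, herm (deriv γ t) (γ t) = 0

/-- The vector `(-conj a₂, conj a₁)`, which spans the Hermitian-orthogonal complement of `a`. -/
def perp (a : ℂ × ℂ) : ℂ × ℂ := (-conj a.2, conj a.1)

theorem conj_herm (a b : ℂ × ℂ) : conj (herm a b) = herm b a := by
  simp [herm]; ring

theorem hermSq_coe (a : ℂ × ℂ) : ((hermSq a : ℝ) : ℂ) = herm a a := by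
  simp [hermSq, herm, Complex.mul_conj, Complex.normSq_eq_norm_sq]

theorem hermSq_nonneg (a : ℂ × ℂ) : 0 ≤ hermSq a := by unfold hermSq; positivity

theorem hermSq_eq_zero {a : ℂ × ℂ} : hermSq a = 0 ↔ a = 0 := by
  unfold hermSq
  rw [add_eq_zero_iff_of_nonneg (by positivity) (by positivity)]
  simp [Prod.ext_iff]

theorem herm_smul_left (c : ℂ) (a b : ℂ × ℂ) : herm (c • a) b = c * herm a b := by
  simp [herm]; ring

theorem herm_smul_right (c : ℂ) (a b : ℂ × ℂ) : herm a (c • b) = conj c * herm a b := by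
  simp [herm]; ring

theorem eq_smul_perp {a v : ℂ × ℂ} (ha : hermSq a = 1) (hv : herm v a = 0) :
    v = herm v (perp a) • perp a := by
  have ha' : herm a a = 1 := by rw [← hermSq_coe, ha]; simp
  simp only [herm] at ha' hv
  ext
  · simp only [perp, herm, Prod.smul_fst, smul_eq_mul, map_neg, Complex.conj_conj]
    linear_combination (-v.1) * ha' + a.1 * hv
  · simp only [perp, herm, Prod.smul_snd, smul_eq_mul, map_neg, Complex.conj_conj]
    linear_combination (-v.2) * ha' + a.2 * hv

/-- The Gram determinant of two unit vectors and their perpendiculars, in the form in which it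
enters the mixed second derivative of `log (1 - ⟨a, b⟩)`. -/
theorem herm_perp_identity {a b : ℂ × ℂ} (ha : hermSq a = 1) (hb : hermSq b = 1) :
    herm (perp a) (perp b) * (1 - herm a b) + herm (perp a) b * herm a (perp b) =
      - conj (1 - herm a b) := by
  have ha' : herm a a = 1 := by rw [← hermSq_coe, ha]; simp
  have hb' : herm b b = 1 := by rw [← hermSq_coe, hb]; simp
  simp only [herm] at ha' hb'
  simp only [perp, herm, map_neg, map_sub, map_add, map_mul, map_one, Complex.conj_conj]
  linear_combination (-(b.1 * conj b.1 + b.2 * conj b.2)) * ha' - hb'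

theorem hermSq_smul_perp (c : ℂ) {a : ℂ × ℂ} (ha : hermSq a = 1) :
    hermSq (c • perp a) = ‖c‖ ^ 2 := by
  have : hermSq (c • perp a) = ‖c‖ ^ 2 * hermSq a := by simp [hermSq, perp]; ring
  rw [this, ha, mul_one]

/-- For unit vectors, the real part of `1 - ⟨a, b⟩` is half the squared distance. -/
theorem re_one_sub_herm {a b : ℂ × ℂ} (ha : hermSq a = 1) (hb : hermSq b = 1) :
    (1 - herm a b).re = hermSq (a - b) / 2 := by
  have h : hermSq (a - b) = hermSq a + hermSq b - 2 * (herm a b).re := by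
    simp only [hermSq, herm, ← Complex.normSq_eq_norm_sq, Complex.normSq_apply, Prod.fst_sub,
      Prod.snd_sub, Complex.sub_re, Complex.sub_im, Complex.add_re, Complex.mul_re,
      Complex.conj_re, Complex.conj_im]
    ring
  rw [h, ha, hb]; simp; ring

/-- The kernel `1 - ⟨γ s, γ t⟩`; up to conformal factors it is the squared Korányi distance. -/
def gap (γ : ℝ → ℂ × ℂ) (s t : ℝ) : ℂ := 1 - herm (γ s) (γ t)

/-- The complex speed `c` in `γ' = c • perp γ`. -/
def speed (γ : ℝ → ℂ × ℂ) (t : ℝ) : ℂ := herm (deriv γ t) (perp (γ t))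

/-- Half the partial derivative in the first variable of `log (gap γ s t)`. -/
def halfLogDeriv (γ : ℝ → ℂ × ℂ) (s t : ℝ) : ℂ := -(1 / 2) * herm (deriv γ s) (γ t) / gap γ s t

/-- Half the mixed second derivative of `log (gap γ s t)`. Its absolute value is the CR invariant
density `dp dq / d(p, q)²`. -/
def cross (γ : ℝ → ℂ × ℂ) (s t : ℝ) : ℂ :=
  1 / 2 * speed γ s * conj (speed γ t) * conj (gap γ s t) / gap γ s t ^ 2

/-- The energy density `|X| - Re X` for `X = cross γ`. -/
def density (γ : ℝ → ℂ × ℂ) (s t : ℝ) : ℝ := ‖cross γ s t‖ - (cross γ s t).re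

/-- The kernel divided by its double zero on the diagonal. -/
def gapQuot (γ : ℝ → ℂ × ℂ) (p : ℝ × ℝ) : ℂ :=
  if p.1 = p.2 then ((hermSq (deriv γ p.1) : ℝ) : ℂ) / 2 else gap γ p.1 p.2 / ((p.1 : ℂ) - p.2) ^ 2

/-- The neighbourhood of the diagonal on which the quotient does not vanish. -/
def strip (P : ℝ) : Set (ℝ × ℝ) := {p | |p.1 - p.2| < P}

/-- The regular part of `halfLogDeriv` on the diagonal. -/
def regLogDeriv (γ : ℝ → ℂ × ℂ) (p : ℝ × ℝ) : ℂ :=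
  1 / 2 * fderiv ℝ (gapQuot γ) p (1, 0) / gapQuot γ p

/-- The regular part of `cross` on the diagonal. -/
def regCross (γ : ℝ → ℂ × ℂ) (p : ℝ × ℝ) : ℂ := fderiv ℝ (regLogDeriv γ) p (0, 1)

theorem isOpen_strip (P : ℝ) : IsOpen (strip P) :=
  isOpen_lt (by fun_prop) (by fun_prop)

/-- A periodic function that is injective on a half-open period is injective on every open
period. -/
theorem eq_of_abs_sub_lt_of_injOn {α : Type*} {f : ℝ → α} {P : ℝ} (hP : 0 < P)
    (hper : Function.Periodic f P) (hinj : Set.InjOn f (Set.Ico 0 P)) {s t : ℝ}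
    (hst : |s - t| < P) (e : f s = f t) : s = t := by
  wlog hle : s ≤ t generalizing s t
  · exact (this (by rwa [abs_sub_comm]) e.symm (le_of_not_ge hle)).symm
  obtain ⟨n, hn, -⟩ := existsUnique_sub_zsmul_mem_Ico hP s 0
  simp only [zero_add] at hn
  have hlt : t - s < P := by
    rw [abs_sub_comm, abs_of_nonneg (by linarith)] at hst; exact hst
  have e1 : f (s - n • P) = f s := hper.sub_zsmul_eq n
  by_cases hc : t - n • P < P
  · have e2 : f (t - n • P) = f t := hper.sub_zsmul_eq n
    have := hinj hn ⟨by linarith [hn.1], hc⟩ (by rw [e1, e2, e])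
    linarith
  · have e2 : f (t - n • P - P) = f t := by rw [hper.sub_eq]; exact hper.sub_zsmul_eq n
    have := hinj hn (x₂ := t - n • P - P) ⟨by linarith, by linarith [hn.2]⟩ (by rw [e1, e2, e])
    linarith

theorem contDiff_herm {E : Type*} [NormedAddCommGroup E] [NormedSpace ℝ E] {n : WithTop ℕ∞}
    {f g : E → ℂ × ℂ} (hf : ContDiff ℝ n f) (hg : ContDiff ℝ n g) :
    ContDiff ℝ n fun x => herm (f x) (g x) := by
  have hc : ContDiff ℝ n (fun z : ℂ => conj z) := Complex.conjCLE.contDiff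
  unfold herm
  exact (hf.fst.mul (hc.comp hg.fst)).add (hf.snd.mul (hc.comp hg.snd))

theorem contDiff_perp {n : WithTop ℕ∞} : ContDiff ℝ n perp := by
  have hc : ContDiff ℝ n (fun z : ℂ => conj z) := Complex.conjCLE.contDiff
  unfold perp
  exact (hc.comp contDiff_snd).neg.prodMk (hc.comp contDiff_fst)

theorem hasDerivAt_herm_left {f : ℝ → ℂ × ℂ} {f' : ℂ × ℂ} {t : ℝ} (hf : HasDerivAt f f' t)
    (b : ℂ × ℂ) : HasDerivAt (fun s => herm (f s) b) (herm f' b) t := by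
  have h1 : HasDerivAt (fun s => (f s).1) f'.1 t := hf.fst
  have h2 : HasDerivAt (fun s => (f s).2) f'.2 t := hf.snd
  exact (h1.mul_const _).add (h2.mul_const _)

theorem hasDerivAt_herm_right {f : ℝ → ℂ × ℂ} {f' : ℂ × ℂ} {t : ℝ} (hf : HasDerivAt f f' t)
    (a : ℂ × ℂ) : HasDerivAt (fun s => herm a (f s)) (herm a f') t := by
  have h := Complex.conjCLE.hasFDerivAt.comp_hasDerivAt t (hasDerivAt_herm_left hf a)
  have e : (fun s => herm a (f s)) = Complex.conjCLE ∘ fun s => herm (f s) a := by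
    funext s; simp [conj_herm]
  rw [e]
  exact h.congr_deriv (by simp [conj_herm])

theorem gap_comm (γ : ℝ → ℂ × ℂ) (s t : ℝ) : gap γ t s = conj (gap γ s t) := by
  simp [gap, conj_herm]

theorem norm_cross (γ : ℝ → ℂ × ℂ) (s t : ℝ) :
    ‖cross γ s t‖ = ‖speed γ s‖ * ‖speed γ t‖ / (2 * ‖gap γ s t‖) := by
  rw [cross]
  simp only [norm_div, norm_mul, RCLike.norm_conj, norm_pow, norm_one]
  by_cases hg : gap γ s t = 0
  · simp [hg]
  · have : ‖gap γ s t‖ ≠ 0 := by simpa using hg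
    have h2 : ‖(2 : ℂ)‖ = 2 := by simp
    rw [h2]
    field_simp

theorem cross_comm (γ : ℝ → ℂ × ℂ) (s t : ℝ) : cross γ t s = conj (cross γ s t) := by
  simp only [cross, gap_comm γ s t, map_div₀, map_mul, map_pow, Complex.conj_conj,
    map_one, map_ofNat]
  ring

theorem gapQuot_comm (γ : ℝ → ℂ × ℂ) (s t : ℝ) :
    gapQuot γ (t, s) = conj (gapQuot γ (s, t)) := by
  unfold gapQuot
  by_cases hst : s = t
  · subst hst; simp [map_ofNat]
  · have hts : t ≠ s := fun h => hst h.symm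
    simp only [hst, hts, if_false, gap_comm γ s t, map_div₀, map_pow, map_sub, Complex.conj_ofReal]
    congr 1; ring

namespace LegendrianLoop

variable {γ : ℝ → ℂ × ℂ} {P : ℝ}

theorem hasDerivAt (h : LegendrianLoop γ P) (t : ℝ) : HasDerivAt γ (deriv γ t) t :=
  ((h.smooth.differentiable (by simp)) t).hasDerivAt

theorem contDiff_deriv (h : LegendrianLoop γ P) : ContDiff ℝ ∞ (deriv γ) := by
  have : ContDiff ℝ (∞ + 1) γ := by simpa using h.smooth
  exact (contDiff_succ_iff_deriv.1 this).2.2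

theorem deriv_eq (h : LegendrianLoop γ P) (t : ℝ) : deriv γ t = speed γ t • perp (γ t) :=
  eq_smul_perp (h.onSphere t) (h.horizontal t)

theorem hermSq_deriv (h : LegendrianLoop γ P) (t : ℝ) : hermSq (deriv γ t) = ‖speed γ t‖ ^ 2 := by
  rw [h.deriv_eq t, hermSq_smul_perp _ (h.onSphere t)]

theorem speed_ne_zero (h : LegendrianLoop γ P) (t : ℝ) : speed γ t ≠ 0 := by
  intro h0
  exact h.immersed t (by rw [h.deriv_eq t, h0, zero_smul])

theorem contDiff_speed (h : LegendrianLoop γ P) : ContDiff ℝ ∞ (speed γ) :=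
  contDiff_herm h.contDiff_deriv (contDiff_perp.comp h.smooth)

theorem contDiff_gap (h : LegendrianLoop γ P) : ContDiff ℝ ∞ fun p : ℝ × ℝ => gap γ p.1 p.2 :=
  contDiff_const.sub (contDiff_herm (h.smooth.comp contDiff_fst) (h.smooth.comp contDiff_snd))

theorem deriv_periodic (h : LegendrianLoop γ P) : Function.Periodic (deriv γ) P := by
  intro t
  rw [← deriv_comp_add_const]
  congr 1
  exact h.periodic.funext

theorem speed_periodic (h : LegendrianLoop γ P) : Function.Periodic (speed γ) P := fun t => by
  simp only [speed, h.periodic t, h.deriv_periodic t]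

theorem gap_re (h : LegendrianLoop γ P) (s t : ℝ) :
    (gap γ s t).re = hermSq (γ s - γ t) / 2 := re_one_sub_herm (h.onSphere s) (h.onSphere t)

theorem gap_self (h : LegendrianLoop γ P) (t : ℝ) : gap γ t t = 0 := by
  simp [gap, ← hermSq_coe, h.onSphere]

theorem eq_of_abs_sub_lt (h : LegendrianLoop γ P) {s t : ℝ} (hst : |s - t| < P)
    (e : γ s = γ t) : s = t :=
  eq_of_abs_sub_lt_of_injOn h.period_pos h.periodic h.injOn hst e

theorem gap_re_pos (h : LegendrianLoop γ P) {s t : ℝ} (hne : γ s ≠ γ t) :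
    0 < (gap γ s t).re := by
  rw [h.gap_re]
  have : hermSq (γ s - γ t) ≠ 0 := fun h0 => hne (sub_eq_zero.1 (hermSq_eq_zero.1 h0))
  have := lt_of_le_of_ne (hermSq_nonneg _) this.symm
  linarith

theorem gap_ne_zero (h : LegendrianLoop γ P) {s t : ℝ} (hne : γ s ≠ γ t) : gap γ s t ≠ 0 := by
  intro h0
  have := h.gap_re_pos hne
  simp [h0] at this

theorem hasDerivAt_gap_left (h : LegendrianLoop γ P) (s t : ℝ) :
    HasDerivAt (fun s => gap γ s t) (-herm (deriv γ s) (γ t)) s :=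
  (hasDerivAt_herm_left (h.hasDerivAt s) _).const_sub 1

theorem hasDerivAt_gap_right (h : LegendrianLoop γ P) (s t : ℝ) :
    HasDerivAt (fun t => gap γ s t) (-herm (γ s) (deriv γ t)) t :=
  (hasDerivAt_herm_right (h.hasDerivAt t) _).const_sub 1

theorem hasDerivAt_halfLogDeriv (h : LegendrianLoop γ P) {s t : ℝ} (hne : γ s ≠ γ t) :
    HasDerivAt (fun t => halfLogDeriv γ s t) (cross γ s t) t := by
  have hg := h.gap_ne_zero hne
  have h1 := ((hasDerivAt_herm_right (h.hasDerivAt t) (deriv γ s)).const_mul (-(1 / 2) : ℂ)).div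
    (h.hasDerivAt_gap_right s t) hg
  refine h1.congr_deriv ?_
  have key := herm_perp_identity (h.onSphere s) (h.onSphere t)
  rw [cross, h.deriv_eq s, h.deriv_eq t]
  simp only [herm_smul_left, herm_smul_right]
  congr 1
  change _ = _ * conj (1 - herm (γ s) (γ t))
  rw [← neg_eq_iff_eq_neg.2 key]
  simp only [gap]
  ring

theorem cross_ne_zero (h : LegendrianLoop γ P) {s t : ℝ} (hne : γ s ≠ γ t) : cross γ s t ≠ 0 := by
  have h1 := h.speed_ne_zero s
  have h2 := h.speed_ne_zero t
  have h3 := h.gap_ne_zero hne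
  simp [cross, h1, h2, h3]

theorem herm_deriv_deriv (h : LegendrianLoop γ P) (s : ℝ) :
    herm (deriv (deriv γ) s) (γ s) = -((hermSq (deriv γ s) : ℝ) : ℂ) := by
  -- differentiate `⟨γ', γ⟩ = 0`
  have hp := h.hasDerivAt s
  have hq := ((h.contDiff_deriv.differentiable (by simp)) s).hasDerivAt
  have hc : ∀ {f : ℝ → ℂ} {f' : ℂ}, HasDerivAt f f' s →
      HasDerivAt (fun t => conj (f t)) (conj f') s := fun {f f'} hf =>
    Complex.conjCLE.hasFDerivAt.comp_hasDerivAt s hf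
  have hp1 : HasDerivAt (fun t => (γ t).1) (deriv γ s).1 s := hp.fst
  have hp2 : HasDerivAt (fun t => (γ t).2) (deriv γ s).2 s := hp.snd
  have hq1 : HasDerivAt (fun t => (deriv γ t).1) (deriv (deriv γ) s).1 s := hq.fst
  have hq2 : HasDerivAt (fun t => (deriv γ t).2) (deriv (deriv γ) s).2 s := hq.snd
  have h3 := (hq1.mul (hc hp1)).add (hq2.mul (hc hp2))
  have hA : HasDerivAt (fun t => herm (deriv γ t) (γ t)) _ s := h3
  have hB : (fun t => herm (deriv γ t) (γ t)) = fun _ => 0 := funext h.horizontal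
  rw [hB] at hA
  have := hA.unique (hasDerivAt_const s (0 : ℂ))
  rw [hermSq_coe]
  simp only [herm]
  linear_combination this

theorem contDiff_gapQuot (h : LegendrianLoop γ P) : ContDiff ℝ ∞ (gapQuot γ) := by
  have hf : ContDiff ℝ ∞ fun p : ℝ × ℝ => gap γ (p.2 + p.1) p.2 :=
    contDiff_const.sub (contDiff_herm (h.smooth.comp (contDiff_snd.add contDiff_fst))
      (h.smooth.comp contDiff_snd))
  have hder : ∀ x τ : ℝ, HasDerivAt (fun x => γ (τ + x)) (deriv γ (τ + x)) x := fun x τ =>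
    (h.hasDerivAt (τ + x)).comp_const_add τ x
  have hder' : ∀ x τ : ℝ, HasDerivAt (fun x => deriv γ (τ + x)) (deriv (deriv γ) (τ + x)) x :=
    fun x τ => ((h.contDiff_deriv.differentiable (by simp)) (τ + x)).hasDerivAt.comp_const_add τ x
  have hd1 : ∀ x τ : ℝ, HasDerivAt (fun x => gap γ (τ + x) τ) (-herm (deriv γ (τ + x)) (γ τ)) x :=
    fun x τ => (hasDerivAt_herm_left (hder x τ) (γ τ)).const_sub 1
  have hd2 : ∀ τ : ℝ, HasDerivAt (fun x => -herm (deriv γ (τ + x)) (γ τ))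
      (-herm (deriv (deriv γ) (τ + 0)) (γ τ)) 0 :=
    fun τ => (hasDerivAt_herm_left (hder' 0 τ) (γ τ)).neg
  obtain ⟨k, hk, hfk, hk0⟩ := exists_smooth_div_sq hf
    (fun τ => by simp only [add_zero, h.gap_self])
    (fun p => -herm (deriv γ (p.2 + p.1)) (γ p.2))
    (fun x τ => hd1 x τ)
    (fun τ => by simp only [add_zero, h.horizontal, neg_zero])
    (fun τ => -herm (deriv (deriv γ) (τ + 0)) (γ τ))
    (fun τ => hd2 τ)
  have e : gapQuot γ = fun p => k (p.1 - p.2, p.2) := by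
    funext ⟨s, t⟩
    unfold gapQuot
    split_ifs with hst
    · simp only at hst
      subst hst
      simp only [sub_self, hk0, add_zero, h.herm_deriv_deriv, neg_neg]
    · have h1 := hfk (s - t) t
      simp only [add_sub_cancel] at h1
      have h2 : ((s : ℂ) - t) ≠ 0 := by
        rw [← Complex.ofReal_sub]; exact_mod_cast sub_ne_zero.2 hst
      simp only [h1, Complex.ofReal_sub]
      field_simp
  rw [e]
  exact hk.comp ((contDiff_fst.sub contDiff_snd).prodMk contDiff_snd)

theorem gap_eq (h : LegendrianLoop γ P) (s t : ℝ) :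
    gap γ s t = ((s : ℂ) - t) ^ 2 * gapQuot γ (s, t) := by
  unfold gapQuot
  split_ifs with hst
  · simp only at hst
    subst hst
    simp [h.gap_self]
  · have h2 : ((s : ℂ) - t) ≠ 0 := by
      rw [← Complex.ofReal_sub]; exact_mod_cast sub_ne_zero.2 hst
    field_simp

theorem gapQuot_self (h : LegendrianLoop γ P) (t : ℝ) :
    gapQuot γ (t, t) = ((‖speed γ t‖ ^ 2 / 2 : ℝ) : ℂ) := by
  simp [gapQuot, h.hermSq_deriv]

theorem gapQuot_ne_zero (h : LegendrianLoop γ P) {p : ℝ × ℝ} (hp : p ∈ strip P) :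
    gapQuot γ p ≠ 0 := by
  obtain ⟨s, t⟩ := p
  by_cases hst : s = t
  · subst hst
    rw [h.gapQuot_self]
    have := h.speed_ne_zero s
    simpa using this
  · intro h0
    have := h.gap_eq s t
    rw [h0, mul_zero] at this
    exact h.gap_ne_zero (fun e => hst (h.eq_of_abs_sub_lt hp e)) this

theorem contDiffOn_regLogDeriv (h : LegendrianLoop γ P) :
    ContDiffOn ℝ ∞ (regLogDeriv γ) (strip P) := by
  have hd : ContDiff ℝ ∞ (fun p : ℝ × ℝ => fderiv ℝ (gapQuot γ) p (1, 0)) :=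
    (h.contDiff_gapQuot.fderiv_right (m := ∞) (by simp)).clm_apply contDiff_const
  unfold regLogDeriv
  simp only [div_eq_mul_inv _ (gapQuot γ _)]
  exact (contDiff_const.mul hd).contDiffOn.mul (h.contDiff_gapQuot.contDiffOn.inv
    fun p hp => h.gapQuot_ne_zero hp)

theorem continuousOn_regCross (h : LegendrianLoop γ P) : ContinuousOn (regCross γ) (strip P) := by
  have := (h.contDiffOn_regLogDeriv.fderiv_of_isOpen (m := ∞) (isOpen_strip P)
    (by simp)).continuousOn
  exact this.clm_apply continuousOn_const

theorem hasDerivAt_regLogDeriv (h : LegendrianLoop γ P) {s t : ℝ} (hst : (s, t) ∈ strip P) :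
    HasDerivAt (fun t => regLogDeriv γ (s, t)) (regCross γ (s, t)) t := by
  have h1 : DifferentiableAt ℝ (regLogDeriv γ) (s, t) :=
    (h.contDiffOn_regLogDeriv.differentiableOn (by simp)).differentiableAt
      ((isOpen_strip P).mem_nhds hst)
  have h2 : HasDerivAt (fun t : ℝ => (s, t)) ((0 : ℝ), (1 : ℝ)) t :=
    (hasDerivAt_const t s).prodMk (hasDerivAt_id t)
  exact h1.hasFDerivAt.comp_hasDerivAt t h2

theorem halfLogDeriv_eq (h : LegendrianLoop γ P) {s t : ℝ} (hst : (s, t) ∈ strip P)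
    (hne : s ≠ t) : halfLogDeriv γ s t = 1 / ((s : ℂ) - t) + regLogDeriv γ (s, t) := by
  have hx : ((s : ℂ) - t) ≠ 0 := by
    rw [← Complex.ofReal_sub]; exact_mod_cast sub_ne_zero.2 hne
  have hq := h.gapQuot_ne_zero hst
  have h2 : HasDerivAt (fun s : ℝ => (s, t)) ((1 : ℝ), (0 : ℝ)) s :=
    (hasDerivAt_id s).prodMk (hasDerivAt_const s t)
  have h3 : HasDerivAt (fun s : ℝ => gapQuot γ (s, t)) (fderiv ℝ (gapQuot γ) (s, t) (1, 0)) s :=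
    ((h.contDiff_gapQuot.differentiable (by simp)) (s, t)).hasFDerivAt.comp_hasDerivAt
      (f := fun s : ℝ => (s, t)) s h2
  have h4 : HasDerivAt (fun s : ℝ => ((s : ℂ) - t) ^ 2) (2 * ((s : ℂ) - t)) s := by
    have := (((hasDerivAt_id s).ofReal_comp).sub_const (t : ℂ)).pow 2
    refine this.congr_deriv ?_
    simp
  have h5 := h4.mul h3
  have e : (fun s => gap γ s t) =
      (fun s : ℝ => ((s : ℂ) - t) ^ 2) * fun s : ℝ => gapQuot γ (s, t) := by
    funext s; simp [h.gap_eq]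
  have h6 := h.hasDerivAt_gap_left s t
  rw [e] at h6
  have h7 := h6.unique h5
  have h8 : herm (deriv γ s) (γ t) = -(2 * ((s : ℂ) - t) * gapQuot γ (s, t) +
      ((s : ℂ) - t) ^ 2 * fderiv ℝ (gapQuot γ) (s, t) (1, 0)) := by
    rw [← h7]; ring
  rw [halfLogDeriv, h8, h.gap_eq, regLogDeriv]
  field_simp

theorem cross_eq (h : LegendrianLoop γ P) {s t : ℝ} (hst : (s, t) ∈ strip P)
    (hne : s ≠ t) : cross γ s t = 1 / ((s : ℂ) - t) ^ 2 + regCross γ (s, t) := by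
  have hx : ((s : ℂ) - t) ≠ 0 := by
    rw [← Complex.ofReal_sub]; exact_mod_cast sub_ne_zero.2 hne
  have h1 := h.hasDerivAt_halfLogDeriv (t := t) (s := s) (fun e => hne (h.eq_of_abs_sub_lt hst e))
  have h2 : HasDerivAt (fun t : ℝ => 1 / ((s : ℂ) - t)) (1 / ((s : ℂ) - t) ^ 2) t := by
    have h4 : HasDerivAt (fun t : ℝ => (s : ℂ) - t) (-1) t := by
      exact (((hasDerivAt_id t).ofReal_comp).const_sub (s : ℂ)).congr_deriv (by simp)
    have := h4.fun_inv hx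
    simp only [one_div]
    exact this.congr_deriv (by simp)
  have h3 := h2.add (h.hasDerivAt_regLogDeriv hst)
  refine h1.unique (h3.congr_of_eventuallyEq ?_)
  have ho : IsOpen {t : ℝ | (s, t) ∈ strip P ∧ s ≠ t} :=
    ((isOpen_strip P).preimage (by fun_prop)).inter (isOpen_ne_fun (by fun_prop) (by fun_prop))
  filter_upwards [ho.mem_nhds ⟨hst, hne⟩] with u hu
  simpa using h.halfLogDeriv_eq hu.1 hu.2

end LegendrianLoop

/-! ### The energy density of a loop -/

/-- The integral of the energy density over the torus; the energy of the knot turns out to be this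
integral, whether the knot passes through `∞` or not. -/
def loopEnergy (γ : ℝ → ℂ × ℂ) (P : ℝ) : ℝ := ∫ s in (0 : ℝ)..P, ∫ t in (0 : ℝ)..P, density γ s t

theorem density_nonneg (γ : ℝ → ℂ × ℂ) (s t : ℝ) : 0 ≤ density γ s t :=
  sub_nonneg.2 (Complex.re_le_norm _)

namespace LegendrianLoop

variable {γ : ℝ → ℂ × ℂ} {P : ℝ}

theorem cross_periodic_left (h : LegendrianLoop γ P) (s t : ℝ) :
    cross γ (s + P) t = cross γ s t := by
  simp only [cross, gap, h.periodic s, h.speed_periodic s]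

theorem cross_periodic_right (h : LegendrianLoop γ P) (s t : ℝ) :
    cross γ s (t + P) = cross γ s t := by
  simp only [cross, gap, h.periodic t, h.speed_periodic t]

theorem halfLogDeriv_periodic_right (h : LegendrianLoop γ P) (s t : ℝ) :
    halfLogDeriv γ s (t + P) = halfLogDeriv γ s t := by
  simp only [halfLogDeriv, gap, h.periodic t]

theorem density_periodic_right (h : LegendrianLoop γ P) (s : ℝ) :
    Function.Periodic (density γ s) P := fun t => by
  simp only [density, h.cross_periodic_right]

theorem density_periodic_left (h : LegendrianLoop γ P) (t : ℝ) :
    Function.Periodic (fun s => density γ s t) P := fun s => by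
  simp only [density, h.cross_periodic_left]

theorem continuousAt_cross (h : LegendrianLoop γ P) {p : ℝ × ℝ} (hp : γ p.1 ≠ γ p.2) :
    ContinuousAt (fun p : ℝ × ℝ => cross γ p.1 p.2) p := by
  have hs := h.contDiff_speed.continuous
  have hg := h.contDiff_gap.continuous
  have hne := h.gap_ne_zero hp
  unfold cross
  refine ContinuousAt.div ?_ (hg.pow 2).continuousAt (pow_ne_zero 2 hne)
  exact (((continuous_const.mul (hs.comp continuous_fst)).mul
    (Complex.continuous_conj.comp (hs.comp continuous_snd))).mul
    (Complex.continuous_conj.comp hg)).continuousAt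

theorem cross_self (h : LegendrianLoop γ P) (t : ℝ) : cross γ t t = 0 := by
  simp [cross, h.gap_self]

/-- The regularization `x² * cross = 1 + x² * regCross` shows that the density, which vanishes by
convention on the diagonal, is continuous there. -/
theorem continuousAt_density_diag (h : LegendrianLoop γ P) (t : ℝ) :
    ContinuousAt (fun p : ℝ × ℝ => density γ p.1 p.2) (t, t) := by
  have hmem : (t, t) ∈ strip P := by simp [strip, h.period_pos]
  have hy : ContinuousAt (regCross γ) (t, t) :=
    h.continuousOn_regCross.continuousAt ((isOpen_strip P).mem_nhds hmem)
  set w : ℝ × ℝ → ℂ := fun p => 1 + ((p.1 - p.2 : ℝ) : ℂ) ^ 2 * regCross γ p with hw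
  have hx : ContinuousAt (fun p : ℝ × ℝ => ((p.1 - p.2 : ℝ) : ℂ)) (t, t) := by
    apply Continuous.continuousAt; fun_prop
  have hwc : ContinuousAt w (t, t) := continuousAt_const.add ((hx.pow 2).mul hy)
  have hwt : w (t, t) = 1 := by simp [hw]
  have hre : ∀ᶠ p in 𝓝 (t, t), 0 < (w p).re := by
    have : ContinuousAt (fun p => (w p).re) (t, t) := Complex.continuous_re.continuousAt.comp hwc
    exact this.eventually_const_lt (by simp [hwt])
  have hcont : ContinuousAt (fun p : ℝ × ℝ =>
      (p.1 - p.2) ^ 2 * (regCross γ p).im ^ 2 / (‖w p‖ + (w p).re)) (t, t) := by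
    refine ContinuousAt.div ?_ (hwc.norm.add (Complex.continuous_re.continuousAt.comp hwc)) ?_
    · exact (Continuous.continuousAt (by fun_prop)).mul
        ((Complex.continuous_im.continuousAt.comp hy).pow 2)
    · simp [hwt]
  refine hcont.congr ?_
  filter_upwards [hre, (isOpen_strip P).mem_nhds hmem] with p hp hps
  obtain ⟨s, u⟩ := p
  by_cases hsu : s = u
  · subst hsu
    simp [density, h.cross_self]
  · have hx0 : s - u ≠ 0 := sub_ne_zero.2 hsu
    have hxc : ((s - u : ℝ) : ℂ) ≠ 0 := by exact_mod_cast hx0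
    have e : cross γ s u = w (s, u) / (((s - u) ^ 2 : ℝ) : ℂ) := by
      rw [h.cross_eq hps hsu, hw]
      push_cast at hxc ⊢
      field_simp
    have hn : ‖w (s, u)‖ ^ 2 = (w (s, u)).re ^ 2 + (w (s, u)).im ^ 2 := by
      rw [← Complex.normSq_eq_norm_sq, Complex.normSq_apply]; ring
    have him : (w (s, u)).im = (s - u) ^ 2 * (regCross γ (s, u)).im := by
      rw [hw]
      simp only [← Complex.ofReal_pow, Complex.add_im, Complex.one_im, Complex.im_ofReal_mul,
        zero_add]
    have hpos : 0 < ‖w (s, u)‖ + (w (s, u)).re := by positivity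
    simp only [density, e, norm_div, Complex.norm_real, Real.norm_eq_abs,
      abs_of_nonneg (sq_nonneg (s - u)), Complex.div_ofReal_re]
    field_simp
    rw [him] at hn
    nlinarith

theorem continuous_density (h : LegendrianLoop γ P) :
    Continuous fun p : ℝ × ℝ => density γ p.1 p.2 := by
  rw [continuous_iff_continuousAt]
  rintro ⟨s, t⟩
  by_cases hst : γ s = γ t
  · obtain ⟨n, hn, -⟩ := existsUnique_sub_zsmul_mem_Ico h.period_pos t s
    have hper : ∀ u, density γ u (t - n • P) = density γ u t := fun u =>
      (h.density_periodic_right u).sub_zsmul_eq n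
    have hs : s = t - n • P := by
      refine h.eq_of_abs_sub_lt ?_ ?_
      · rw [abs_sub_comm, abs_of_nonneg (by linarith [hn.1])]; linarith [hn.2]
      · rw [hst]; exact (h.periodic.sub_zsmul_eq n).symm
    have h1 := h.continuousAt_density_diag s
    have h2 : ContinuousAt (fun p : ℝ × ℝ => (p.1, p.2 - n • P)) (s, t) := by
      apply Continuous.continuousAt; fun_prop
    have h4 := ContinuousAt.comp (g := fun p : ℝ × ℝ => density γ p.1 p.2)
      (f := fun p : ℝ × ℝ => (p.1, p.2 - n • P)) (x := (s, t))
      (by change ContinuousAt _ (s, t - n • P); rwa [← hs]) h2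
    refine h4.congr (Eventually.of_forall fun p => ?_)
    exact (h.density_periodic_right p.1).sub_zsmul_eq n
  · have hc := h.continuousAt_cross (p := (s, t)) hst
    exact hc.norm.sub (Complex.continuous_re.continuousAt.comp hc)

theorem continuous_density_right (h : LegendrianLoop γ P) (s : ℝ) : Continuous (density γ s) :=
  h.continuous_density.comp (f := fun t : ℝ => (s, t)) (by fun_prop)

theorem continuous_integral_density (h : LegendrianLoop γ P) :
    Continuous fun s => ∫ t in (0 : ℝ)..P, density γ s t :=
  intervalIntegral.continuous_parametric_intervalIntegral_of_continuous'
    (f := fun s t => density γ s t) h.continuous_density 0 P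

theorem integral_density_nonneg (h : LegendrianLoop γ P) (s : ℝ) :
    0 ≤ ∫ t in (0 : ℝ)..P, density γ s t :=
  intervalIntegral.integral_nonneg h.period_pos.le fun t _ => density_nonneg γ s t

theorem loopEnergy_nonneg (h : LegendrianLoop γ P) : 0 ≤ loopEnergy γ P :=
  intervalIntegral.integral_nonneg h.period_pos.le fun s _ => h.integral_density_nonneg s

theorem loopEnergy_eq_zero_iff (h : LegendrianLoop γ P) :
    loopEnergy γ P = 0 ↔ ∀ s t, density γ s t = 0 := by
  refine ⟨fun h0 => ?_, fun h0 => by simp [loopEnergy, h0]⟩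
  have key : ∀ s ∈ Set.Icc 0 P, ∀ t ∈ Set.Icc 0 P, density γ s t = 0 := by
    by_contra! hcon
    obtain ⟨s, hs, t, ht, hne⟩ := hcon
    have hpos : 0 < density γ s t := lt_of_le_of_ne (density_nonneg γ s t) hne.symm
    have h1 : 0 < ∫ t in (0 : ℝ)..P, density γ s t :=
      intervalIntegral.integral_pos h.period_pos (h.continuous_density_right s).continuousOn
        (fun t _ => density_nonneg γ s t) ⟨t, ht, hpos⟩
    have h2 : 0 < loopEnergy γ P :=
      intervalIntegral.integral_pos h.period_pos h.continuous_integral_density.continuousOn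
        (fun s _ => h.integral_density_nonneg s) ⟨s, hs, h1⟩
    exact h2.ne' h0
  intro s t
  obtain ⟨s', hs', e1⟩ := (h.density_periodic_left t).exists_mem_Ico₀ h.period_pos s
  obtain ⟨t', ht', e2⟩ := (h.density_periodic_right s').exists_mem_Ico₀ h.period_pos t
  rw [e1, e2]
  exact key s' ⟨hs'.1, hs'.2.le⟩ t' ⟨ht'.1, ht'.2.le⟩

/-- The regular part of `cross` integrates over a period to the same value as `-1 / x²` would in the
sense of finite parts: integrals of `Re cross` only produce boundary terms, and these cancel by
periodicity. -/
theorem integral_regCross (h : LegendrianLoop γ P) (s : ℝ) :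
    ∫ x in (-(P / 2))..(P / 2), (regCross γ (s, s + x)).re = 4 / P := by
  have hP := h.period_pos
  have hmem : ∀ x ∈ Set.uIcc (-(P / 2)) (P / 2), (s, s + x) ∈ strip P := by
    intro x hx
    rw [Set.uIcc_of_le (by linarith)] at hx
    have : |x| ≤ P / 2 := abs_le.2 hx
    simp only [strip, Set.mem_ofPred_eq, sub_add_cancel_left, abs_neg]
    linarith
  have hder : ∀ x ∈ Set.uIcc (-(P / 2)) (P / 2),
      HasDerivAt (fun x => (regLogDeriv γ (s, s + x)).re) (regCross γ (s, s + x)).re x := by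
    intro x hx
    have h1 := (h.hasDerivAt_regLogDeriv (hmem x hx)).comp_const_add s x
    exact Complex.reCLM.hasFDerivAt.comp_hasDerivAt x h1
  rw [intervalIntegral.integral_eq_sub_of_hasDerivAt hder]
  · have hp := h.halfLogDeriv_eq (hmem (P / 2) Set.right_mem_uIcc) (by linarith)
    have hm := h.halfLogDeriv_eq (hmem (-(P / 2)) Set.left_mem_uIcc) (by linarith)
    have hper := h.halfLogDeriv_periodic_right s (s + -(P / 2))
    have e : s + -(P / 2) + P = s + P / 2 := by ring
    rw [e, hp, hm] at hper
    have hPc : (P : ℂ) ≠ 0 := by exact_mod_cast hP.ne'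
    have e1 : (1 : ℂ) / ((s : ℂ) - ((s + P / 2 : ℝ) : ℂ)) = ((-(2 / P) : ℝ) : ℂ) := by
      push_cast
      rw [sub_add_cancel_left]
      field_simp
    have e2 : (1 : ℂ) / ((s : ℂ) - ((s + -(P / 2) : ℝ) : ℂ)) = ((2 / P : ℝ) : ℂ) := by
      push_cast
      rw [sub_add_cancel_left]
      field_simp
    rw [e1, e2] at hper
    have := congrArg Complex.re hper
    simp only [Complex.add_re, Complex.ofReal_re] at this
    have h4 : 4 / P = 2 / P + 2 / P := by ring
    linarith
  · refine ContinuousOn.intervalIntegrable ?_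
    have hc : ContinuousOn (fun x => regCross γ (s, s + x)) (Set.uIcc (-(P / 2)) (P / 2)) :=
      h.continuousOn_regCross.comp (Continuous.continuousOn (by fun_prop)) hmem
    exact Complex.continuous_re.comp_continuousOn hc

end LegendrianLoop

/-! ### The Heisenberg group and the sphere -/

/-- The inverse of `heisToSphere`; the point `(0, 1)` is sent to `0` because of the convention for
division by zero, in agreement with `finitePart`. -/
def sphereToHeis (a : ℂ × ℂ) : Heis :=
  (a.1 / (Complex.I * (a.2 - 1)), -((a.2 + 1) / (Complex.I * (a.2 - 1))).re / 4)

/-- The function `|z|² + 4 i u`. -/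
def siegel (p : Heis) : ℂ := ((‖p.1‖ ^ 2 : ℝ) : ℂ) + 4 * Complex.I * (p.2 : ℂ)

theorem one_add_siegel_ne_zero (p : Heis) : 1 + siegel p ≠ 0 := by
  intro h
  have := congrArg Complex.re h
  simp only [siegel, Complex.add_re, Complex.one_re, Complex.ofReal_re, Complex.mul_re,
    Complex.re_ofNat, Complex.I_re, Complex.im_ofNat, Complex.I_im, Complex.ofReal_im,
    Complex.zero_re, Complex.mul_im] at this
  nlinarith [sq_nonneg ‖p.1‖]

theorem heisToSphere_eq (p : Heis) :
    heisToSphere p = (-(2 * Complex.I * p.1) / (1 + siegel p), 1 - 2 / (1 + siegel p)) := by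
  have h := one_add_siegel_ne_zero p
  have e : Complex.I * (-4 * (p.2 : ℂ) + Complex.I * ((‖p.1‖ ^ 2 : ℝ) : ℂ)) = -siegel p := by
    simp only [siegel]
    linear_combination ((‖p.1‖ ^ 2 : ℝ) : ℂ) * Complex.I_mul_I
  simp only [heisToSphere, e]
  have e1 : -siegel p - 1 = -(1 + siegel p) := by ring
  rw [e1]
  refine Prod.ext ?_ ?_
  · simp only; field_simp
  · simp only; field_simp; ring

theorem one_sub_heisToSphere_snd (p : Heis) : 1 - (heisToSphere p).2 = 2 / (1 + siegel p) := by
  rw [heisToSphere_eq]; simp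

theorem siegel_add_conj (p : Heis) : siegel p + conj (siegel p) = 2 * (p.1 * conj p.1) := by
  simp only [siegel, map_add, map_mul, Complex.conj_ofReal, Complex.conj_I, map_ofNat,
    Complex.mul_conj, Complex.normSq_eq_norm_sq]
  ring

/-- The kernel of the sphere in Heisenberg coordinates. -/
theorem one_sub_herm_heisToSphere (p q : Heis) :
    (1 - herm (heisToSphere p) (heisToSphere q)) * ((1 + siegel p) * conj (1 + siegel q)) =
      2 * (siegel p + conj (siegel q) - 2 * (p.1 * conj q.1)) := by
  have hp := one_add_siegel_ne_zero p
  have hq := one_add_siegel_ne_zero q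
  have hq' : conj (1 + siegel q) ≠ 0 := (map_ne_zero _).2 hq
  simp only [heisToSphere_eq, herm, map_sub, map_div₀, map_neg, map_mul, map_ofNat,
    Complex.conj_I, map_one, map_add] at hq' ⊢
  field_simp
  linear_combination (4 * p.1 * conj q.1) * Complex.I_sq

theorem hermSq_heisToSphere (p : Heis) : hermSq (heisToSphere p) = 1 := by
  have h := one_sub_herm_heisToSphere p p
  rw [siegel_add_conj, sub_self, mul_zero, ← hermSq_coe] at h
  have hp := one_add_siegel_ne_zero p
  have hq' : conj (1 + siegel p) ≠ 0 := (map_ne_zero _).2 hp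
  have := (mul_eq_zero.1 h).resolve_right (mul_ne_zero hp hq')
  exact_mod_cast (sub_eq_zero.1 this).symm

theorem heisToSphere_snd_ne_one (p : Heis) : (heisToSphere p).2 ≠ 1 := by
  intro h
  have := one_sub_heisToSphere_snd p
  rw [h, sub_self] at this
  exact (div_ne_zero two_ne_zero (one_add_siegel_ne_zero p)) this.symm

theorem sphereToHeis_heisToSphere (p : Heis) : sphereToHeis (heisToSphere p) = p := by
  have h := one_add_siegel_ne_zero p
  have e : (heisToSphere p).2 - 1 = -(2 / (1 + siegel p)) := by
    rw [← one_sub_heisToSphere_snd]; ring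
  have e2 : (heisToSphere p).2 + 1 = 2 * siegel p / (1 + siegel p) := by
    rw [heisToSphere_eq]; field_simp; ring
  rw [sphereToHeis, e, e2, heisToSphere_eq]
  have hI := Complex.I_ne_zero
  refine Prod.ext ?_ ?_
  · simp only; field_simp
  · have : 2 * siegel p / (1 + siegel p) / (Complex.I * -(2 / (1 + siegel p))) =
        Complex.I * siegel p := by
      field_simp
      linear_combination (-siegel p) * Complex.I_sq
    simp only [this]
    simp [siegel, -Complex.ofReal_pow]

theorem heisToSphere_sphereToHeis {a : ℂ × ℂ} (ha : hermSq a = 1) (h : a.2 ≠ 1) :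
    heisToSphere (sphereToHeis a) = a := by
  have hI := Complex.I_ne_zero
  have h1 : a.2 - 1 ≠ 0 := sub_ne_zero.2 h
  have h1' : conj a.2 - 1 ≠ 0 := by
    intro h0; apply h1; have := congrArg conj h0; simpa using this
  have hn : ((‖a.1‖ ^ 2 : ℝ) : ℂ) = 1 - a.2 * conj a.2 := by
    have h3 := hermSq_coe a
    rw [ha] at h3
    have h4 : ((‖a.1‖ ^ 2 : ℝ) : ℂ) = a.1 * conj a.1 := by
      rw [Complex.mul_conj, Complex.normSq_eq_norm_sq]
    rw [h4]
    simp only [herm, Complex.ofReal_one] at h3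
    linear_combination -h3
  -- `w = (a₂ + 1) / (i (a₂ - 1))` has imaginary part `|z|²`
  set w : ℂ := (a.2 + 1) / (Complex.I * (a.2 - 1)) with hw
  have hs : siegel (sphereToHeis a) = -(Complex.I * w) := by
    have hre : ((w.re : ℝ) : ℂ) = (w + conj w) / 2 := by
      rw [Complex.add_conj]; push_cast; ring
    have hz : ((‖a.1 / (Complex.I * (a.2 - 1))‖ ^ 2 : ℝ) : ℂ) =
        (1 - a.2 * conj a.2) / ((a.2 - 1) * (conj a.2 - 1)) := by
      rw [norm_div, div_pow, Complex.ofReal_div, hn, norm_mul, Complex.norm_I, one_mul,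
        ← Complex.normSq_eq_norm_sq, ← Complex.mul_conj]
      simp
    have hcw : conj w = (conj a.2 + 1) / (-Complex.I * (conj a.2 - 1)) := by
      simp [hw]
    simp only [siegel, sphereToHeis, ← hw, hz]
    push_cast
    rw [hre, hcw, hw]
    field_simp
    ring_nf
  have hwI : Complex.I * w = (a.2 + 1) / (a.2 - 1) := by rw [hw]; field_simp
  have h2 : 1 + siegel (sphereToHeis a) = -2 / (a.2 - 1) := by
    rw [hs, hwI]; field_simp; ring
  rw [heisToSphere_eq, h2]
  refine Prod.ext ?_ ?_
  · simp only [sphereToHeis]; field_simp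
  · simp only; field_simp; ring

theorem hermSq_toSphere (p : OnePoint Heis) : hermSq (toSphere p) = 1 := by
  induction p using OnePoint.rec with
  | infty => simp [toSphere, hermSq]
  | coe p => exact hermSq_heisToSphere p

theorem toSphere_coe (p : Heis) : toSphere p = heisToSphere p := rfl

theorem toSphere_snd_eq_one_iff (p : OnePoint Heis) : (toSphere p).2 = 1 ↔ p = OnePoint.infty := by
  induction p using OnePoint.rec with
  | infty => simp [toSphere]
  | coe p => simpa [toSphere_coe] using heisToSphere_snd_ne_one p

theorem finitePart_eq (p : OnePoint Heis) : finitePart p = sphereToHeis (toSphere p) := by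
  induction p using OnePoint.rec with
  | infty => simp [toSphere, finitePart, sphereToHeis, Prod.ext_iff]
  | coe p => exact (sphereToHeis_heisToSphere p).symm

theorem toSphere_injective : Function.Injective toSphere := by
  intro p q h
  induction p using OnePoint.rec with
  | infty => exact ((toSphere_snd_eq_one_iff q).1 (h ▸ (toSphere_snd_eq_one_iff _).2 rfl)).symm
  | coe p =>
    induction q using OnePoint.rec with
    | infty => exact (toSphere_snd_eq_one_iff _).1 (h ▸ (toSphere_snd_eq_one_iff _).2 rfl)
    | coe q =>
      have := congrArg sphereToHeis h
      rw [toSphere_coe, toSphere_coe, sphereToHeis_heisToSphere, sphereToHeis_heisToSphere] at this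
      rw [this]

theorem exists_toSphere_eq {a : ℂ × ℂ} (ha : hermSq a = 1) : ∃ p, toSphere p = a := by
  by_cases h : a.2 = 1
  · refine ⟨OnePoint.infty, ?_⟩
    have h1 : ‖a.1‖ ^ 2 = 0 := by
      rw [hermSq, h] at ha; simpa using ha
    have h2 : a.1 = 0 := norm_eq_zero.1 (pow_eq_zero_iff two_ne_zero |>.1 h1)
    exact Prod.ext (by simpa [toSphere] using h2.symm) h.symm
  · exact ⟨(sphereToHeis a : Heis), heisToSphere_sphereToHeis ha h⟩

theorem koranyiDist_nonneg (p q : Heis) : 0 ≤ koranyiDist p q := Real.rpow_nonneg (by positivity) _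

/-- The square of the Korányi distance is the modulus of a sesqui-holomorphic kernel. -/
theorem koranyiDist_sq_eq_norm (p q : Heis) :
    koranyiDist p q ^ 2 = ‖siegel p + conj (siegel q) - 2 * (p.1 * conj q.1)‖ := by
  have h : ∀ x : ℝ, 0 ≤ x → (x ^ (1 / 4 : ℝ)) ^ 2 = √x := fun x hx => by
    rw [← Real.rpow_natCast, ← Real.rpow_mul hx, Real.sqrt_eq_rpow]; norm_num
  rw [koranyiDist, koranyiNorm, h _ (by positivity), Complex.norm_eq_sqrt_sq_add_sq]
  congr 1
  obtain ⟨⟨a, b⟩, u⟩ := p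
  obtain ⟨⟨c, d⟩, v⟩ := q
  simp only [heisMul, heisInv, siegel, ← Complex.normSq_eq_norm_sq, Complex.normSq_apply,
    Complex.add_re, Complex.add_im, Complex.sub_re, Complex.sub_im, Complex.mul_re, Complex.mul_im,
    Complex.neg_re, Complex.neg_im, Complex.conj_re, Complex.conj_im, Complex.ofReal_re,
    Complex.ofReal_im, Complex.I_re, Complex.I_im, Complex.re_ofNat, Complex.im_ofNat]
  ring

theorem koranyiDist_sq (p q : Heis) : koranyiDist p q ^ 2 =
    2 * ‖1 - herm (heisToSphere p) (heisToSphere q)‖ /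
      (‖1 - (heisToSphere p).2‖ * ‖1 - (heisToSphere q).2‖) := by
  have h := congrArg norm (one_sub_herm_heisToSphere p q)
  have hp : ‖1 + siegel p‖ ≠ 0 := norm_ne_zero_iff.2 (one_add_siegel_ne_zero p)
  have hq : ‖1 + siegel q‖ ≠ 0 := norm_ne_zero_iff.2 (one_add_siegel_ne_zero q)
  rw [norm_mul, norm_mul, RCLike.norm_conj, norm_mul, Complex.norm_ofNat] at h
  rw [koranyiDist_sq_eq_norm, one_sub_heisToSphere_snd, one_sub_heisToSphere_snd, norm_div,
    norm_div, Complex.norm_ofNat]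
  field_simp
  rw [← mul_assoc 2 p.1] at h
  linarith

/-- The contact form is, up to a positive factor, the imaginary part of `⟨γ', γ⟩`. -/
theorem herm_deriv_heisToSphere {γ : ℝ → ℂ × ℂ} {p : ℝ → Heis} {γ' : ℂ × ℂ} {p' : Heis} {t : ℝ}
    (hγ : HasDerivAt γ γ' t) (hp : HasDerivAt p p' t) (e : ∀ᶠ s in 𝓝 t, γ s = heisToSphere (p s)) :
    herm γ' (γ t) * ((1 + siegel (p t)) * conj (1 + siegel (p t))) =
      -(8 * Complex.I * contactForm (p t) p') := by
  have hz : HasDerivAt (fun s => (p s).1) p'.1 t := hp.fst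
  have hu : HasDerivAt (fun s => (p s).2) p'.2 t := hp.snd
  have hzc : HasDerivAt (fun s => conj (p s).1) (conj p'.1) t :=
    Complex.conjCLE.hasFDerivAt.comp_hasDerivAt t hz
  have hs : HasDerivAt (fun s => siegel (p s))
      (p'.1 * conj (p t).1 + (p t).1 * conj p'.1 + 4 * Complex.I * (p'.2 : ℂ)) t := by
    have h1 := (hz.mul hzc).add ((hu.ofReal_comp).const_mul (4 * Complex.I))
    have e : (fun s => siegel (p s)) = (fun s => (p s).1) * (fun s => conj (p s).1) +
        fun s => 4 * Complex.I * ((p s).2 : ℂ) := by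
      funext s
      simp [siegel, Complex.mul_conj, Complex.normSq_eq_norm_sq]
    rw [e]; exact h1
  have hN := ((hs.add_const (conj (siegel (p t)))).sub
    ((hz.mul_const (conj (p t).1)).const_mul 2)).const_mul 2
  have hL := (((hasDerivAt_herm_left hγ (γ t)).const_sub 1).mul
    ((hs.const_add 1).mul_const (conj (1 + siegel (p t)))))
  have ht := e.self_of_nhds
  have hLN := hL.unique (hN.congr_of_eventuallyEq (e.mono fun s hse => by
    have := one_sub_herm_heisToSphere (p s) (p t)
    rw [← hse, ← ht] at this
    exact this))
  have h0 : herm (γ t) (γ t) = 1 := by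
    rw [← hermSq_coe, ht, hermSq_heisToSphere, Complex.ofReal_one]
  rw [h0] at hLN
  have him : (((p t).1 * conj p'.1).im : ℂ) * (2 * Complex.I) =
      (p t).1 * conj p'.1 - p'.1 * conj (p t).1 := by
    have := Complex.sub_conj ((p t).1 * conj p'.1)
    simp only [map_mul, Complex.conj_conj] at this
    push_cast at this
    linear_combination -this
  simp only [contactForm]
  push_cast
  linear_combination -hLN + 2 * him

/-! ### Legendrian knots as loops in the sphere -/

theorem measurable_sphereToHeis : Measurable sphereToHeis := by
  unfold sphereToHeis
  refine Measurable.prodMk ?_ ?_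
  · fun_prop
  · exact ((Complex.measurable_re.comp (by fun_prop)).neg.div_const 4)

theorem differentiableAt_sphereToHeis {γ : ℝ → ℂ × ℂ} {t : ℝ} (hγ : DifferentiableAt ℝ γ t)
    (h : (γ t).2 ≠ 1) : DifferentiableAt ℝ (fun s => sphereToHeis (γ s)) t := by
  have h1 : DifferentiableAt ℝ (fun s => (γ s).1) t := hγ.fst
  have h2 : DifferentiableAt ℝ (fun s => (γ s).2) t := hγ.snd
  have h0 : Complex.I * ((γ t).2 - 1) ≠ 0 := mul_ne_zero Complex.I_ne_zero (sub_ne_zero.2 h)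
  have h3 : DifferentiableAt ℝ (fun s => Complex.I * ((γ s).2 - 1)) t :=
    (h2.sub_const 1).const_mul _
  have h4 : DifferentiableAt ℝ (fun s => ((γ s).2 + 1) / (Complex.I * ((γ s).2 - 1))) t := by
    simp only [div_eq_mul_inv]; exact (h2.add_const 1).mul (h3.inv h0)
  have h5 : DifferentiableAt ℝ (fun s => (γ s).1 / (Complex.I * ((γ s).2 - 1))) t := by
    simp only [div_eq_mul_inv]; exact h1.mul (h3.inv h0)
  have h6 : DifferentiableAt ℝ
      (fun s => (((γ s).2 + 1) / (Complex.I * ((γ s).2 - 1))).re) t :=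
    Complex.reCLM.differentiableAt.comp t h4
  exact h5.prodMk ((h6.neg).div_const 4)

/-- The speed, in the metric of the Heisenberg group, of the loop `γ` in the sphere. -/
def arcSpeed (γ : ℝ → ℂ × ℂ) (t : ℝ) : ℝ := ‖speed γ t‖ / ‖1 - (γ t).2‖

/-- The Korányi distance of two points of the loop divided by the difference of the parameters. -/
def quotDist (γ : ℝ → ℂ × ℂ) (p : ℝ × ℝ) : ℝ :=
  √(2 * ‖gapQuot γ p‖ / (‖1 - (γ p.1).2‖ * ‖1 - (γ p.2).2‖))

theorem arcSpeed_nonneg (γ : ℝ → ℂ × ℂ) (t : ℝ) : 0 ≤ arcSpeed γ t := by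
  unfold arcSpeed; positivity

namespace LegendrianLoop

variable {γ : ℝ → ℂ × ℂ} {P : ℝ}

theorem norm_deriv_sphereToHeis (h : LegendrianLoop γ P) {t : ℝ} (ht : (γ t).2 ≠ 1) :
    ‖(deriv (fun s => sphereToHeis (γ s)) t).1‖ = arcSpeed γ t := by
  have hd := (differentiableAt_sphereToHeis (h.hasDerivAt t).differentiableAt ht).hasDerivAt
  have hd1 : HasDerivAt (fun s => (sphereToHeis (γ s)).1)
      (deriv (fun s => sphereToHeis (γ s)) t).1 t := hd.fst
  have h1 : HasDerivAt (fun s => (γ s).1) (deriv γ t).1 t := (h.hasDerivAt t).fst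
  have h2 : HasDerivAt (fun s => (γ s).2) (deriv γ t).2 t := (h.hasDerivAt t).snd
  have hne : (γ t).2 - 1 ≠ 0 := sub_ne_zero.2 ht
  have h0 : Complex.I * ((γ t).2 - 1) ≠ 0 := mul_ne_zero Complex.I_ne_zero hne
  have h3 := h1.div ((h2.sub_const 1).const_mul Complex.I) h0
  have h4 := hd1.unique h3
  have hs : (γ t).1 * conj (γ t).1 + (γ t).2 * conj (γ t).2 = 1 := by
    have := hermSq_coe (γ t)
    rw [h.onSphere] at this
    simpa [herm] using this.symm
  have h5 : (deriv γ t).1 * (Complex.I * ((γ t).2 - 1)) -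
      (γ t).1 * (Complex.I * (deriv γ t).2) =
      Complex.I * speed γ t * conj ((γ t).2 - 1) := by
    conv_lhs => rw [h.deriv_eq t]
    simp only [perp, Prod.smul_fst, Prod.smul_snd, smul_eq_mul, map_sub, map_one]
    linear_combination (-Complex.I * speed γ t) * hs
  rw [h4, h5, norm_div, norm_mul, norm_mul, norm_pow, RCLike.norm_conj, norm_mul,
    Complex.norm_I, arcSpeed, norm_sub_rev 1]
  have : ‖(γ t).2 - 1‖ ≠ 0 := norm_ne_zero_iff.2 hne
  field_simp

theorem koranyiDist_sq (h : LegendrianLoop γ P) {s t : ℝ} (hs : (γ s).2 ≠ 1) (ht : (γ t).2 ≠ 1) :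
    koranyiDist (sphereToHeis (γ s)) (sphereToHeis (γ t)) ^ 2 =
      2 * ‖gap γ s t‖ / (‖1 - (γ s).2‖ * ‖1 - (γ t).2‖) := by
  rw [LegendrianEnergy.koranyiDist_sq, heisToSphere_sphereToHeis (h.onSphere s) hs,
    heisToSphere_sphereToHeis (h.onSphere t) ht, gap]

/-- `|cross|` is the density `dp dq / d(p, q)²`. -/
theorem norm_cross_eq (h : LegendrianLoop γ P) {s t : ℝ} (hs : (γ s).2 ≠ 1) (ht : (γ t).2 ≠ 1) :
    ‖cross γ s t‖ = arcSpeed γ s * arcSpeed γ t /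
      koranyiDist (sphereToHeis (γ s)) (sphereToHeis (γ t)) ^ 2 := by
  have h1 : ‖1 - (γ s).2‖ ≠ 0 := norm_ne_zero_iff.2 (sub_ne_zero.2 hs.symm)
  have h2 : ‖1 - (γ t).2‖ ≠ 0 := norm_ne_zero_iff.2 (sub_ne_zero.2 ht.symm)
  rw [norm_cross, h.koranyiDist_sq hs ht, arcSpeed, arcSpeed]
  field_simp

theorem gap_pos_lt (h : LegendrianLoop γ P) {s t : ℝ} (hst : (s, t) ∈ strip P) (hne : s ≠ t) :
    0 < ‖gap γ s t‖ :=
  norm_pos_iff.2 (h.gap_ne_zero fun e => hne (h.eq_of_abs_sub_lt hst e))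

/-- The Korányi distance is `|s - t|` times a function that is smooth off `∞`. -/
theorem koranyiDist_eq (h : LegendrianLoop γ P) {s t : ℝ} (hs : (γ s).2 ≠ 1) (ht : (γ t).2 ≠ 1) :
    koranyiDist (sphereToHeis (γ s)) (sphereToHeis (γ t)) = |s - t| * quotDist γ (s, t) := by
  have e : ‖gap γ s t‖ = |s - t| ^ 2 * ‖gapQuot γ (s, t)‖ := by
    rw [h.gap_eq, norm_mul, norm_pow, ← Complex.ofReal_sub, Complex.norm_real, Real.norm_eq_abs]
  rw [← Real.sqrt_sq (koranyiDist_nonneg _ _), h.koranyiDist_sq hs ht, e, quotDist,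
    ← Real.sqrt_sq (abs_nonneg (s - t)), ← Real.sqrt_mul (by positivity),
    Real.sqrt_sq (abs_nonneg (s - t))]
  congr 1
  ring

theorem quotDist_self (h : LegendrianLoop γ P) (t : ℝ) : quotDist γ (t, t) = arcSpeed γ t := by
  rw [← Real.sqrt_sq (arcSpeed_nonneg γ t), quotDist, h.gapQuot_self, Complex.norm_real,
    Real.norm_of_nonneg (by positivity), arcSpeed]
  congr 1
  ring

theorem quotDist_pos (h : LegendrianLoop γ P) {p : ℝ × ℝ} (hp : p ∈ strip P)
    (h1 : (γ p.1).2 ≠ 1) (h2 : (γ p.2).2 ≠ 1) : 0 < quotDist γ p := by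
  have := norm_pos_iff.2 (h.gapQuot_ne_zero hp)
  have := norm_pos_iff.2 (sub_ne_zero.2 h1.symm)
  have := norm_pos_iff.2 (sub_ne_zero.2 h2.symm)
  exact Real.sqrt_pos.2 (by positivity)

theorem contDiffAt_norm_one_sub (h : LegendrianLoop γ P) {t : ℝ} (ht : (γ t).2 ≠ 1) :
    ContDiffAt ℝ ∞ (fun t => ‖1 - (γ t).2‖) t :=
  ((contDiff_const.sub h.smooth.snd).contDiffAt).norm ℝ (sub_ne_zero.2 ht.symm)

theorem contDiffAt_quotDist (h : LegendrianLoop γ P) {p : ℝ × ℝ} (hp : p ∈ strip P)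
    (h1 : (γ p.1).2 ≠ 1) (h2 : (γ p.2).2 ≠ 1) : ContDiffAt ℝ ∞ (quotDist γ) p := by
  have c0 := (h.contDiff_gapQuot.contDiffAt (x := p)).norm ℝ (h.gapQuot_ne_zero hp)
  have c1 : ContDiffAt ℝ ∞ (fun p : ℝ × ℝ => ‖1 - (γ p.1).2‖) p :=
    (h.contDiffAt_norm_one_sub h1).comp p contDiffAt_fst
  have c2 : ContDiffAt ℝ ∞ (fun p : ℝ × ℝ => ‖1 - (γ p.2).2‖) p :=
    (h.contDiffAt_norm_one_sub h2).comp p contDiffAt_snd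
  have n0 := norm_pos_iff.2 (h.gapQuot_ne_zero hp)
  have n1 := norm_pos_iff.2 (sub_ne_zero.2 h1.symm)
  have n2 := norm_pos_iff.2 (sub_ne_zero.2 h2.symm)
  exact ((contDiffAt_const.mul c0).div (c1.mul c2) (mul_pos n1 n2).ne').sqrt
    (div_pos (mul_pos two_pos n0) (mul_pos n1 n2)).ne'

end LegendrianLoop

namespace LegendrianKnot

variable (K : LegendrianKnot)

/-- The knot as a curve in the sphere. -/
def loop (t : ℝ) : ℂ × ℂ := toSphere (K.curve t)

theorem loop_snd_eq_one_iff (t : ℝ) : (K.loop t).2 = 1 ↔ K.curve t = OnePoint.infty :=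
  toSphere_snd_eq_one_iff _

theorem finitePart_curve (t : ℝ) : finitePart (K.curve t) = sphereToHeis (K.loop t) :=
  finitePart_eq _

theorem coe_sphereToHeis_loop {t : ℝ} (ht : (K.loop t).2 ≠ 1) :
    ((sphereToHeis (K.loop t) : Heis) : OnePoint Heis) = K.curve t :=
  toSphere_injective (heisToSphere_sphereToHeis (hermSq_toSphere _) ht)

theorem differentiable_loop : Differentiable ℝ K.loop := K.smooth.differentiable (by simp)

theorem herm_deriv_of_ne {t : ℝ} (ht : (K.loop t).2 ≠ 1) :
    herm (deriv K.loop t) (K.loop t) = 0 := by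
  have hd := (differentiableAt_sphereToHeis (K.differentiable_loop t) ht).hasDerivAt
  have hev : ∀ᶠ s in 𝓝 t, K.loop s = heisToSphere (sphereToHeis (K.loop s)) := by
    have ho : IsOpen {s | (K.loop s).2 ≠ 1} :=
      isOpen_ne_fun (continuous_snd.comp K.differentiable_loop.continuous) continuous_const
    filter_upwards [ho.mem_nhds ht] with s hs
    exact (heisToSphere_sphereToHeis (hermSq_toSphere _) hs).symm
  have h1 := herm_deriv_heisToSphere (K.differentiable_loop t).hasDerivAt hd hev
  have hinf : K.curve t ≠ OnePoint.infty := fun e => ht ((K.loop_snd_eq_one_iff t).2 e)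
  have h2 := K.legendrian t hinf
  simp only [K.finitePart_curve] at h2
  rw [h2, Complex.ofReal_zero, mul_zero, neg_zero] at h1
  have h3 := one_add_siegel_ne_zero (sphereToHeis (K.loop t))
  exact (mul_eq_zero.1 h1).resolve_right (mul_ne_zero h3 ((map_ne_zero _).2 h3))

theorem eventually_ne_one (t : ℝ) : ∀ᶠ s in 𝓝[≠] t, (K.loop s).2 ≠ 1 := by
  by_cases ht : (K.loop t).2 = 1
  · have hnear : ∀ᶠ s in 𝓝[≠] t, |s - t| < K.period :=
      nhdsWithin_le_nhds ((isOpen_lt (by fun_prop) continuous_const).mem_nhds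
        (by simpa using K.period_pos))
    filter_upwards [hnear, self_mem_nhdsWithin] with s hs hne h1
    refine hne (eq_of_abs_sub_lt_of_injOn K.period_pos K.periodic K.injOn hs ?_)
    rw [(K.loop_snd_eq_one_iff s).1 h1, (K.loop_snd_eq_one_iff t).1 ht]
  · have ho : IsOpen {s | (K.loop s).2 ≠ 1} :=
      isOpen_ne_fun (continuous_snd.comp K.differentiable_loop.continuous) continuous_const
    exact nhdsWithin_le_nhds (ho.mem_nhds ht)

theorem isLegendrianLoop : LegendrianLoop K.loop K.period where
  period_pos := K.period_pos
  periodic t := by simp only [loop, K.periodic t]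
  injOn := toSphere_injective.comp_injOn K.injOn
  smooth := K.smooth
  immersed := K.immersed
  onSphere t := hermSq_toSphere _
  horizontal t := by
    -- by continuity at a passage through `∞`
    have hd : Continuous (deriv K.loop) := by
      have h0 : ContDiff ℝ ∞ K.loop := K.smooth
      have : ContDiff ℝ (∞ + 1) K.loop := by simpa using h0
      exact (contDiff_succ_iff_deriv.1 this).2.2.continuous
    have hc : Continuous fun t => herm (deriv K.loop t) (K.loop t) :=
      (contDiff_herm contDiff_fst contDiff_snd : ContDiff ℝ 0 fun p : (ℂ × ℂ) × (ℂ × ℂ) =>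
        herm p.1 p.2).continuous.comp (hd.prodMk K.differentiable_loop.continuous)
    have h1 : Tendsto (fun t => herm (deriv K.loop t) (K.loop t)) (𝓝[≠] t)
        (𝓝 (herm (deriv K.loop t) (K.loop t))) := (hc.tendsto t).mono_left nhdsWithin_le_nhds
    refine tendsto_nhds_unique (h1.congr' ?_) tendsto_const_nhds
    filter_upwards [K.eventually_ne_one t] with s hs
    exact K.herm_deriv_of_ne hs

/-- The passages through `∞` form a null set of parameters. -/
theorem ae_loop_snd_ne_one : ∀ᵐ t, (K.loop t).2 ≠ 1 := by
  change volume {t | ¬(K.loop t).2 ≠ 1} = 0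
  refine measure_null_of_locally_null _ fun t ht => ⟨{t}, ?_, by simp⟩
  have := K.eventually_ne_one t
  rw [eventually_nhdsWithin_iff] at this
  refine mem_nhdsWithin_iff_eventually.2 (this.mono fun s hs hs1 => ?_)
  by_contra hne
  exact hs1 (hs hne)

theorem measurable_arcSpeed : Measurable (arcSpeed K.loop) := by
  have h1 := K.isLegendrianLoop.contDiff_speed.continuous
  have h2 := K.differentiable_loop.continuous
  unfold arcSpeed
  exact h1.norm.measurable.div (continuous_const.sub (continuous_snd.comp h2)).norm.measurable

theorem measurable_sphereToHeis_loop : Measurable fun t => sphereToHeis (K.loop t) :=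
  measurable_sphereToHeis.comp K.differentiable_loop.continuous.measurable

/-- The length density on the parameter interval. -/
def paramLength : Measure ℝ :=
  (volume.restrict (Set.Ico 0 K.period)).withDensity fun t => ENNReal.ofReal (arcSpeed K.loop t)

theorem arcLength_eq : K.arcLength = K.paramLength.map fun t => sphereToHeis (K.loop t) := by
  unfold arcLength paramLength
  simp only [K.finitePart_curve]
  congr 1
  refine withDensity_congr_ae ?_
  filter_upwards [ae_restrict_of_ae K.ae_loop_snd_ne_one] with t ht
  rw [K.isLegendrianLoop.norm_deriv_sphereToHeis ht]

theorem measurable_ofReal_arcSpeed : Measurable fun t => ENNReal.ofReal (arcSpeed K.loop t) :=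
  K.measurable_arcSpeed.ennreal_ofReal

instance : SFinite K.paramLength := by unfold paramLength; infer_instance

instance : SFinite K.arcLength := by rw [arcLength_eq]; infer_instance

theorem integral_paramLength {E : Type*} [NormedAddCommGroup E] [NormedSpace ℝ E] (f : ℝ → E) :
    ∫ t, f t ∂K.paramLength = ∫ t in Set.Ico 0 K.period, arcSpeed K.loop t • f t := by
  unfold paramLength
  rw [integral_withDensity_eq_integral_toReal_smul K.measurable_ofReal_arcSpeed (by simp)]
  simp [ENNReal.toReal_ofReal (arcSpeed_nonneg _ _)]

theorem integrable_paramLength {E : Type*} [NormedAddCommGroup E] [NormedSpace ℝ E] (f : ℝ → E) :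
    Integrable f K.paramLength ↔
      IntegrableOn (fun t => arcSpeed K.loop t • f t) (Set.Ico 0 K.period) := by
  unfold paramLength
  rw [integrable_withDensity_iff_integrable_smul' K.measurable_ofReal_arcSpeed (by simp)]
  simp [ENNReal.toReal_ofReal (arcSpeed_nonneg _ _), IntegrableOn]

end LegendrianKnot

/-! ### The potential -/

/-- If a signed distance function `x * ρ x` is smooth near `0` with `ρ 0 > 0`, then its sublevel set
`{|x| ρ(x) < ε}` near `0` is an interval `(ψ(-ε), ψ(ε))`, and the finite parts of `1 / x²` over the
complement with respect to `x` and to the distance agree. -/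
theorem exists_sublevel_interval {ρ : ℝ → ℝ} (hρ : ContDiffAt ℝ ∞ ρ 0) (h0 : 0 < ρ 0) {a : ℝ}
    (ha : 0 < a) :
    ∃ (ψ : ℝ → ℝ) (η : ℝ), 0 < η ∧ η < a ∧ Tendsto ψ (𝓝 0) (𝓝 0) ∧
      (∀ᶠ ε in 𝓝[>] 0, ψ (-ε) < 0 ∧ 0 < ψ ε ∧ -η < ψ (-ε) ∧ ψ ε < η ∧
        ∀ x, |x| ≤ η → (ε ≤ |x * ρ x| ↔ x ≤ ψ (-ε) ∨ ψ ε ≤ x)) ∧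
      Tendsto (fun ε => 1 / ψ ε - 1 / ψ (-ε) - 2 * ρ 0 / ε) (𝓝[>] 0) (𝓝 0) := by
  set δ : ℝ → ℝ := fun x => x * ρ x with hδ
  have hδc : ContDiffAt ℝ ∞ δ 0 := contDiffAt_id.mul hρ
  have hd : deriv δ 0 = ρ 0 := by
    have := (hasDerivAt_id (0 : ℝ)).mul (hρ.differentiableAt (by simp)).hasDerivAt
    have h2 : HasDerivAt δ (1 * ρ 0 + 0 * deriv ρ 0) 0 := this
    simpa using h2.deriv
  have hstrict : HasStrictDerivAt δ (ρ 0) 0 := by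
    rw [← hd]
    exact hδc.hasStrictDerivAt (by simp)
  have hδ0 : δ 0 = 0 := by simp [hδ]
  set ψ := hstrict.localInverse δ (ρ 0) 0 h0.ne' with hψ
  have hψd : HasStrictDerivAt ψ (ρ 0)⁻¹ 0 := by
    have := hstrict.to_localInverse h0.ne'
    rwa [hδ0] at this
  have hψ0 : ψ 0 = 0 := by
    have := HasStrictFDerivAt.localInverse_apply_image (hstrict.hasStrictFDerivAt_equiv h0.ne')
    rw [hδ0] at this
    exact this
  have hright : ∀ᶠ ε in 𝓝 0, δ (ψ ε) = ε := by
    have := HasStrictFDerivAt.eventually_right_inverse (hstrict.hasStrictFDerivAt_equiv h0.ne')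
    rwa [hδ0] at this
  have hψt : Tendsto ψ (𝓝 0) (𝓝 0) := by
    have := hψd.hasDerivAt.continuousAt.tendsto
    rwa [hψ0] at this
  -- near `0` the signed distance is strictly increasing and `ρ` is positive
  have hdc : ContinuousAt (deriv δ) 0 := by
    have h1 : ContinuousAt (fderiv ℝ δ) 0 := (hδc.fderiv_right (m := 0) (by simp)).continuousAt
    exact h1.clm_apply continuousAt_const
  have hev : ∀ᶠ x in 𝓝 (0 : ℝ), 0 < deriv δ x ∧ 0 < ρ x :=
    (hdc.eventually_const_lt (by rwa [hd])).and (hρ.continuousAt.eventually_const_lt h0)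
  obtain ⟨η₀, hη₀, hball⟩ := Metric.eventually_nhds_iff.1 hev
  set η := min (η₀ / 2) (a / 2) with hη
  have hηpos : 0 < η := by positivity
  have hηsub : ∀ x, |x| ≤ η → 0 < deriv δ x ∧ 0 < ρ x := fun x hx => hball (by
    rw [Real.dist_eq, sub_zero]
    exact lt_of_le_of_lt (hx.trans (min_le_left _ _)) (by linarith))
  have hmono : StrictMonoOn δ (Set.Icc (-η) η) := by
    refine strictMonoOn_of_deriv_pos (convex_Icc _ _) (fun x hx => ?_) fun x hx => ?_
    · exact (differentiableAt_of_deriv_ne_zero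
        (hηsub x (abs_le.2 hx)).1.ne').continuousAt.continuousWithinAt
    · rw [interior_Icc] at hx
      exact (hηsub x (abs_le.2 ⟨hx.1.le, hx.2.le⟩)).1
  have hneg : Tendsto (fun ε : ℝ => -ε) (𝓝 0) (𝓝 0) := by
    simpa using (continuous_neg (G := ℝ)).tendsto 0
  have hbd : ∀ᶠ ε in 𝓝 (0 : ℝ), |ψ ε| < η := by
    have := hψt.abs
    rw [abs_zero] at this
    exact this.eventually_lt_const hηpos
  have hsign : ∀ ε : ℝ, δ (ψ ε) = ε → |ψ ε| < η → (0 < ε → 0 < ψ ε) ∧ (ε < 0 → ψ ε < 0) := by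
    intro ε h1 h2
    have h3 := (hηsub _ h2.le).2
    constructor
    · intro h4; rw [← h1] at h4; exact (pos_iff_pos_of_mul_pos h4).2 h3
    · intro h4
      by_contra! h5
      have : 0 ≤ δ (ψ ε) := mul_nonneg h5 h3.le
      linarith
  have hgood : ∀ᶠ ε in 𝓝[>] (0 : ℝ), 0 < ε ∧ (δ (ψ ε) = ε ∧ |ψ ε| < η) ∧
      (δ (ψ (-ε)) = -ε ∧ |ψ (-ε)| < η) := by
    refine (eventually_mem_nhdsWithin).and (nhdsWithin_le_nhds ?_)
    exact (hright.and hbd).and (hneg.eventually (hright.and hbd))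
  refine ⟨ψ, η, hηpos, lt_of_le_of_lt (min_le_right _ _) (by linarith), hψt, ?_, ?_⟩
  · filter_upwards [hgood] with ε ⟨hε, ⟨h1, h2⟩, h3, h4⟩
    have hp := (hsign ε h1 h2).1 hε
    have hm := (hsign (-ε) h3 h4).2 (by linarith)
    refine ⟨hm, hp, (abs_lt.1 h4).1, (abs_lt.1 h2).2, fun x hx => ?_⟩
    have hx' := abs_le.1 hx
    have hI : ∀ y, |y| < η → y ∈ Set.Icc (-η) η := fun y hy => abs_le.1 hy.le
    have e1 : ψ ε ≤ x ↔ ε ≤ δ x := by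
      rw [← hmono.le_iff_le (hI _ h2) hx', h1]
    have e2 : x ≤ ψ (-ε) ↔ δ x ≤ -ε := by
      rw [← hmono.le_iff_le hx' (hI _ h4), h3]
    rw [e1, e2, le_abs, or_comm, le_neg]
  · -- `1 / ψ(ε) = ρ(ψ(ε)) / ε`, and the first-order terms of `ρ ∘ ψ` at `±ε` cancel
    have hr : HasDerivAt (fun ε => ρ (ψ ε)) (deriv ρ 0 * (ρ 0)⁻¹) 0 := by
      have h1 : HasDerivAt ρ (deriv ρ 0) (ψ 0) := by
        rw [hψ0]; exact (hρ.differentiableAt (by simp)).hasDerivAt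
      exact h1.comp 0 hψd.hasDerivAt
    have hrm : HasDerivAt (fun ε => ρ (ψ (-ε))) (-(deriv ρ 0 * (ρ 0)⁻¹)) 0 := by
      have h1 : HasDerivAt (fun ε => ρ (ψ ε)) (deriv ρ 0 * (ρ 0)⁻¹) (-0) := by rwa [neg_zero]
      exact (h1.comp (0 : ℝ) (hasDerivAt_neg (0 : ℝ))).congr_deriv (by ring)
    have hsum := hr.add hrm
    rw [add_neg_cancel, hasDerivAt_iff_tendsto_slope] at hsum
    have hsum' := hsum.mono_left (nhdsWithin_mono 0 (fun x (hx : (0 : ℝ) < x) => hx.ne'))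
    refine hsum'.congr' ?_
    filter_upwards [hgood] with ε ⟨hε, ⟨h1, h2⟩, h3, h4⟩
    have hp := (hsign ε h1 h2).1 hε
    have hm := (hsign (-ε) h3 h4).2 (by linarith)
    have e1 : 1 / ψ ε = ρ (ψ ε) / ε := by
      rw [div_eq_div_iff hp.ne' hε.ne']
      have : ψ ε * ρ (ψ ε) = ε := h1
      linarith
    have e2 : -(1 / ψ (-ε)) = ρ (ψ (-ε)) / ε := by
      rw [← div_neg, div_eq_div_iff (by linarith) hε.ne']
      have : ψ (-ε) * ρ (ψ (-ε)) = -ε := h3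
      linarith
    rw [sub_eq_add_neg (1 / ψ ε), e1, e2]
    simp only [slope_def_field, Pi.add_apply, neg_zero, hψ0, sub_zero]
    ring

theorem continuous_koranyiDist : Continuous fun x : Heis × Heis => koranyiDist x.1 x.2 := by
  unfold koranyiDist koranyiNorm heisMul heisInv
  refine Continuous.rpow_const ?_ fun _ => Or.inr (by norm_num)
  have hc : Continuous fun z : ℂ => conj z := Complex.continuous_conj
  simp only
  fun_prop

theorem continuous_koranyiDist_right (p : Heis) : Continuous fun q => koranyiDist p q := by
  unfold koranyiDist koranyiNorm heisMul heisInv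
  refine Continuous.rpow_const ?_ fun _ => Or.inr (by norm_num)
  have hc : Continuous fun z : ℂ => conj z := Complex.continuous_conj
  simp only
  fun_prop

namespace LegendrianLoop

variable {γ : ℝ → ℂ × ℂ} {P : ℝ}

/-- Points at parameter distance between `η` and half a period are at bounded-below distance. -/
theorem exists_koranyiDist_lower (h : LegendrianLoop γ P) {s : ℝ} (hs : (γ s).2 ≠ 1) {η : ℝ}
    (hη : 0 < η) : ∃ c > 0, ∀ x, η ≤ |x| → |x| ≤ P / 2 → (γ (s + x)).2 ≠ 1 →
      c ≤ koranyiDist (sphereToHeis (γ s)) (sphereToHeis (γ (s + x))) := by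
  have hP := h.period_pos
  have hcomp : IsCompact {x : ℝ | η ≤ |x| ∧ |x| ≤ P / 2} := by
    refine (isCompact_Icc (a := -(P / 2)) (b := P / 2)).of_isClosed_subset ?_
      fun x hx => abs_le.1 hx.2
    exact (isClosed_le continuous_const continuous_abs).inter
      (isClosed_le continuous_abs continuous_const)
  have hcont : Continuous fun x => ‖gap γ s (s + x)‖ :=
    (h.contDiff_gap.continuous.comp (f := fun x : ℝ => (s, s + x)) (by fun_prop)).norm
  have hpos : ∀ x ∈ {x : ℝ | η ≤ |x| ∧ |x| ≤ P / 2}, 0 < ‖gap γ s (s + x)‖ := by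
    rintro x ⟨hx1, hx2⟩
    refine h.gap_pos_lt ?_ ?_
    · simp only [strip, Set.mem_ofPred_eq, sub_add_cancel_left, abs_neg]; linarith
    · intro e
      have : x = 0 := by linarith
      rw [this, abs_zero] at hx1
      linarith
  obtain ⟨c, hc, hle⟩ := hcomp.exists_forall_le' hcont.continuousOn hpos
  have n1 := norm_pos_iff.2 (sub_ne_zero.2 hs.symm)
  refine ⟨√(c / ‖1 - (γ s).2‖), Real.sqrt_pos.2 (by positivity), fun x hx1 hx2 hx => ?_⟩
  refine Real.sqrt_le_iff.2 ⟨koranyiDist_nonneg _ _, ?_⟩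
  have n2 := norm_pos_iff.2 (sub_ne_zero.2 hx.symm)
  have hle2 : ‖1 - (γ (s + x)).2‖ ≤ 2 := by
    have h1 : ‖(γ (s + x)).2‖ ≤ 1 := by
      have := h.onSphere (s + x)
      unfold hermSq at this
      nlinarith [sq_nonneg ‖(γ (s + x)).1‖, norm_nonneg (γ (s + x)).2]
    calc ‖1 - (γ (s + x)).2‖ ≤ ‖(1 : ℂ)‖ + ‖(γ (s + x)).2‖ := norm_sub_le _ _
      _ ≤ 2 := by rw [norm_one]; linarith
  rw [h.koranyiDist_sq hs hx, div_le_div_iff₀ n1 (by positivity)]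
  have h3 := hle x ⟨hx1, hx2⟩
  have h4 : c * ‖1 - (γ (s + x)).2‖ ≤ ‖gap γ s (s + x)‖ * 2 := by gcongr
  nlinarith

theorem continuousAt_cross_add (h : LegendrianLoop γ P) (s : ℝ) {x : ℝ} (hx0 : x ≠ 0)
    (hx : |x| ≤ P / 2) : ContinuousAt (fun x => cross γ s (s + x)) x := by
  have hP := h.period_pos
  have hne : γ s ≠ γ (s + x) := fun e => hx0 (by
    have := h.eq_of_abs_sub_lt (s := s) (t := s + x)
      (by rw [sub_add_cancel_left, abs_neg]; linarith) e
    linarith)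
  have h1 := h.continuousAt_cross (p := (s, s + x)) hne
  exact ContinuousAt.comp (g := fun p : ℝ × ℝ => cross γ p.1 p.2) (f := fun x : ℝ => (s, s + x))
    h1 (by fun_prop)

theorem hasDerivAt_halfLogDeriv_add (h : LegendrianLoop γ P) (s : ℝ) {x : ℝ} (hx0 : x ≠ 0)
    (hx : |x| ≤ P / 2) :
    HasDerivAt (fun x => (halfLogDeriv γ s (s + x)).re) (cross γ s (s + x)).re x := by
  have hP := h.period_pos
  have hne : γ s ≠ γ (s + x) := fun e => hx0 (by
    have := h.eq_of_abs_sub_lt (s := s) (t := s + x)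
      (by rw [sub_add_cancel_left, abs_neg]; linarith) e
    linarith)
  exact Complex.reCLM.hasFDerivAt.comp_hasDerivAt x
    ((h.hasDerivAt_halfLogDeriv hne).comp_const_add s x)

theorem integral_re_cross (h : LegendrianLoop γ P) (s : ℝ) {b c : ℝ} (hbc : b ≤ c)
    (h0 : ∀ x ∈ Set.Icc b c, x ≠ 0 ∧ |x| ≤ P / 2) :
    ∫ x in b..c, (cross γ s (s + x)).re =
      (halfLogDeriv γ s (s + c)).re - (halfLogDeriv γ s (s + b)).re := by
  refine intervalIntegral.integral_eq_sub_of_hasDerivAt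
    (f := fun x => (halfLogDeriv γ s (s + x)).re) (fun x hx => ?_) ?_
  · rw [Set.uIcc_of_le hbc] at hx
    exact h.hasDerivAt_halfLogDeriv_add s (h0 x hx).1 (h0 x hx).2
  · refine ContinuousOn.intervalIntegrable fun x hx => ?_
    rw [Set.uIcc_of_le hbc] at hx
    exact (Complex.continuous_re.continuousAt.comp
      (h.continuousAt_cross_add s (h0 x hx).1 (h0 x hx).2)).continuousWithinAt

/-- The integral of `|cross|` is the integral of the density plus boundary terms. -/
theorem integral_norm_cross (h : LegendrianLoop γ P) (s : ℝ) {b c : ℝ} (hbc : b ≤ c)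
    (h0 : ∀ x ∈ Set.Icc b c, x ≠ 0 ∧ |x| ≤ P / 2) :
    ∫ x in b..c, ‖cross γ s (s + x)‖ = (∫ x in b..c, density γ s (s + x)) +
      ((halfLogDeriv γ s (s + c)).re - (halfLogDeriv γ s (s + b)).re) := by
  rw [← h.integral_re_cross s hbc h0, ← intervalIntegral.integral_add]
  · simp [density]
  · exact ((h.continuous_density_right s).comp (by fun_prop)).intervalIntegrable _ _
  · refine ContinuousOn.intervalIntegrable fun x hx => ?_
    rw [Set.uIcc_of_le hbc] at hx
    exact (Complex.continuous_re.continuousAt.comp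
      (h.continuousAt_cross_add s (h0 x hx).1 (h0 x hx).2)).continuousWithinAt

theorem integral_density_shift (h : LegendrianLoop γ P) (s : ℝ) :
    ∫ x in (-(P / 2))..(P / 2), density γ s (s + x) = ∫ t in (0 : ℝ)..P, density γ s t := by
  rw [intervalIntegral.integral_comp_add_left (density γ s) s]
  have := (h.density_periodic_right s).intervalIntegral_add_eq (s + -(P / 2)) 0
  rw [zero_add] at this
  rw [← this]
  congr 1
  ring

/-- The finite part of the integral of `|cross|` along the loop: its real part contributes only
boundary terms, which the counterterm cancels. -/
theorem tendsto_truncated_cross (h : LegendrianLoop γ P) (s : ℝ) {ψ : ℝ → ℝ} {ρ₀ : ℝ}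
    (hψ : Tendsto ψ (𝓝 0) (𝓝 0))
    (hsgn : ∀ᶠ ε in 𝓝[>] 0, ψ (-ε) < 0 ∧ 0 < ψ ε)
    (hlim : Tendsto (fun ε => 1 / ψ ε - 1 / ψ (-ε) - 2 * ρ₀ / ε) (𝓝[>] 0) (𝓝 0)) :
    Tendsto (fun ε => (∫ x in (-(P / 2))..(ψ (-ε)), ‖cross γ s (s + x)‖) +
      (∫ x in (ψ ε)..(P / 2), ‖cross γ s (s + x)‖) - 2 * ρ₀ / ε) (𝓝[>] 0)
      (𝓝 (∫ t in (0 : ℝ)..P, density γ s t)) := by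
  have hP := h.period_pos
  have hψp : Tendsto ψ (𝓝[>] 0) (𝓝 0) := hψ.mono_left nhdsWithin_le_nhds
  have hψm : Tendsto (fun ε => ψ (-ε)) (𝓝[>] 0) (𝓝 0) := by
    refine hψ.comp ?_
    have : Tendsto (fun ε : ℝ => -ε) (𝓝 0) (𝓝 0) := by
      simpa using (continuous_neg (G := ℝ)).tendsto 0
    exact this.mono_left nhdsWithin_le_nhds
  have hdc : Continuous fun x => density γ s (s + x) :=
    (h.continuous_density_right s).comp (by fun_prop)
  have hreg : ContinuousAt (fun x => (regLogDeriv γ (s, s + x)).re) 0 := by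
    have hm : (s, s + (0 : ℝ)) ∈ strip P := by simp [strip, hP]
    have h1 : ContinuousAt (regLogDeriv γ) (s, s + (0 : ℝ)) :=
      (h.contDiffOn_regLogDeriv.continuousOn).continuousAt ((isOpen_strip P).mem_nhds hm)
    exact Complex.continuous_re.continuousAt.comp
      (h1.comp (f := fun x : ℝ => (s, s + x)) (by fun_prop))
  have hprim : Continuous fun b => ∫ x in (-(P / 2))..b, density γ s (s + x) :=
    intervalIntegral.continuous_primitive (fun _ _ => hdc.intervalIntegrable _ _) _
  have hprim2 : Continuous fun b => ∫ x in b..(P / 2), density γ s (s + x) := by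
    simp only [fun b => intervalIntegral.integral_symm (P / 2) b
      (f := fun x => density γ s (s + x)) (μ := volume)]
    exact (intervalIntegral.continuous_primitive (fun _ _ => hdc.intervalIntegrable _ _) _).neg
  have t1 := (hprim.tendsto 0).comp hψm
  have t2 := (hprim2.tendsto 0).comp hψp
  have t3 := (hreg.tendsto.comp hψm).sub (hreg.tendsto.comp hψp)
  have t4 := ((t1.add t2).add t3).add hlim
  rw [intervalIntegral.integral_add_adjacent_intervals (hdc.intervalIntegrable _ _)
    (hdc.intervalIntegrable _ _), h.integral_density_shift, sub_self, add_zero, add_zero] at t4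
  refine t4.congr' ?_
  have hsmall : ∀ᶠ ε in 𝓝[>] (0 : ℝ), -(P / 2) < ψ (-ε) ∧ ψ ε < P / 2 :=
    (hψm.eventually_const_lt (by linarith)).and (hψp.eventually_lt_const (by linarith))
  filter_upwards [hsgn, hsmall] with ε ⟨hm, hp⟩ ⟨hm2, hp2⟩
  rw [h.integral_norm_cross s hm2.le fun x hx => ⟨by linarith [hx.2], abs_le.2
      ⟨hx.1, by linarith [hx.2]⟩⟩,
    h.integral_norm_cross s hp2.le fun x hx => ⟨by linarith [hx.1], abs_le.2
      ⟨by linarith [hx.1], hx.2⟩⟩]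
  have hper : halfLogDeriv γ s (s + P / 2) = halfLogDeriv γ s (s + -(P / 2)) := by
    rw [← h.halfLogDeriv_periodic_right s (s + -(P / 2))]; congr 1; ring
  have hre : ∀ x : ℝ, x ≠ 0 → |x| < P →
      (halfLogDeriv γ s (s + x)).re = -(1 / x) + (regLogDeriv γ (s, s + x)).re := by
    intro x hx0 hxP
    rw [h.halfLogDeriv_eq (by simpa [strip] using hxP) (by simpa using hx0), Complex.add_re]
    congr 1
    have : (1 : ℂ) / ((s : ℂ) - ((s + x : ℝ) : ℂ)) = ((-(1 / x) : ℝ) : ℂ) := by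
      push_cast
      rw [sub_add_cancel_left, div_neg]
    rw [this, Complex.ofReal_re]
  rw [hper, hre _ hm.ne (by rw [abs_lt]; constructor <;> linarith),
    hre _ hp.ne' (by rw [abs_lt]; constructor <;> linarith)]
  simp only [Function.comp_def]
  ring

end LegendrianLoop

namespace LegendrianKnot

variable (K : LegendrianKnot)

theorem setIntegral_koranyiDist {s : ℝ} (hs : (K.loop s).2 ≠ 1) (ε : ℝ) :
    ∫ q in {q : Heis | ε ≤ koranyiDist (sphereToHeis (K.loop s)) q},
      1 / koranyiDist (sphereToHeis (K.loop s)) q ^ 2 ∂K.arcLength =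
    (∫ x in (-(K.period / 2))..(K.period / 2),
      {x | ε ≤ koranyiDist (sphereToHeis (K.loop s)) (sphereToHeis (K.loop (s + x)))}.indicator
        (fun x => ‖cross K.loop s (s + x)‖) x) / arcSpeed K.loop s := by
  have hL := K.isLegendrianLoop
  have hd : Continuous fun q => koranyiDist (sphereToHeis (K.loop s)) q :=
    continuous_koranyiDist_right _
  have hm : MeasurableSet {q : Heis | ε ≤ koranyiDist (sphereToHeis (K.loop s)) q} :=
    (isClosed_le continuous_const hd).measurableSet
  have hf : Measurable fun q => 1 / koranyiDist (sphereToHeis (K.loop s)) q ^ 2 :=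
    (hd.measurable.pow_const 2).const_div 1
  rw [← integral_indicator hm, arcLength_eq, integral_map
    K.measurable_sphereToHeis_loop.aemeasurable (hf.indicator hm).aestronglyMeasurable,
    integral_paramLength]
  set F : ℝ → ℝ := fun u =>
    {u | ε ≤ koranyiDist (sphereToHeis (K.loop s)) (sphereToHeis (K.loop u))}.indicator
      (fun u => ‖cross K.loop s u‖) u with hF
  have hper : Function.Periodic F K.period := by
    intro u
    simp only [hF, Set.indicator, Set.mem_ofPred_eq, hL.periodic u, hL.cross_periodic_right]
  have hA : 0 < arcSpeed K.loop s :=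
    div_pos (norm_pos_iff.2 (hL.speed_ne_zero s)) (norm_pos_iff.2 (sub_ne_zero.2 hs.symm))
  have e1 : ∀ᵐ u ∂volume.restrict (Set.Ico 0 K.period), arcSpeed K.loop u •
      {q : Heis | ε ≤ koranyiDist (sphereToHeis (K.loop s)) q}.indicator
        (fun q => 1 / koranyiDist (sphereToHeis (K.loop s)) q ^ 2) (sphereToHeis (K.loop u)) =
      F u / arcSpeed K.loop s := by
    filter_upwards [ae_restrict_of_ae K.ae_loop_snd_ne_one] with u hu
    simp only [hF, Set.indicator, Set.mem_ofPred_eq, smul_eq_mul]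
    split_ifs
    · rw [hL.norm_cross_eq hs hu]
      field_simp
    · simp
  rw [integral_congr_ae e1, integral_div, integral_Ico_eq_integral_Ioc,
    ← intervalIntegral.integral_of_le K.period_pos.le]
  congr 1
  have e2 := hper.intervalIntegral_add_eq 0 (s + -(K.period / 2))
  rw [zero_add] at e2
  rw [e2]
  have e3 : s + -(K.period / 2) + K.period = s + K.period / 2 := by ring
  rw [e3, ← intervalIntegral.integral_comp_add_left F s]
  rfl

theorem hasPotential {s : ℝ} (hs : (K.loop s).2 ≠ 1) :
    K.HasPotential (sphereToHeis (K.loop s))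
      ((∫ t in (0 : ℝ)..K.period, density K.loop s t) / arcSpeed K.loop s) := by
  have hL := K.isLegendrianLoop
  have hP := K.period_pos
  have hA : 0 < arcSpeed K.loop s :=
    div_pos (norm_pos_iff.2 (hL.speed_ne_zero s)) (norm_pos_iff.2 (sub_ne_zero.2 hs.symm))
  have hmem : (s, s + (0 : ℝ)) ∈ strip K.period := by simp [strip, hP]
  have hρ : ContDiffAt ℝ ∞ (fun x => quotDist K.loop (s, s + x)) 0 := by
    have := hL.contDiffAt_quotDist hmem hs (by simpa using hs)
    exact this.comp (f := fun x : ℝ => (s, s + x)) (0 : ℝ) (by fun_prop)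
  have hρ0 : quotDist K.loop (s, s + 0) = arcSpeed K.loop s := by
    rw [add_zero, hL.quotDist_self]
  obtain ⟨ψ, η, hη, hηa, hψ, hev, hlim⟩ := exists_sublevel_interval hρ
    (by rw [hρ0]; exact hA) (half_pos hP)
  rw [hρ0] at hlim
  have hT := (hL.tendsto_truncated_cross s hψ (hev.mono fun ε h => ⟨h.1, h.2.1⟩) hlim).div_const
    (arcSpeed K.loop s)
  unfold HasPotential
  refine hT.congr' ?_
  obtain ⟨c, hc, hlow⟩ := hL.exists_koranyiDist_lower hs hη
  have hεc : ∀ᶠ ε in 𝓝[>] (0 : ℝ), 0 < ε ∧ ε < c :=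
    (eventually_mem_nhdsWithin).and (nhdsWithin_le_nhds (eventually_lt_nhds hc))
  filter_upwards [hev, hεc] with ε ⟨hm, hp, hm2, hp2, hiff⟩ ⟨hε, hεc⟩
  rw [K.setIntegral_koranyiDist hs, sub_div]
  congr 1
  swap
  · field_simp
  congr 1
  set G : ℝ → ℝ :=
    {x | ε ≤ koranyiDist (sphereToHeis (K.loop s)) (sphereToHeis (K.loop (s + x)))}.indicator
      (fun x => ‖cross K.loop s (s + x)‖) with hG
  have hae : ∀ᵐ x : ℝ, (K.loop (s + x)).2 ≠ 1 :=
    (measurePreserving_add_left volume s).quasiMeasurePreserving.ae K.ae_loop_snd_ne_one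
  have hkey : ∀ x, |x| ≤ K.period / 2 → (K.loop (s + x)).2 ≠ 1 →
      (ε ≤ koranyiDist (sphereToHeis (K.loop s)) (sphereToHeis (K.loop (s + x))) ↔
        x ≤ ψ (-ε) ∨ ψ ε ≤ x) := by
    intro x hx hx1
    by_cases hxη : |x| ≤ η
    · rw [← hiff x hxη, hL.koranyiDist_eq hs hx1, sub_add_cancel_left, abs_neg, abs_mul,
        abs_of_nonneg (a := quotDist _ _) (Real.sqrt_nonneg _)]
    · push Not at hxη
      refine iff_of_true (hεc.le.trans (hlow x hxη.le hx hx1)) ?_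
      rcases lt_abs.1 hxη with h | h
      · right; linarith
      · left; linarith
  -- on the three pieces the integrand is `|cross|`, `0` and `|cross|`
  have hG1 : ∀ b c : ℝ, b ≤ c → -(K.period / 2) ≤ b → c ≤ K.period / 2 →
      (c ≤ ψ (-ε) ∨ ψ ε ≤ b) → ∀ᵐ x, x ∈ Set.uIoc b c → ‖cross K.loop s (s + x)‖ = G x := by
    intro b c hbc hb hc' hor
    filter_upwards [hae] with x hx hxI
    rw [Set.uIoc_of_le hbc] at hxI
    have hxa : |x| ≤ K.period / 2 := abs_le.2 ⟨by linarith [hxI.1], by linarith [hxI.2]⟩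
    have : x ∈ {x | ε ≤ koranyiDist (sphereToHeis (K.loop s)) (sphereToHeis (K.loop (s + x)))} :=
      (hkey x hxa hx).2 (hor.imp (fun h => hxI.2.trans h) fun h => h.trans hxI.1.le)
    rw [hG, Set.indicator_of_mem this]
  have hG0 : ∀ᵐ x, x ∈ Set.uIoc (ψ (-ε)) (ψ ε) → (0 : ℝ) = G x := by
    have hne : ∀ᵐ x : ℝ, x ≠ ψ ε := by
      rw [ae_iff]; simp
    filter_upwards [hae, hne] with x hx hxne hxI
    rw [Set.uIoc_of_le (by linarith)] at hxI
    have hxa : |x| ≤ K.period / 2 := abs_le.2 ⟨by linarith [hxI.1], by linarith [hxI.2]⟩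
    have : x ∉ {x | ε ≤ koranyiDist (sphereToHeis (K.loop s)) (sphereToHeis (K.loop (s + x)))} :=
      fun hcon => ((hkey x hxa hx).1 hcon).elim (fun h => by linarith [hxI.1])
        fun h => hxne (le_antisymm hxI.2 h)
    rw [hG, Set.indicator_of_notMem this]
  have a1 := hG1 (-(K.period / 2)) (ψ (-ε)) (by linarith) le_rfl (by linarith) (Or.inl le_rfl)
  have a2 := hG1 (ψ ε) (K.period / 2) (by linarith) (by linarith) le_rfl (Or.inr le_rfl)
  have hint : ∀ b c : ℝ, b ≤ c → (∀ x ∈ Set.Icc b c, x ≠ 0 ∧ |x| ≤ K.period / 2) →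
      IntervalIntegrable (fun x => ‖cross K.loop s (s + x)‖) volume b c := by
    intro b c hbc h0
    refine ContinuousOn.intervalIntegrable fun x hx => ?_
    rw [Set.uIcc_of_le hbc] at hx
    exact (hL.continuousAt_cross_add s (h0 x hx).1 (h0 x hx).2).norm.continuousWithinAt
  have i1 : IntervalIntegrable G volume (-(K.period / 2)) (ψ (-ε)) :=
    (hint _ _ (by linarith) fun x hx => ⟨by linarith [hx.2],
      abs_le.2 ⟨hx.1, by linarith [hx.2]⟩⟩).congr_ae ((ae_restrict_iff' measurableSet_uIoc).2 a1)
  have i2 : IntervalIntegrable G volume (ψ ε) (K.period / 2) :=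
    (hint _ _ (by linarith) fun x hx => ⟨by linarith [hx.1],
      abs_le.2 ⟨by linarith [hx.1], hx.2⟩⟩).congr_ae ((ae_restrict_iff' measurableSet_uIoc).2 a2)
  have i0 : IntervalIntegrable G volume (ψ (-ε)) (ψ ε) :=
    (intervalIntegrable_const (c := (0 : ℝ))).congr_ae
      ((ae_restrict_iff' measurableSet_uIoc).2 hG0)
  rw [← intervalIntegral.integral_add_adjacent_intervals (i1.trans i0) i2,
    ← intervalIntegral.integral_add_adjacent_intervals i1 i0,
    ← intervalIntegral.integral_congr_ae hG0, ← intervalIntegral.integral_congr_ae a1,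
    ← intervalIntegral.integral_congr_ae a2]
  simp

theorem stronglyMeasurable_truncated (ε : ℝ) :
    StronglyMeasurable fun p : Heis => (∫ q in {q : Heis | ε ≤ koranyiDist p q},
      1 / koranyiDist p q ^ 2 ∂K.arcLength) - 2 / ε := by
  have hm : MeasurableSet {x : Heis × Heis | ε ≤ koranyiDist x.1 x.2} :=
    (isClosed_le continuous_const continuous_koranyiDist).measurableSet
  have hf : Measurable fun x : Heis × Heis => 1 / koranyiDist x.1 x.2 ^ 2 :=
    (continuous_koranyiDist.measurable.pow_const 2).const_div 1
  have h1 := (Measurable.ite hm hf measurable_const :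
    Measurable fun x : Heis × Heis => if ε ≤ koranyiDist x.1 x.2 then
      1 / koranyiDist x.1 x.2 ^ 2 else (0 : ℝ)).stronglyMeasurable.integral_prod_right'
        (ν := K.arcLength)
  have e : (fun p : Heis => ∫ q in {q : Heis | ε ≤ koranyiDist p q},
      1 / koranyiDist p q ^ 2 ∂K.arcLength) = fun p : Heis => ∫ q, (if ε ≤ koranyiDist p q then
      1 / koranyiDist p q ^ 2 else (0 : ℝ)) ∂K.arcLength := by
    funext p
    have hp : MeasurableSet {q : Heis | ε ≤ koranyiDist p q} :=
      (isClosed_le continuous_const (continuous_koranyiDist_right p)).measurableSet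
    rw [← integral_indicator hp]
    simp only [Set.indicator_apply, Set.mem_ofPred_eq]
  have h2 : StronglyMeasurable fun p : Heis => ∫ q in {q : Heis | ε ≤ koranyiDist p q},
      1 / koranyiDist p q ^ 2 ∂K.arcLength := by rw [e]; exact h1
  exact h2.sub stronglyMeasurable_const

theorem measurable_heisToSphere : Measurable heisToSphere := by
  have h : Measurable siegel := by unfold siegel; fun_prop
  have e : heisToSphere = fun p =>
      (-(2 * Complex.I * p.1) / (1 + siegel p), 1 - 2 / (1 + siegel p)) := funext heisToSphere_eq
  rw [e]
  fun_prop

theorem ae_mem_carrier : ∀ᵐ p : Heis ∂K.arcLength, ((p : Heis) : OnePoint Heis) ∈ K.carrier := by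
  have hL := K.isLegendrianLoop
  have hcl : IsClosed (Set.range K.loop) := by
    rw [← hL.periodic.image_Icc hL.period_pos 0]
    exact (isCompact_Icc.image hL.smooth.continuous).isClosed
  have e : {p : Heis | (p : OnePoint Heis) ∈ K.carrier} = heisToSphere ⁻¹' Set.range K.loop := by
    ext p
    constructor
    · rintro ⟨t, ht⟩; exact ⟨t, by rw [loop, ht]; rfl⟩
    · rintro ⟨t, ht⟩; exact ⟨t, toSphere_injective ht⟩
  have hms : MeasurableSet {p : Heis | (p : OnePoint Heis) ∈ K.carrier} := by
    rw [e]; exact measurable_heisToSphere hcl.measurableSet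
  rw [arcLength_eq, ae_map_iff K.measurable_sphereToHeis_loop.aemeasurable hms]
  have h0 : ∀ᵐ t ∂volume.restrict (Set.Ico 0 K.period),
      ((sphereToHeis (K.loop t) : Heis) : OnePoint Heis) ∈ K.carrier := by
    filter_upwards [ae_restrict_of_ae K.ae_loop_snd_ne_one] with t ht
    exact ⟨t, (K.coe_sphereToHeis_loop ht).symm⟩
  exact (withDensity_absolutelyContinuous _ _).ae_le h0

/-- The energy of a knot through `∞`. -/
theorem hasEnergy_iff_of_mem (hK : OnePoint.infty ∈ K.carrier) (e : ℝ) :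
    K.HasEnergy e ↔ e = loopEnergy K.loop K.period := by
  have hL := K.isLegendrianLoop
  set v : ℝ → ℝ := fun s => (∫ t in (0 : ℝ)..K.period, density K.loop s t) / arcSpeed K.loop s
  -- any choice of the potential has the right integral
  have hV : ∀ V : Heis → ℝ,
      (∀ p : Heis, (p : OnePoint Heis) ∈ K.carrier → K.HasPotential p (V p)) →
      ∀ᵐ s ∂volume.restrict (Set.Ico 0 K.period),
        arcSpeed K.loop s • V (sphereToHeis (K.loop s)) =
          ∫ t in (0 : ℝ)..K.period, density K.loop s t := by
    intro V hV
    filter_upwards [ae_restrict_of_ae K.ae_loop_snd_ne_one] with s hs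
    have hA : arcSpeed K.loop s ≠ 0 :=
      (div_pos (norm_pos_iff.2 (hL.speed_ne_zero s))
        (norm_pos_iff.2 (sub_ne_zero.2 hs.symm))).ne'
    have hmem : ((sphereToHeis (K.loop s) : Heis) : OnePoint Heis) ∈ K.carrier :=
      ⟨s, (K.coe_sphereToHeis_loop hs).symm⟩
    have := tendsto_nhds_unique (hV _ hmem) (K.hasPotential hs)
    rw [this, smul_eq_mul]
    field_simp
  have hval : ∫ s in Set.Ico 0 K.period, (∫ t in (0 : ℝ)..K.period, density K.loop s t) =
      loopEnergy K.loop K.period := by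
    rw [loopEnergy, integral_Ico_eq_integral_Ioc, intervalIntegral.integral_of_le K.period_pos.le]
  have hint : IntegrableOn (fun s => ∫ t in (0 : ℝ)..K.period, density K.loop s t)
      (Set.Ico 0 K.period) :=
    (hL.continuous_integral_density.integrableOn_Icc).mono_set Set.Ico_subset_Icc_self
  constructor
  · rintro (⟨hK', -⟩ | ⟨-, V, hpot, hVi, rfl⟩)
    · exact absurd hK hK'
    · have hm := hVi.aestronglyMeasurable
      rw [arcLength_eq] at hm ⊢
      rw [integral_map K.measurable_sphereToHeis_loop.aemeasurable hm, integral_paramLength,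
        integral_congr_ae (hV V hpot), hval]
  · rintro rfl
    refine Or.inr ⟨hK, ?_⟩
    have hex : ∀ p : Heis, ∃ v : ℝ, (p : OnePoint Heis) ∈ K.carrier → K.HasPotential p v := by
      intro p
      by_cases hp : (p : OnePoint Heis) ∈ K.carrier
      · obtain ⟨s, hs⟩ := hp
        have h1 : (K.loop s).2 ≠ 1 := by
          rw [ne_eq, K.loop_snd_eq_one_iff, hs]; exact OnePoint.coe_ne_infty p
        have h2 : sphereToHeis (K.loop s) = p :=
          OnePoint.coe_injective ((K.coe_sphereToHeis_loop h1).trans hs)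
        exact ⟨_, fun _ => h2 ▸ K.hasPotential h1⟩
      · exact ⟨0, fun h => absurd h hp⟩
    choose V hpot using hex
    have hm : AEStronglyMeasurable V K.arcLength :=
      aestronglyMeasurable_of_tendsto_ae (𝓝[>] (0 : ℝ))
        (fun ε => (K.stronglyMeasurable_truncated ε).aestronglyMeasurable)
        (K.ae_mem_carrier.mono hpot)
    have hVi : Integrable V K.arcLength := by
      rw [arcLength_eq] at hm ⊢
      rw [integrable_map_measure hm K.measurable_sphereToHeis_loop.aemeasurable]
      rw [integrable_paramLength]
      exact hint.congr ((hV V hpot).mono fun s hs => hs.symm)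
    refine ⟨V, hpot, hVi, ?_⟩
    rw [arcLength_eq] at hm ⊢
    rw [integral_map K.measurable_sphereToHeis_loop.aemeasurable hm, integral_paramLength,
        integral_congr_ae (hV V hpot), hval]

end LegendrianKnot

/-! ### Meromorphic continuation of regularized integrals -/

/-- An integral `∫ exp (ζ X) w` is holomorphic where it converges absolutely. -/
theorem differentiableOn_integral_exp {α : Type*} [MeasurableSpace α] {μ : Measure α} {X : α → ℝ}
    {w : α → ℂ} {σ₀ : ℝ} (hX : AEStronglyMeasurable X μ) (hw : AEStronglyMeasurable w μ)
    (hint : ∀ σ : ℝ, σ₀ < σ → Integrable (fun a => Real.exp (σ * X a) * ‖w a‖) μ) :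
    DifferentiableOn ℂ (fun ζ : ℂ => ∫ a, Complex.exp (ζ * X a) * w a ∂μ) {ζ | σ₀ < ζ.re} := by
  intro ζ₀ hζ₀
  have hζ₀' : σ₀ < ζ₀.re := hζ₀
  obtain ⟨r, hr, hrσ⟩ : ∃ r : ℝ, 0 < r ∧ σ₀ < ζ₀.re - 2 * r :=
    ⟨(ζ₀.re - σ₀) / 4, by linarith, by linarith⟩
  have hXc : AEStronglyMeasurable (fun a => (X a : ℂ)) μ :=
    Complex.continuous_ofReal.comp_aestronglyMeasurable hX
  have hexp : ∀ ζ : ℂ, AEStronglyMeasurable (fun a => Complex.exp (ζ * X a)) μ := fun ζ =>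
    (by fun_prop : Continuous fun z : ℂ => Complex.exp (ζ * z)).comp_aestronglyMeasurable hXc
  have hnorm : ∀ (ζ : ℂ) (a : α), ‖Complex.exp (ζ * X a)‖ = Real.exp (ζ.re * X a) := fun ζ a => by
    rw [Complex.norm_exp, Complex.re_mul_ofReal]
  refine DifferentiableAt.differentiableWithinAt ?_
  have := hasDerivAt_integral_of_dominated_loc_of_deriv_le (𝕜 := ℂ) (μ := μ)
    (F := fun ζ a => Complex.exp (ζ * X a) * w a)
    (F' := fun ζ a => Complex.exp (ζ * X a) * X a * w a) (x₀ := ζ₀)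
    (bound := fun a => (1 / r) * (Real.exp ((ζ₀.re + 2 * r) * X a) * ‖w a‖ +
      Real.exp ((ζ₀.re - 2 * r) * X a) * ‖w a‖)) (Metric.ball_mem_nhds ζ₀ hr) ?_ ?_ ?_ ?_ ?_ ?_
  · exact this.2.differentiableAt
  · exact Eventually.of_forall fun ζ => (hexp ζ).mul hw
  · refine (integrable_norm_iff ((hexp ζ₀).mul hw)).1 ?_
    simpa only [Pi.mul_apply, norm_mul, hnorm] using hint ζ₀.re hζ₀'
  · exact ((hexp ζ₀).mul hXc).mul hw
  · refine Eventually.of_forall fun a ζ hζ => ?_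
    have hre : |ζ.re - ζ₀.re| < r := by
      have := Complex.abs_re_le_norm (ζ - ζ₀)
      rw [Complex.sub_re] at this
      exact this.trans_lt (by simpa [dist_eq_norm] using hζ)
    obtain ⟨h1, h2⟩ := abs_lt.1 hre
    rw [norm_mul, norm_mul, hnorm, Complex.norm_real, Real.norm_eq_abs, ← add_mul, ← mul_assoc]
    refine mul_le_mul_of_nonneg_right ?_ (norm_nonneg _)
    -- `r |X| ≤ exp (r |X|)` absorbs the factor `X`
    have h3 : r * |X a| ≤ Real.exp (r * |X a|) := by
      have := Real.add_one_le_exp (r * |X a|); linarith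
    have h4 : |X a| ≤ 1 / r * Real.exp (r * |X a|) := by
      rw [one_div, ← div_eq_inv_mul, le_div_iff₀ hr]; linarith
    calc Real.exp (ζ.re * X a) * |X a| ≤
        Real.exp (ζ.re * X a) * (1 / r * Real.exp (r * |X a|)) := by gcongr
      _ = 1 / r * Real.exp (ζ.re * X a + r * |X a|) := by rw [Real.exp_add]; ring
      _ ≤ _ := by
        gcongr
        rcases le_total 0 (X a) with h | h
        · rw [abs_of_nonneg h]
          refine le_trans (Real.exp_le_exp.2 ?_) (le_add_of_nonneg_right (Real.exp_pos _).le)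
          nlinarith
        · rw [abs_of_nonpos h]
          refine le_trans (Real.exp_le_exp.2 ?_) (le_add_of_nonneg_left (Real.exp_pos _).le)
          nlinarith
  · exact ((hint _ (by linarith)).add (hint _ hrσ)).const_mul _
  · refine Eventually.of_forall fun a ζ _ => ?_
    have h1 : HasDerivAt (fun ζ : ℂ => ζ * X a) (X a : ℂ) ζ := hasDerivAt_mul_const _
    exact (h1.cexp).mul_const (w a)

/-- The half-strip over which the regularized integrals are taken: a period in the first variable,
and `0 < x ≤ a` in the second. -/
def window (P a : ℝ) : Set (ℝ × ℝ) := Set.Ioc 0 P ×ˢ Set.Ioc 0 a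

/-- The region on which the data of the regularized integrals are smooth. -/
def slab (b : ℝ) : Set (ℝ × ℝ) := {p | |p.2| < b}

/-- The regularized integral of `xⁿ m` against `x ^ ζ * exp (ζ k)`. -/
def moment (P a : ℝ) (k : ℝ × ℝ → ℝ) (n : ℕ) (m : ℝ × ℝ → ℝ) (ζ : ℂ) : ℂ :=
  ∫ p in window P a, Complex.exp (ζ * ((Real.log p.2 + k p : ℝ) : ℂ)) *
    ((p.2 ^ n * m p : ℝ) : ℂ)

/-- The boundary term at `x = a` of an integration by parts. -/
def boundaryTerm (P a : ℝ) (k : ℝ × ℝ → ℝ) (n : ℕ) (m : ℝ × ℝ → ℝ) (ζ : ℂ) : ℂ :=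
  ∫ τ in Set.Ioc 0 P, Complex.exp (ζ * ((Real.log a + k (τ, a) : ℝ) : ℂ)) *
    ((a ^ (n + 1) * m (τ, a) : ℝ) : ℂ)

/-- The partial derivative in the second variable. -/
def partialSnd (f : ℝ × ℝ → ℝ) (p : ℝ × ℝ) : ℝ := fderiv ℝ f p (0, 1)

theorem isOpen_slab (b : ℝ) : IsOpen (slab b) := isOpen_lt (by fun_prop) (by fun_prop)

theorem measurableSet_window (P a : ℝ) : MeasurableSet (window P a) :=
  measurableSet_Ioc.prod measurableSet_Ioc

theorem contDiffOn_partialSnd {f : ℝ × ℝ → ℝ} {b : ℝ} (hf : ContDiffOn ℝ ∞ f (slab b)) :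
    ContDiffOn ℝ ∞ (partialSnd f) (slab b) :=
  (hf.fderiv_of_isOpen (isOpen_slab b) (by simp)).clm_apply contDiffOn_const

theorem hasDerivAt_partialSnd {f : ℝ × ℝ → ℝ} {b : ℝ} (hf : ContDiffOn ℝ ∞ f (slab b)) {τ x : ℝ}
    (hx : |x| < b) : HasDerivAt (fun x => f (τ, x)) (partialSnd f (τ, x)) x := by
  have h1 : DifferentiableAt ℝ f (τ, x) :=
    (hf.differentiableOn (by simp)).differentiableAt ((isOpen_slab b).mem_nhds hx)
  exact h1.hasFDerivAt.comp_hasDerivAt x ((hasDerivAt_const x τ).prodMk (hasDerivAt_id x))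

section

variable {P a b : ℝ} {k m : ℝ × ℝ → ℝ}

theorem closedWindow_subset (hab : a < b) : Set.Icc 0 P ×ˢ Set.Icc 0 a ⊆ slab b := fun p hp => by
  change |p.2| < b
  rw [abs_of_nonneg hp.2.1]
  exact hp.2.2.trans_lt hab

theorem window_subset : window P a ⊆ Set.Icc 0 P ×ˢ Set.Icc 0 a :=
  Set.prod_mono Set.Ioc_subset_Icc_self Set.Ioc_subset_Icc_self

theorem exists_bound_window (hab : a < b) (hm : ContinuousOn m (slab b)) :
    ∃ C, ∀ p ∈ Set.Icc 0 P ×ˢ Set.Icc 0 a, |m p| ≤ C :=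
  (isCompact_Icc.prod isCompact_Icc).exists_bound_of_continuousOn
    (hm.mono (closedWindow_subset hab))

theorem aestronglyMeasurable_window (hab : a < b) (hm : ContinuousOn m (slab b)) :
    AEStronglyMeasurable m (volume.restrict (window P a)) :=
  (hm.mono (window_subset.trans (closedWindow_subset hab))).aestronglyMeasurable
    (measurableSet_window P a)

theorem aestronglyMeasurable_exponent (hab : a < b) (hk : ContinuousOn k (slab b)) :
    AEStronglyMeasurable (fun p : ℝ × ℝ => Real.log p.2 + k p) (volume.restrict (window P a)) :=
  (Real.measurable_log.comp measurable_snd).aestronglyMeasurable.add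
    (aestronglyMeasurable_window hab hk)

theorem aestronglyMeasurable_weight (hab : a < b) (hm : ContinuousOn m (slab b)) (n : ℕ) :
    AEStronglyMeasurable (fun p : ℝ × ℝ => ((p.2 ^ n * m p : ℝ) : ℂ))
      (volume.restrict (window P a)) :=
  Complex.continuous_ofReal.comp_aestronglyMeasurable
    ((measurable_snd.pow_const n).aestronglyMeasurable.mul (aestronglyMeasurable_window hab hm))

theorem integrable_rpow_window (ha : 0 < a) {r : ℝ} (hr : -1 < r) :
    Integrable (fun p : ℝ × ℝ => p.2 ^ r) (volume.restrict (window P a)) := by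
  have h1 : Integrable (fun x : ℝ => x ^ r) (volume.restrict (Set.Ioc 0 a)) :=
    (intervalIntegrable_iff_integrableOn_Ioc_of_le ha.le).1
      (intervalIntegral.intervalIntegrable_rpow' hr)
  have h2 : Integrable (fun _ : ℝ => (1 : ℝ)) (volume.restrict (Set.Ioc 0 P)) := integrable_const _
  have h3 := h2.mul_prod h1
  rw [Measure.prod_restrict] at h3
  simpa [window, Measure.volume_eq_prod] using h3

/-- Absolute convergence, when the weight vanishes to order `j` at `x = 0`. -/
theorem integrable_moment (ha : 0 < a) (hab : a < b) (hk : ContinuousOn k (slab b))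
    (hm : ContinuousOn m (slab b)) (n j : ℕ) {C : ℝ}
    (hC : ∀ p ∈ Set.Icc 0 P ×ˢ Set.Icc 0 a, |m p| ≤ C * p.2 ^ j) {σ : ℝ}
    (hσ : -(n : ℝ) - j - 1 < σ) :
    Integrable (fun p : ℝ × ℝ => Real.exp (σ * (Real.log p.2 + k p)) *
      ‖((p.2 ^ n * m p : ℝ) : ℂ)‖) (volume.restrict (window P a)) := by
  obtain ⟨D, hD⟩ : ∃ D, ∀ p ∈ Set.Icc 0 P ×ˢ Set.Icc 0 a, |Real.exp (σ * k p)| ≤ D :=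
    exists_bound_window hab ((continuousOn_const (c := σ)).mul hk).rexp
  refine Integrable.mono' ((integrable_rpow_window ha (r := σ + n + j) (by linarith)).const_mul
    (D * C)) ?_ ?_
  · exact ((by fun_prop : Continuous fun x : ℝ => Real.exp (σ * x)).comp_aestronglyMeasurable
      (aestronglyMeasurable_exponent hab hk)).mul (aestronglyMeasurable_weight hab hm n).norm
  · rw [ae_restrict_iff' (measurableSet_window P a)]
    refine Eventually.of_forall fun p hp => ?_
    have hx : 0 < p.2 := hp.2.1
    have h1 := hD p (window_subset hp)
    have h2 := hC p (window_subset hp)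
    rw [abs_of_pos (Real.exp_pos _)] at h1
    rw [norm_mul, norm_norm, Complex.norm_real, Real.norm_of_nonneg (Real.exp_pos _).le,
      Real.norm_eq_abs, abs_mul, abs_of_nonneg (by positivity : 0 ≤ p.2 ^ n), mul_add,
      Real.exp_add]
    have h3 : Real.exp (σ * Real.log p.2) = p.2 ^ σ := by
      rw [Real.rpow_def_of_pos hx, mul_comm]
    have hD0 : 0 ≤ D := (Real.exp_pos _).le.trans h1
    calc Real.exp (σ * Real.log p.2) * Real.exp (σ * k p) * (p.2 ^ n * |m p|)
        ≤ p.2 ^ σ * D * (p.2 ^ n * (C * p.2 ^ j)) := by rw [h3]; gcongr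
      _ = D * C * p.2 ^ (σ + n + j) := by
        rw [Real.rpow_add hx, Real.rpow_add hx, Real.rpow_natCast, Real.rpow_natCast]; ring

theorem differentiableOn_moment (ha : 0 < a) (hab : a < b) (hk : ContinuousOn k (slab b))
    (hm : ContinuousOn m (slab b)) (n j : ℕ) {C : ℝ}
    (hC : ∀ p ∈ Set.Icc 0 P ×ˢ Set.Icc 0 a, |m p| ≤ C * p.2 ^ j) :
    DifferentiableOn ℂ (moment P a k n m) {ζ | -(n : ℝ) - j - 1 < ζ.re} :=
  differentiableOn_integral_exp (aestronglyMeasurable_exponent hab hk)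
    (aestronglyMeasurable_weight hab hm n) fun _ hσ => integrable_moment ha hab hk hm n j hC hσ

theorem integrable_moment_complex_of_le (ha : 0 < a) (hab : a < b) (hk : ContinuousOn k (slab b))
    (hm : ContinuousOn m (slab b)) (n j : ℕ) {C : ℝ}
    (hC : ∀ p ∈ Set.Icc 0 P ×ˢ Set.Icc 0 a, |m p| ≤ C * p.2 ^ j) {ζ : ℂ}
    (hζ : -(n : ℝ) - j - 1 < ζ.re) :
    Integrable (fun p : ℝ × ℝ => Complex.exp (ζ * ((Real.log p.2 + k p : ℝ) : ℂ)) *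
      ((p.2 ^ n * m p : ℝ) : ℂ)) (volume.restrict (window P a)) := by
  have h1 := integrable_moment ha hab hk hm n j hC hζ
  refine (integrable_norm_iff ?_).1 (h1.congr (Eventually.of_forall fun p => ?_))
  · exact ((by fun_prop : Continuous fun x : ℝ => Complex.exp (ζ * x)).comp_aestronglyMeasurable
      (aestronglyMeasurable_exponent hab hk)).mul (aestronglyMeasurable_weight hab hm n)
  · simp only [norm_mul, Complex.norm_exp, Complex.re_mul_ofReal]

theorem integrable_moment_complex (ha : 0 < a) (hab : a < b) (hk : ContinuousOn k (slab b))
    (hm : ContinuousOn m (slab b)) (n : ℕ) {ζ : ℂ} (hζ : -(n : ℝ) - 1 < ζ.re) :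
    Integrable (fun p : ℝ × ℝ => Complex.exp (ζ * ((Real.log p.2 + k p : ℝ) : ℂ)) *
      ((p.2 ^ n * m p : ℝ) : ℂ)) (volume.restrict (window P a)) := by
  obtain ⟨C, hC⟩ := exists_bound_window (P := P) hab hm
  exact integrable_moment_complex_of_le ha hab hk hm n 0 (C := C) (by simpa using hC)
    (by simpa using hζ)

theorem differentiable_boundaryTerm (ha : 0 ≤ a) (hab : a < b) (hk : ContinuousOn k (slab b))
    (hm : ContinuousOn m (slab b)) (n : ℕ) : Differentiable ℂ (boundaryTerm P a k n m) := by
  have hsub : ∀ τ : ℝ, (τ, a) ∈ slab b := fun τ => by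
    change |a| < b; rwa [abs_of_nonneg ha]
  have hc : ∀ {f : ℝ × ℝ → ℝ}, ContinuousOn f (slab b) → Continuous fun τ : ℝ => f (τ, a) :=
    fun {f} hf => hf.comp_continuous (by fun_prop) hsub
  have hX : Continuous fun τ : ℝ => Real.log a + k (τ, a) := continuous_const.add (hc hk)
  have hw : Continuous fun τ : ℝ => ((a ^ (n + 1) * m (τ, a) : ℝ) : ℂ) :=
    Complex.continuous_ofReal.comp (continuous_const.mul (hc hm))
  intro ζ
  have h := differentiableOn_integral_exp (μ := volume.restrict (Set.Ioc 0 P))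
    (σ₀ := ζ.re - 1) hX.aestronglyMeasurable hw.aestronglyMeasurable fun σ _ => by
      have : Continuous fun τ => Real.exp (σ * (Real.log a + k (τ, a))) *
          ‖((a ^ (n + 1) * m (τ, a) : ℝ) : ℂ)‖ :=
        (Real.continuous_exp.comp (continuous_const.mul hX)).mul hw.norm
      exact this.integrableOn_Icc.mono_set Set.Ioc_subset_Icc_self
  exact (h.differentiableAt ((isOpen_lt continuous_const Complex.continuous_re).mem_nhds
    (by simp)))

/-- Integration by parts in `x`. -/
theorem moment_recurrence (ha : 0 < a) (hab : a < b) (hk : ContDiffOn ℝ ∞ k (slab b))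
    (hm : ContDiffOn ℝ ∞ m (slab b)) (n : ℕ) {ζ : ℂ} (hζ : -(n : ℝ) - 1 < ζ.re) :
    (ζ + n + 1) * moment P a k n m ζ = boundaryTerm P a k n m ζ -
      ζ * moment P a k (n + 1) (fun p => partialSnd k p * m p) ζ -
      moment P a k (n + 1) (partialSnd m) ζ := by
  have hkx := (contDiffOn_partialSnd hk).continuousOn
  have hmx := (contDiffOn_partialSnd hm).continuousOn
  have hζ' : -((n + 1 : ℕ) : ℝ) - 1 < ζ.re := by push_cast; linarith
  set E : ℝ × ℝ → ℂ := fun p => Complex.exp (ζ * ((Real.log p.2 + k p : ℝ) : ℂ)) with hE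
  have i0 : Integrable (fun p => (ζ + n + 1) * (E p * ((p.2 ^ n * m p : ℝ) : ℂ)))
      (volume.restrict (window P a)) :=
    (integrable_moment_complex ha hab hk.continuousOn hm.continuousOn n hζ).const_mul _
  have i1 : Integrable (fun p => ζ * (E p *
      ((p.2 ^ (n + 1) * (partialSnd k p * m p) : ℝ) : ℂ))) (volume.restrict (window P a)) :=
    (integrable_moment_complex ha hab hk.continuousOn (hkx.mul hm.continuousOn)
      (n + 1) hζ').const_mul ζ
  have i2 : Integrable (fun p => E p * ((p.2 ^ (n + 1) * partialSnd m p : ℝ) : ℂ))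
      (volume.restrict (window P a)) :=
    integrable_moment_complex ha hab hk.continuousOn hmx (n + 1) hζ'
  have h01 : Integrable (fun p => (ζ + n + 1) * (E p * ((p.2 ^ n * m p : ℝ) : ℂ)) +
      ζ * (E p * ((p.2 ^ (n + 1) * (partialSnd k p * m p) : ℝ) : ℂ)))
      (volume.restrict (window P a)) := i0.add i1
  have hint : Integrable (fun p => (ζ + n + 1) * (E p * ((p.2 ^ n * m p : ℝ) : ℂ)) +
      ζ * (E p * ((p.2 ^ (n + 1) * (partialSnd k p * m p) : ℝ) : ℂ)) +
      E p * ((p.2 ^ (n + 1) * partialSnd m p : ℝ) : ℂ))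
      (volume.restrict (window P a)) := h01.add i2
  have key : ∫ p in window P a, ((ζ + n + 1) * (E p * ((p.2 ^ n * m p : ℝ) : ℂ)) +
      ζ * (E p * ((p.2 ^ (n + 1) * (partialSnd k p * m p) : ℝ) : ℂ)) +
      E p * ((p.2 ^ (n + 1) * partialSnd m p : ℝ) : ℂ)) = boundaryTerm P a k n m ζ := by
    have hvol : (volume : Measure (ℝ × ℝ)).restrict (window P a) =
        (volume.restrict (Set.Ioc 0 P)).prod (volume.restrict (Set.Ioc 0 a)) := by
      rw [window, Measure.volume_eq_prod, Measure.prod_restrict]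
    rw [hvol] at hint ⊢
    rw [integral_prod _ hint, boundaryTerm]
    refine integral_congr_ae ?_
    filter_upwards [hint.prod_right_ae, ae_restrict_mem measurableSet_Ioc] with τ hτ hτm
    rw [← intervalIntegral.integral_of_le ha.le]
    set Φ : ℝ → ℂ := fun x => E (τ, x) * ((x ^ (n + 1) * m (τ, x) : ℝ) : ℂ) with hΦ
    have hder : ∀ x, 0 < x → x < b → HasDerivAt Φ
        ((ζ + n + 1) * (E (τ, x) * ((x ^ n * m (τ, x) : ℝ) : ℂ)) +
        ζ * (E (τ, x) * ((x ^ (n + 1) * (partialSnd k (τ, x) * m (τ, x)) : ℝ) : ℂ)) +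
        E (τ, x) * ((x ^ (n + 1) * partialSnd m (τ, x) : ℝ) : ℂ)) x := by
      intro x hx hxb
      have hxb' : |x| < b := by rwa [abs_of_pos hx]
      have h1 := (((Real.hasDerivAt_log hx.ne').add (hasDerivAt_partialSnd hk (τ := τ) hxb')
        ).ofReal_comp.const_mul ζ).cexp
      have h2 := ((hasDerivAt_pow (n + 1) x).mul
        (hasDerivAt_partialSnd hm (τ := τ) hxb')).ofReal_comp
      refine (h1.mul h2).congr_deriv ?_
      have hxc : (x : ℂ) ≠ 0 := by exact_mod_cast hx.ne'
      simp only [hE, Pi.add_apply, Pi.mul_apply]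
      push_cast
      field_simp
      ring
    have hlim0 : Tendsto Φ (𝓝[>] 0) (𝓝 0) := by
      obtain ⟨C, hC⟩ := exists_bound_window (P := P) hab hm.continuousOn
      obtain ⟨D, hD⟩ : ∃ D, ∀ p ∈ Set.Icc 0 P ×ˢ Set.Icc 0 a, |Real.exp (ζ.re * k p)| ≤ D :=
        exists_bound_window hab ((continuousOn_const (c := ζ.re)).mul hk.continuousOn).rexp
      have hpow : Tendsto (fun x : ℝ => D * C * x ^ (ζ.re + (n + 1 : ℕ))) (𝓝[>] 0) (𝓝 0) := by
        have : Tendsto (fun x : ℝ => x ^ (ζ.re + (n + 1 : ℕ))) (𝓝[>] 0) (𝓝 0) := by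
          have hpos : 0 < ζ.re + (n + 1 : ℕ) := by push_cast; linarith
          have := (Real.continuousAt_rpow_const 0 _ (Or.inr hpos.le)).tendsto
          rw [Real.zero_rpow hpos.ne'] at this
          exact this.mono_left nhdsWithin_le_nhds
        simpa using this.const_mul (D * C)
      refine squeeze_zero_norm' ?_ hpow
      have hmem : ∀ᶠ x in 𝓝[>] (0 : ℝ), 0 < x ∧ x < a :=
        (eventually_mem_nhdsWithin).and (nhdsWithin_le_nhds (eventually_lt_nhds ha))
      filter_upwards [hmem] with x ⟨hx, hxa⟩
      have hp : (τ, x) ∈ Set.Icc 0 P ×ˢ Set.Icc 0 a := ⟨⟨hτm.1.le, hτm.2⟩, hx.le, hxa.le⟩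
      have h1 := hC _ hp
      have h2 := hD _ hp
      rw [abs_of_pos (Real.exp_pos _)] at h2
      have hD0 : 0 ≤ D := (Real.exp_pos _).le.trans h2
      have h3 : Real.exp (ζ.re * Real.log x) = x ^ ζ.re := by
        rw [Real.rpow_def_of_pos hx, mul_comm]
      simp only [hΦ, hE]
      rw [norm_mul, Complex.norm_exp, Complex.re_mul_ofReal, Complex.norm_real, Real.norm_eq_abs,
        abs_mul, abs_of_nonneg (by positivity : 0 ≤ x ^ (n + 1)), mul_add, Real.exp_add, h3,
        Real.rpow_add hx, Real.rpow_natCast]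
      calc x ^ ζ.re * Real.exp (ζ.re * k (τ, x)) * (x ^ (n + 1) * |m (τ, x)|)
          ≤ x ^ ζ.re * D * (x ^ (n + 1) * C) := by gcongr
        _ = D * C * (x ^ ζ.re * x ^ (n + 1)) := by ring
    have hlima : Tendsto Φ (𝓝[<] a) (𝓝 (Φ a)) :=
      (hder a ha hab).continuousAt.tendsto.mono_left nhdsWithin_le_nhds
    have := intervalIntegral.integral_eq_sub_of_hasDerivAt_of_tendsto ha
      (fun x hx => hder x hx.1 (hx.2.trans hab))
      ((intervalIntegrable_iff_integrableOn_Ioc_of_le ha.le).2 hτ) hlim0 hlima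
    rw [this, sub_zero]
  rw [integral_add h01 i2, integral_add i0 i1, integral_const_mul, integral_const_mul] at key
  rw [← key]
  simp only [moment]
  ring

end

section

variable {P a b : ℝ} {k m : ℝ × ℝ → ℝ}

theorem isOpen_re_gt (c : ℝ) : IsOpen {ζ : ℂ | c < ζ.re} :=
  isOpen_lt continuous_const Complex.continuous_re

theorem isPreconnected_re_gt (c : ℝ) : IsPreconnected {ζ : ℂ | c < ζ.re} :=
  (convex_halfSpace_re_gt c).isPreconnected

/-- Holomorphic functions on a half-plane that agree on a smaller half-plane agree. -/
theorem eq_of_eq_on_halfPlane {f g : ℂ → ℂ} {c c' : ℝ}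
    (hf : DifferentiableOn ℂ f {ζ | c < ζ.re}) (hg : DifferentiableOn ℂ g {ζ | c < ζ.re})
    (h : ∀ ζ : ℂ, c' < ζ.re → f ζ = g ζ) {ζ : ℂ} (hζ : c < ζ.re) : f ζ = g ζ := by
  have hz : c < ((max c c' + 1 : ℝ) : ℂ).re := by
    rw [Complex.ofReal_re]; linarith [le_max_left c c']
  refine (hf.analyticOnNhd (isOpen_re_gt c)).eqOn_of_preconnected_of_eventuallyEq
    (hg.analyticOnNhd (isOpen_re_gt c)) (isPreconnected_re_gt c) hz ?_ hζ
  have : ((max c c' + 1 : ℝ) : ℂ) ∈ {ζ : ℂ | c' < ζ.re} := by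
    change c' < _; rw [Complex.ofReal_re]; linarith [le_max_right c c']
  filter_upwards [(isOpen_re_gt c').mem_nhds this] with ζ hζ using h ζ hζ

/-- Dividing by `Γ(ζ + n + 1)` turns the recurrence into one without denominators, so that it
continues the quotient holomorphically one unit further to the left at each step. -/
theorem exists_continuation_step (ha : 0 < a) (hab : a < b) (hk : ContDiffOn ℝ ∞ k (slab b))
    (N : ℕ) :
    ∀ (n : ℕ) (m : ℝ × ℝ → ℝ), ContDiffOn ℝ ∞ m (slab b) →
      ∃ F : ℂ → ℂ, DifferentiableOn ℂ F {ζ | -(N : ℝ) - n - 1 < ζ.re} ∧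
        ∀ ζ : ℂ, -(n : ℝ) - 1 < ζ.re →
          F ζ = moment P a k n m ζ * (Complex.Gamma (ζ + n + 1))⁻¹ := by
  have hΓ : ∀ c : ℂ, Differentiable ℂ fun ζ : ℂ => (Complex.Gamma (ζ + c))⁻¹ := fun c =>
    Complex.differentiable_one_div_Gamma.comp (differentiable_id.add_const c)
  induction N with
  | zero =>
    intro n m hm
    obtain ⟨C, hC⟩ := exists_bound_window (P := P) hab hm.continuousOn
    have h1 := differentiableOn_moment ha hab hk.continuousOn hm.continuousOn n 0
      (C := C) (by simpa using hC)
    refine ⟨fun ζ => moment P a k n m ζ * (Complex.Gamma (ζ + (n + 1)))⁻¹, ?_, fun ζ _ => ?_⟩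
    · refine DifferentiableOn.mul (h1.mono fun ζ hζ => ?_) (hΓ _).differentiableOn
      simpa using hζ
    · simp only [add_assoc]
  | succ N ih =>
    intro n m hm
    have hkm : ContDiffOn ℝ ∞ (fun p => partialSnd k p * m p) (slab b) :=
      (contDiffOn_partialSnd hk).mul hm
    obtain ⟨F₁, hF₁, e₁⟩ := ih (n + 1) _ hkm
    obtain ⟨F₂, hF₂, e₂⟩ := ih (n + 1) _ (contDiffOn_partialSnd hm)
    refine ⟨fun ζ => boundaryTerm P a k n m ζ * (Complex.Gamma (ζ + (n + 2)))⁻¹ - ζ * F₁ ζ - F₂ ζ,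
      ?_, fun ζ hζ => ?_⟩
    · have hset : {ζ : ℂ | -((N + 1 : ℕ) : ℝ) - n - 1 < ζ.re} =
          {ζ : ℂ | -(N : ℝ) - (n + 1 : ℕ) - 1 < ζ.re} := by
        ext ζ; simp only [Set.mem_ofPred_eq]; push_cast; constructor <;> intro h <;> linarith
      rw [hset]
      exact (((differentiable_boundaryTerm ha.le hab hk.continuousOn hm.continuousOn n).mul
        (hΓ _)).differentiableOn.sub (differentiableOn_id.mul hF₁)).sub hF₂
    · have hζ' : -((n + 1 : ℕ) : ℝ) - 1 < ζ.re := by push_cast; linarith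
      have hG := Complex.one_div_Gamma_eq_self_mul_one_div_Gamma_add_one (ζ + n + 1)
      have hr := moment_recurrence (P := P) ha hab hk hm n hζ
      simp only [e₁ ζ hζ', e₂ ζ hζ']
      rw [hG]
      have e : ζ + (n + 2) = ζ + n + 1 + 1 := by ring
      have e' : ζ + ((n + 1 : ℕ) : ℂ) + 1 = ζ + n + 1 + 1 := by push_cast; ring
      rw [e, e']
      linear_combination (-(Complex.Gamma (ζ + n + 1 + 1))⁻¹) * hr

theorem exists_entire_continuation (ha : 0 < a) (hab : a < b) (hk : ContDiffOn ℝ ∞ k (slab b))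
    (hm : ContDiffOn ℝ ∞ m (slab b)) :
    ∃ G : ℂ → ℂ, Differentiable ℂ G ∧
      ∀ ζ : ℂ, -1 < ζ.re → G ζ = moment P a k 0 m ζ * (Complex.Gamma (ζ + 1))⁻¹ := by
  choose F hF e using fun N => exists_continuation_step (P := P) ha hab hk N 0 m hm
  simp only [CharP.cast_eq_zero, sub_zero, neg_zero, zero_sub, add_zero] at hF e
  have hmono : ∀ {M N : ℕ}, M ≤ N → ∀ ζ : ℂ, -(M : ℝ) - 1 < ζ.re → F M ζ = F N ζ := by
    intro M N hMN ζ hζ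
    refine eq_of_eq_on_halfPlane (c := -(M : ℝ) - 1) (c' := -1) (hF M)
      ((hF N).mono fun ζ hζ => ?_) (fun ζ hζ => ?_) hζ
    · have : (M : ℝ) ≤ N := by exact_mod_cast hMN
      simp only [Set.mem_ofPred_eq] at hζ ⊢
      linarith
    · rw [e M ζ hζ, e N ζ hζ]
  have hlt : ∀ ζ : ℂ, ∀ N : ℕ, ⌈-ζ.re⌉₊ ≤ N → -(N : ℝ) - 1 < ζ.re := fun ζ N hN => by
    have h1 := Nat.le_ceil (-ζ.re)
    have h2 : (⌈-ζ.re⌉₊ : ℝ) ≤ N := by exact_mod_cast hN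
    linarith
  refine ⟨fun ζ => F ⌈-ζ.re⌉₊ ζ, fun ζ => ?_, fun ζ hζ => e _ ζ hζ⟩
  set N := ⌈-ζ.re⌉₊ with hN
  have h1 := hlt ζ N le_rfl
  have hd : DifferentiableAt ℂ (F N) ζ :=
    (hF N).differentiableAt ((isOpen_re_gt _).mem_nhds h1)
  refine hd.congr_of_eventuallyEq ?_
  filter_upwards [(isOpen_re_gt _).mem_nhds h1] with z hz
  rcases le_total ⌈-z.re⌉₊ N with h | h
  · exact hmono h z (hlt z _ le_rfl)
  · exact (hmono h z hz).symm

/-- A smooth function that vanishes on `x = 0` is `O(x)`. -/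
theorem exists_bound_of_vanish {f : ℝ × ℝ → ℝ} (hab : a < b) (hf : ContDiffOn ℝ ∞ f (slab b))
    (h0 : ∀ τ, f (τ, 0) = 0) :
    ∃ C, ∀ p ∈ Set.Icc 0 P ×ˢ Set.Icc 0 a, |f p| ≤ C * p.2 := by
  obtain ⟨C, hC⟩ := exists_bound_window (P := P) hab (contDiffOn_partialSnd hf).continuousOn
  refine ⟨C, fun ⟨τ, x⟩ hp => ?_⟩
  have := (convex_Icc 0 a).norm_image_sub_le_of_norm_hasDerivWithin_le
    (f := fun x => f (τ, x)) (f' := fun x => partialSnd f (τ, x)) (C := C) (x := 0) (y := x)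
    (fun y hy => (hasDerivAt_partialSnd hf
      (by rw [abs_of_nonneg hy.1]; exact hy.2.trans_lt hab)).hasDerivWithinAt)
    (fun y hy => hC (τ, y) ⟨hp.1, hy⟩) ⟨le_rfl, hp.2.1.trans hp.2.2⟩ hp.2
  simpa [h0, abs_of_nonneg hp.2.1] using this

theorem partialSnd_zero_of_even {f : ℝ × ℝ → ℝ} (hb : 0 < b) (hf : ContDiffOn ℝ ∞ f (slab b))
    (heven : ∀ τ x, f (τ, -x) = f (τ, x)) (τ : ℝ) : partialSnd f (τ, 0) = 0 := by
  have h1 := hasDerivAt_partialSnd hf (τ := τ) (x := 0) (by simpa using hb)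
  have h2 : HasDerivAt (fun x => f (τ, -x)) (-partialSnd f (τ, 0)) 0 := by
    have h3 : HasDerivAt (fun x => f (τ, x)) (partialSnd f (τ, 0)) (-0) := by rwa [neg_zero]
    exact (h3.comp (0 : ℝ) (hasDerivAt_neg (0 : ℝ))).congr_deriv (by ring)
  simp only [heven] at h2
  linarith [h1.unique h2]

/-- A smooth even function is constant up to `O(x²)`. -/
theorem exists_bound_of_even {f : ℝ × ℝ → ℝ} (ha : 0 ≤ a) (hab : a < b)
    (hf : ContDiffOn ℝ ∞ f (slab b)) (heven : ∀ τ x, f (τ, -x) = f (τ, x)) :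
    ∃ C, ∀ p ∈ Set.Icc 0 P ×ˢ Set.Icc 0 a, |f p - f (p.1, 0)| ≤ C * p.2 ^ 2 := by
  obtain ⟨C, hC⟩ := exists_bound_of_vanish (P := P) hab (contDiffOn_partialSnd hf)
    (partialSnd_zero_of_even (ha.trans_lt hab) hf heven)
  refine ⟨C, fun ⟨τ, x⟩ hp => ?_⟩
  have hx0 : 0 ≤ x := hp.2.1
  have := (convex_Icc 0 x).norm_image_sub_le_of_norm_hasDerivWithin_le
    (f := fun x => f (τ, x)) (f' := fun x => partialSnd f (τ, x)) (C := C * x) (x := 0) (y := x)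
    (fun y hy => (hasDerivAt_partialSnd hf
      (by rw [abs_of_nonneg hy.1]; exact (hy.2.trans hp.2.2).trans_lt hab)).hasDerivWithinAt)
    (fun y hy => ?_) ⟨le_rfl, hx0⟩ ⟨hx0, le_rfl⟩
  · rw [sub_zero, Real.norm_eq_abs, Real.norm_eq_abs, abs_of_nonneg hx0] at this
    exact this.trans_eq (by ring)
  · by_cases hC0 : 0 ≤ C
    · refine (hC (τ, y) ⟨hp.1, hy.1, hy.2.trans hp.2.2⟩).trans ?_
      exact mul_le_mul_of_nonneg_left hy.2 hC0
    · push Not at hC0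
      have h1 := hC (τ, y) ⟨hp.1, hy.1, hy.2.trans hp.2.2⟩
      have h2 := hC (τ, x) hp
      have h3 : 0 ≤ C * x := (abs_nonneg _).trans h2
      have h4 : x = 0 := le_antisymm (by nlinarith) hx0
      have h5 : y = 0 := le_antisymm (hy.2.trans h4.le) hy.1
      simp only [h4, h5, mul_zero] at h1 ⊢
      exact h1

/-- The finite part at `ζ = -2`, obtained by an integration by parts. -/
theorem integral_finitePart (ha : 0 < a) (hab : a < b) {f : ℝ × ℝ → ℝ}
    (hf : ContDiffOn ℝ ∞ f (slab b))
    (heven : ∀ τ x, f (τ, -x) = f (τ, x)) (h0 : ∀ τ, f (τ, 0) = 1) :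
    IntegrableOn (fun p : ℝ × ℝ => (f p - 1) / p.2 ^ 2) (window P a) ∧
    ∫ p in window P a, partialSnd f p / p.2 =
      (∫ p in window P a, (f p - 1) / p.2 ^ 2) + ∫ τ in Set.Ioc 0 P, (f (τ, a) - 1) / a := by
  have hfx := contDiffOn_partialSnd hf
  obtain ⟨C, hC⟩ := exists_bound_of_vanish (P := P) hab hfx
    (partialSnd_zero_of_even (ha.trans hab) hf heven)
  obtain ⟨D, hD⟩ := exists_bound_of_even (P := P) ha.le hab hf heven
  simp only [h0] at hD
  have hfin : volume (window P a) ≠ ⊤ := by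
    rw [window, Measure.volume_eq_prod, Measure.prod_prod]
    exact ENNReal.mul_ne_top (by simp) (by simp)
  have : IsFiniteMeasure (volume.restrict (window P a)) :=
    ⟨by rw [Measure.restrict_apply_univ]; exact hfin.lt_top⟩
  have m1 : AEStronglyMeasurable (fun p : ℝ × ℝ => partialSnd f p / p.2)
      (volume.restrict (window P a)) := by
    simp only [div_eq_mul_inv]
    exact (aestronglyMeasurable_window hab hfx.continuousOn).mul
      (measurable_snd.inv).aestronglyMeasurable
  have m2 : AEStronglyMeasurable (fun p : ℝ × ℝ => (f p - 1) / p.2 ^ 2)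
      (volume.restrict (window P a)) := by
    simp only [div_eq_mul_inv]
    exact ((aestronglyMeasurable_window hab hf.continuousOn).sub
      aestronglyMeasurable_const).mul ((measurable_snd.pow_const 2).inv).aestronglyMeasurable
  have i1 : IntegrableOn (fun p : ℝ × ℝ => partialSnd f p / p.2) (window P a) := by
    refine Integrable.of_bound m1 C ?_
    rw [ae_restrict_iff' (measurableSet_window P a)]
    refine Eventually.of_forall fun p hp => ?_
    have hx : 0 < p.2 := hp.2.1
    rw [norm_div, Real.norm_eq_abs, Real.norm_of_nonneg hx.le, div_le_iff₀ hx]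
    exact hC p (window_subset hp)
  have i2 : IntegrableOn (fun p : ℝ × ℝ => (f p - 1) / p.2 ^ 2) (window P a) := by
    refine Integrable.of_bound m2 D ?_
    rw [ae_restrict_iff' (measurableSet_window P a)]
    refine Eventually.of_forall fun p hp => ?_
    have hx : 0 < p.2 := hp.2.1
    rw [norm_div, Real.norm_eq_abs, Real.norm_of_nonneg (by positivity),
      div_le_iff₀ (by positivity)]
    exact hD p (window_subset hp)
  refine ⟨i2, ?_⟩
  rw [← sub_eq_iff_eq_add', ← integral_sub i1 i2]
  have hint : IntegrableOn (fun p : ℝ × ℝ => partialSnd f p / p.2 - (f p - 1) / p.2 ^ 2)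
    (window P a) := i1.sub i2
  have hvol : (volume : Measure (ℝ × ℝ)).restrict (window P a) =
      (volume.restrict (Set.Ioc 0 P)).prod (volume.restrict (Set.Ioc 0 a)) := by
    rw [window, Measure.volume_eq_prod, Measure.prod_restrict]
  rw [IntegrableOn, hvol] at hint
  rw [hvol, integral_prod _ hint]
  refine integral_congr_ae ?_
  filter_upwards [hint.prod_right_ae, ae_restrict_mem measurableSet_Ioc] with τ hτ hτm
  rw [← intervalIntegral.integral_of_le ha.le]
  have hder : ∀ x, 0 < x → x < b → HasDerivAt (fun x => (f (τ, x) - 1) / x)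
      (partialSnd f (τ, x) / x - (f (τ, x) - 1) / x ^ 2) x := by
    intro x hx hxb
    have h1 := ((hasDerivAt_partialSnd hf (τ := τ) (x := x) (by rwa [abs_of_pos hx])).sub_const
      1).div (hasDerivAt_id x) hx.ne'
    refine h1.congr_deriv ?_
    simp only [id]
    field_simp
  have hlim0 : Tendsto (fun x => (f (τ, x) - 1) / x) (𝓝[>] 0) (𝓝 0) := by
    have hlin : Tendsto (fun x : ℝ => D * x) (𝓝[>] 0) (𝓝 0) := by
      have : Tendsto (fun x : ℝ => D * x) (𝓝 0) (𝓝 (D * 0)) :=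
        (continuous_const.mul continuous_id).tendsto 0
      rw [mul_zero] at this
      exact this.mono_left nhdsWithin_le_nhds
    refine squeeze_zero_norm' ?_ hlin
    have hmem : ∀ᶠ x in 𝓝[>] (0 : ℝ), 0 < x ∧ x < a :=
      (eventually_mem_nhdsWithin).and (nhdsWithin_le_nhds (eventually_lt_nhds ha))
    filter_upwards [hmem] with x ⟨hx, hxa⟩
    rw [norm_div, Real.norm_eq_abs, Real.norm_of_nonneg hx.le, div_le_iff₀ hx]
    exact (hD (τ, x) ⟨⟨hτm.1.le, hτm.2⟩, hx.le, hxa.le⟩).trans_eq (by ring)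
  have hlima : Tendsto (fun x => (f (τ, x) - 1) / x) (𝓝[<] a) (𝓝 ((f (τ, a) - 1) / a)) :=
    (hder a ha hab).continuousAt.tendsto.mono_left nhdsWithin_le_nhds
  have := intervalIntegral.integral_eq_sub_of_hasDerivAt_of_tendsto ha
    (fun x hx => hder x hx.1 (hx.2.trans hab))
    ((intervalIntegrable_iff_integrableOn_Ioc_of_le ha.le).2 hτ) hlim0 hlima
  rw [this, sub_zero]

/-- The regularized integral of an even density continues meromorphically to the plane; evenness
removes the pole at `-2`, where the value is a finite part. -/
theorem exists_meromorphic_continuation (hP : 0 ≤ P) (ha : 0 < a) (hab : a < b)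
    (hk : ContDiffOn ℝ ∞ k (slab b)) (hm : ContDiffOn ℝ ∞ m (slab b))
    (hke : ∀ τ x, k (τ, -x) = k (τ, x)) (hme : ∀ τ x, m (τ, -x) = m (τ, x))
    (h0 : ∀ τ, Real.exp (-2 * k (τ, 0)) * m (τ, 0) = 1) :
    ∃ B : ℂ → ℂ, MeromorphicOn B Set.univ ∧
      (∀ ζ : ℂ, -1 < ζ.re → B ζ = moment P a k 0 m ζ) ∧ AnalyticAt ℂ B (-2) ∧
      B (-2) = (((∫ p in window P a, (Real.exp (-2 * k p) * m p - 1) / p.2 ^ 2) - P / a : ℝ) : ℂ)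
      := by
  obtain ⟨G, hG, hGe⟩ := exists_entire_continuation (P := P) ha hab hk hm
  have hkx := contDiffOn_partialSnd hk
  have hmx := contDiffOn_partialSnd hm
  have hkm : ContDiffOn ℝ ∞ (fun p => partialSnd k p * m p) (slab b) := hkx.mul hm
  have hb := ha.trans hab
  obtain ⟨C₁, hC₁⟩ := exists_bound_of_vanish (P := P) hab hkm
    fun τ => by rw [partialSnd_zero_of_even hb hk hke, zero_mul]
  obtain ⟨C₂, hC₂⟩ := exists_bound_of_vanish (P := P) hab hmx (partialSnd_zero_of_even hb hm hme)
  -- the numerator `(ζ + 1) * moment` continues to `Re ζ > -3` since `∂ₓ k` and `∂ₓ m` are `O(x)`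
  have d1 := differentiableOn_moment ha hab hk.continuousOn hkm.continuousOn 1 1
    (C := C₁) (by simpa using hC₁)
  have d2 := differentiableOn_moment ha hab hk.continuousOn hmx.continuousOn 1 1
    (C := C₂) (by simpa using hC₂)
  have d0 := differentiable_boundaryTerm (P := P) ha.le hab hk.continuousOn hm.continuousOn 0
  have hset : {ζ : ℂ | -((1 : ℕ) : ℝ) - ((1 : ℕ) : ℝ) - 1 < ζ.re} = {ζ : ℂ | -3 < ζ.re} := by
    norm_num
  rw [hset] at d1 d2
  set num : ℂ → ℂ := fun ζ => boundaryTerm P a k 0 m ζ -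
      ζ * moment P a k 1 (fun p => partialSnd k p * m p) ζ - moment P a k 1 (partialSnd m) ζ
    with hnum
  have dnum : DifferentiableOn ℂ num {ζ | -3 < ζ.re} :=
    (d0.differentiableOn.sub (differentiableOn_id.mul d1)).sub d2
  have hΓ : ∀ c : ℂ, Differentiable ℂ fun ζ : ℂ => (Complex.Gamma (ζ + c))⁻¹ := fun c =>
    Complex.differentiable_one_div_Gamma.comp (differentiable_id.add_const c)
  have hrec : ∀ ζ : ℂ, -1 < ζ.re → (ζ + 1) * moment P a k 0 m ζ = num ζ := fun ζ hζ => by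
    have := moment_recurrence (P := P) ha hab hk hm 0 (ζ := ζ) (by simpa using hζ)
    simpa using this
  have hGnum : ∀ ζ : ℂ, -3 < ζ.re → G ζ = num ζ * (Complex.Gamma (ζ + 2))⁻¹ := by
    intro ζ hζ
    refine eq_of_eq_on_halfPlane (c := -3) (c' := -1) hG.differentiableOn
      (dnum.mul (hΓ 2).differentiableOn) (fun ζ hζ => ?_) hζ
    rw [hGe ζ hζ, Complex.one_div_Gamma_eq_self_mul_one_div_Gamma_add_one (ζ + 1), Pi.mul_apply,
      ← hrec ζ hζ]
    have e : ζ + 1 + 1 = ζ + 2 := by ring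
    rw [e]; ring
  set B₀ : ℂ → ℂ := fun ζ => num ζ / (ζ + 1) with hB₀
  have hB₀an : AnalyticAt ℂ B₀ (-2) := by
    have h1 : AnalyticAt ℂ num (-2) :=
      dnum.analyticAt ((isOpen_re_gt (-3)).mem_nhds (by change (-3 : ℝ) < (-2 : ℂ).re; norm_num))
    exact h1.div (analyticAt_id.add analyticAt_const) (by norm_num)
  refine ⟨Function.update (fun ζ => Complex.Gamma (ζ + 1) * G ζ) (-2) (B₀ (-2)), ?_, ?_, ?_, ?_⟩
  · intro ζ _
    have h1 : MeromorphicAt (fun ζ => Complex.Gamma (ζ + 1) * G ζ) ζ := by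
      have h2 : MeromorphicAt (fun ζ : ℂ => ((Complex.Gamma (ζ + 1))⁻¹)⁻¹) ζ :=
        ((hΓ 1).analyticAt ζ).meromorphicAt.inv
      simp only [inv_inv] at h2
      exact h2.mul (hG.analyticAt ζ).meromorphicAt
    exact MeromorphicAt.update h1 _ _
  · intro ζ hζ
    have hne : ζ ≠ -2 := by
      rintro rfl; norm_num at hζ
    rw [Function.update_of_ne hne, hGe ζ hζ]
    have hΓ0 : Complex.Gamma (ζ + 1) ≠ 0 := by
      refine Complex.Gamma_ne_zero_of_re_pos ?_
      simp; linarith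
    field_simp
  · refine hB₀an.congr ?_
    filter_upwards [Metric.ball_mem_nhds (-2 : ℂ) one_pos] with ζ hζ
    by_cases hne : ζ = -2
    · rw [hne, Function.update_self]
    rw [Function.update_of_ne hne]
    have hdist : ‖ζ + 2‖ < 1 := by simpa [dist_eq_norm] using hζ
    have hre : |ζ.re + 2| < 1 := by
      have := (Complex.abs_re_le_norm (ζ + 2)).trans_lt hdist
      simpa using this
    obtain ⟨hl, hu⟩ := abs_lt.1 hre
    have hΓ0 : Complex.Gamma (ζ + 2) ≠ 0 := by
      refine Complex.Gamma_ne_zero fun j hj => hne ?_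
      rw [hj, norm_neg, Complex.norm_natCast] at hdist
      have : j = 0 := by
        have : (j : ℝ) < 1 := hdist
        exact Nat.lt_one_iff.1 (by exact_mod_cast this)
      rw [this, Nat.cast_zero, neg_zero] at hj
      linear_combination hj
    have h1 : ζ + 1 ≠ 0 := by
      intro h
      have := congrArg Complex.re h
      simp at this; linarith
    have h2 := Complex.Gamma_add_one (ζ + 1) h1
    have e : ζ + 1 + 1 = ζ + 2 := by ring
    rw [e] at h2
    rw [hGnum ζ (by linarith), hB₀, h2]
    rw [h2] at hΓ0
    have h3 := right_ne_zero_of_mul hΓ0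
    field_simp
  · rw [Function.update_self]
    set f : ℝ × ℝ → ℝ := fun p => Real.exp (-2 * k p) * m p with hf
    have hfc : ContDiffOn ℝ ∞ f (slab b) := ((contDiffOn_const.mul hk).exp).mul hm
    obtain ⟨-, hfp⟩ := integral_finitePart (P := P) ha hab hfc
      (fun τ x => by simp only [hf, hke, hme]) h0
    have hexp : ∀ {x : ℝ} (y : ℝ), 0 < x →
        Complex.exp (-2 * ((Real.log x + y : ℝ) : ℂ)) = ((Real.exp (-2 * y) / x ^ 2 : ℝ) : ℂ) := by
      intro x y hx
      have e : (-2 * ((Real.log x + y : ℝ) : ℂ)) = ((-2 * y - 2 * Real.log x : ℝ) : ℂ) := by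
        push_cast; ring
      rw [e, ← Complex.ofReal_exp, Real.exp_sub, two_mul (Real.log x), Real.exp_add,
        Real.exp_log hx, sq]
    have i1 := (integrable_moment_complex_of_le (P := P) (ζ := -2) ha hab hk.continuousOn
      hkm.continuousOn 1 1 (C := C₁) (by simpa using hC₁) (by norm_num)).const_mul (-2)
    have i2 := integrable_moment_complex_of_le (P := P) (ζ := -2) ha hab hk.continuousOn
      hmx.continuousOn 1 1 (C := C₂) (by simpa using hC₂) (by norm_num)
    have hM : (-2) * moment P a k 1 (fun p => partialSnd k p * m p) (-2) +
        moment P a k 1 (partialSnd m) (-2) =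
        ((∫ p in window P a, partialSnd f p / p.2 : ℝ) : ℂ) := by
      rw [moment, moment, ← integral_const_mul, ← integral_add i1 i2, ← integral_complex_ofReal]
      refine setIntegral_congr_fun (measurableSet_window P a) fun p hp => ?_
      have hx : 0 < p.2 := hp.2.1
      have hxb : |p.2| < b := by rw [abs_of_pos hx]; exact hp.2.2.trans_lt hab
      have h1 : HasDerivAt (fun x => f (p.1, x)) _ p.2 :=
        ((hasDerivAt_partialSnd hk (τ := p.1) hxb).const_mul (-2)).exp.mul
          (hasDerivAt_partialSnd hm (τ := p.1) hxb)
      have h2 := (hasDerivAt_partialSnd hfc (τ := p.1) hxb).unique h1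
      have hxc : (p.2 : ℂ) ≠ 0 := by exact_mod_cast hx.ne'
      simp only [hexp _ hx]
      rw [h2]
      push_cast
      field_simp
    have hb' : boundaryTerm P a k 0 m (-2) =
        ((∫ τ in Set.Ioc 0 P, f (τ, a) / a : ℝ) : ℂ) := by
      rw [boundaryTerm, ← integral_complex_ofReal]
      refine setIntegral_congr_fun measurableSet_Ioc fun τ _ => ?_
      have hac : (a : ℂ) ≠ 0 := by exact_mod_cast ha.ne'
      simp only [hexp _ ha, hf]
      push_cast
      field_simp
    have hc : Continuous fun τ : ℝ => f (τ, a) := hfc.continuousOn.comp_continuous (by fun_prop)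
      fun τ => by change |a| < b; rwa [abs_of_pos ha]
    have hlast : ∫ τ in Set.Ioc 0 P, (f (τ, a) - 1) / a =
        (∫ τ in Set.Ioc 0 P, f (τ, a) / a) - P / a := by
      simp only [sub_div]
      rw [integral_sub]
      · simp [hP]; field_simp
      · exact (hc.div_const a).integrableOn_Icc.mono_set Set.Ioc_subset_Icc_self
      · exact integrableOn_const (by simp)
    rw [hlast] at hfp
    have hval : B₀ (-2) = ((-2) * moment P a k 1 (fun p => partialSnd k p * m p) (-2) +
        moment P a k 1 (partialSnd m) (-2)) - boundaryTerm P a k 0 m (-2) := by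
      simp only [hB₀, hnum]
      have : (-2 + 1 : ℂ) = -1 := by norm_num
      rw [this]
      ring
    rw [hval, hM, hb', hfp]
    push_cast
    ring

end

/-! ### Integrals over the torus in symmetric coordinates -/

theorem integrableOn_abs_rpow {σ a : ℝ} (hσ : -1 < σ) (ha : 0 ≤ a) :
    IntegrableOn (fun x : ℝ => |x| ^ σ) (Set.Ioc (-a) a) := by
  rw [← intervalIntegrable_iff_integrableOn_Ioc_of_le (by linarith)]
  have h1 : IntervalIntegrable (fun x : ℝ => |x| ^ σ) volume 0 a := by
    refine (intervalIntegral.intervalIntegrable_rpow' hσ).congr_ae ?_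
    refine (ae_restrict_mem measurableSet_uIoc).mono fun x hx => ?_
    rw [Set.uIoc_of_le ha] at hx
    simp only [abs_of_pos hx.1]
  have h2 : IntervalIntegrable (fun x : ℝ => |x| ^ σ) volume (-a) 0 := by
    rw [IntervalIntegrable.iff_comp_neg]
    simpa using h1.symm
  exact h2.trans h1

theorem integrable_shear {E : Type*} [NormedAddCommGroup E] {F : ℝ → ℝ → E} {P C σ : ℝ}
    {A : Set ℝ} (hP : 0 ≤ P) (hA : A ⊆ Set.Ioc (-(P / 2)) (P / 2))
    (hA' : MeasurableSet A) {u v : ℝ → ℝ → ℝ} (huv : ∀ s x, v s x = u s x + x ∨ v s x = u s x - x)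
    (hm : StronglyMeasurable fun p : ℝ × ℝ => F (u p.1 p.2) (v p.1 p.2)) (hσ : -1 < σ)
    (hF : ∀ s t, s ≠ t → |s - t| ≤ P / 2 → ‖F s t‖ ≤ C * |s - t| ^ σ) :
    Integrable (fun p : ℝ × ℝ => F (u p.1 p.2) (v p.1 p.2))
      ((volume.restrict (Set.Ioc 0 P)).prod (volume.restrict A)) := by
  have h1 : Integrable (fun x : ℝ => C * |x| ^ σ) (volume.restrict A) :=
    ((integrableOn_abs_rpow hσ (by linarith)).mono_set hA).const_mul C
  have h2 : Integrable (fun p : ℝ × ℝ => C * |p.2| ^ σ)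
      ((volume.restrict (Set.Ioc 0 P)).prod (volume.restrict A)) := by
    exact h1.comp_snd _
  refine h2.mono' hm.aestronglyMeasurable ?_
  rw [Measure.prod_restrict]
  have hne : ∀ᵐ p : ℝ × ℝ ∂(volume.prod volume).restrict (Set.Ioc 0 P ×ˢ A), p.2 ≠ 0 := by
    refine ae_restrict_of_ae ?_
    exact (Measure.quasiMeasurePreserving_snd (μ := volume) (ν := volume)).ae
      (compl_mem_ae_iff.2 (by simp : volume {(0 : ℝ)} = 0))
  filter_upwards [ae_restrict_mem (measurableSet_Ioc.prod hA'), hne] with p hp hp0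
  have hx := hA hp.2
  have hx' : |p.2| ≤ P / 2 := abs_le.2 ⟨hx.1.le, hx.2⟩
  have e : |u p.1 p.2 - v p.1 p.2| = |p.2| := by
    rcases huv p.1 p.2 with h | h <;> rw [h]
    · rw [sub_add_cancel_left, abs_neg]
    · rw [sub_sub_cancel]
  have := hF (u p.1 p.2) (v p.1 p.2) (fun h => hp0 (by rw [h] at e; simpa using e.symm))
    (by rw [e]; exact hx')
  rwa [e] at this

/-- A function that is invariant under simultaneous shifts of both variables by `P` is controlled
near the diagonal by its values on a compact part of the strip. -/
theorem exists_bound_of_periodic {E : Type*} [NormedAddCommGroup E] {F : ℝ → ℝ → E}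
    {W : ℝ × ℝ → ℝ} {P σ : ℝ} (hP : 0 < P)
    (hper : ∀ s t, F (s + P) (t + P) = F s t) (hW : ContinuousOn W (strip P))
    (hF : ∀ s t, s ≠ t → |s - t| ≤ P / 2 → ‖F s t‖ ≤ W (s, t) * |s - t| ^ σ) :
    ∃ C, ∀ s t, s ≠ t → |s - t| ≤ P / 2 → ‖F s t‖ ≤ C * |s - t| ^ σ := by
  have hcomp : IsCompact ((fun p : ℝ × ℝ => (p.1, p.1 - p.2)) ''
      (Set.Icc 0 P ×ˢ Set.Icc (-(P / 2)) (P / 2))) :=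
    (isCompact_Icc.prod isCompact_Icc).image (by fun_prop)
  have hsub : ((fun p : ℝ × ℝ => (p.1, p.1 - p.2)) ''
      (Set.Icc 0 P ×ˢ Set.Icc (-(P / 2)) (P / 2))) ⊆ strip P := by
    rintro _ ⟨p, hp, rfl⟩
    have := abs_le.2 hp.2
    simp only [strip, Set.mem_ofPred_eq, sub_sub_cancel]
    linarith
  obtain ⟨C, hC⟩ := hcomp.exists_bound_of_continuousOn (hW.mono hsub)
  refine ⟨C, fun s t hne hst => ?_⟩
  have hp : Function.Periodic (fun r => F r (t - s + r)) P := fun r => by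
    simp only
    rw [← add_assoc, hper]
  obtain ⟨r, hr, e⟩ := hp.exists_mem_Ico₀ hP s
  simp only [sub_add_cancel] at e
  have hrr : r - (t - s + r) = s - t := by ring
  have h1 := hF r (t - s + r) (fun h => hne (sub_eq_zero.1 (by rw [← hrr, ← h, sub_self])))
    (by rwa [hrr])
  have h2 := hC (r, t - s + r) ⟨(r, s - t), ⟨⟨hr.1, hr.2.le⟩, abs_le.1 hst⟩, by
    simp only [Prod.mk.injEq, true_and]; ring⟩
  rw [e]
  rw [hrr] at h1
  exact h1.trans (mul_le_mul_of_nonneg_right ((le_abs_self _).trans h2) (by positivity))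

section Torus

variable {E : Type*} [NormedAddCommGroup E] [NormedSpace ℝ E] {F : ℝ → ℝ → E} {P C σ : ℝ}

theorem integral_period_shift {f : ℝ → E} {P : ℝ} (hP : 0 < P) (hf : Function.Periodic f P)
    (s : ℝ) : ∫ t in Set.Ioc 0 P, f t = ∫ x in Set.Ioc (-(P / 2)) (P / 2), f (s + x) := by
  have h1 := hf.intervalIntegral_add_eq 0 (s + -(P / 2))
  have h2 := intervalIntegral.integral_comp_add_left (a := -(P / 2)) (b := P / 2) f s
  rw [zero_add, show s + -(P / 2) + P = s + P / 2 by ring] at h1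
  rw [← intervalIntegral.integral_of_le hP.le, ← intervalIntegral.integral_of_le (by linarith),
    h1, h2]

/-- Symmetric coordinates `(s, t) = (τ + x / 2, τ - x / 2)`, for a function that is invariant under
simultaneous shifts of both variables by `P`. -/
theorem integral_symmetric (hP : 0 < P) (hper : ∀ s t, F (s + P) (t + P) = F s t)
    (hsymm : ∀ s t, F t s = F s t) (hm : StronglyMeasurable fun p : ℝ × ℝ => F p.1 p.2)
    (hσ : -1 < σ) (hF : ∀ s t, s ≠ t → |s - t| ≤ P / 2 → ‖F s t‖ ≤ C * |s - t| ^ σ) :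
    ∫ s in (0 : ℝ)..P, ∫ x in (-(P / 2))..(P / 2), F s (s + x) =
      (2 : ℝ) • ∫ p in window P (P / 2), F (p.1 + p.2 / 2) (p.1 - p.2 / 2) := by
  have i1 := integrable_shear (u := fun s _ => s) (v := fun s x => s + x) hP.le subset_rfl
    measurableSet_Ioc (fun s x => Or.inl rfl)
    (hm.comp_measurable (g := fun p : ℝ × ℝ => (p.1, p.1 + p.2)) (by fun_prop)) hσ hF
  have hm2 : StronglyMeasurable fun p : ℝ × ℝ => F (p.1 + p.2 / 2) (p.1 - p.2 / 2) :=
    hm.comp_measurable (g := fun p : ℝ × ℝ => (p.1 + p.2 / 2, p.1 - p.2 / 2)) (by fun_prop)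
  have i2 := integrable_shear (u := fun s x => s + x / 2) (v := fun s x => s - x / 2) hP.le
    (subset_rfl) measurableSet_Ioc (fun s x => Or.inr (by ring)) hm2 hσ hF
  have i3 := integrable_shear (u := fun s x => s + x / 2) (v := fun s x => s - x / 2) hP.le
    (Set.Ioc_subset_Ioc_left (by linarith : -(P / 2) ≤ 0)) measurableSet_Ioc
    (fun s x => Or.inr (by ring)) hm2 hσ hF
  set H : ℝ → E := fun x => ∫ τ in Set.Ioc 0 P, F (τ + x / 2) (τ - x / 2) with hH
  have hHe : ∀ x, H (-x) = H x := fun x => by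
    simp only [hH]
    refine integral_congr_ae (Eventually.of_forall fun τ => ?_)
    change F (τ + -x / 2) (τ - -x / 2) = _
    rw [hsymm]
    ring_nf
  have hHx : ∀ x, ∫ s in Set.Ioc 0 P, F s (s + x) = H x := fun x => by
    have hp : Function.Periodic (fun τ => F (τ + x / 2) (τ - x / 2)) P := fun τ => by
      simp only
      rw [← hper (τ + x / 2)]
      ring_nf
    have h1 := intervalIntegral.integral_comp_add_right (a := 0) (b := P)
      (fun τ => F (τ + x / 2) (τ - x / 2)) (x / 2)
    have h2 := hp.intervalIntegral_add_eq (x / 2) 0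
    rw [zero_add] at h2
    rw [zero_add, add_comm P, h2, intervalIntegral.integral_of_le hP.le,
      intervalIntegral.integral_of_le hP.le] at h1
    simp only [hH]
    rw [← h1]
    refine integral_congr_ae (Eventually.of_forall fun τ => ?_)
    change F τ (τ + x) = F (τ + x / 2 + x / 2) (τ + x / 2 - x / 2)
    rw [hsymm]
    ring_nf
  have hHi : IntegrableOn H (Set.Ioc (-(P / 2)) (P / 2)) := i2.integral_prod_right
  have e1 : ∫ s in (0 : ℝ)..P, ∫ x in (-(P / 2))..(P / 2), F s (s + x) =
      ∫ x in (-(P / 2))..(P / 2), H x := by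
    rw [intervalIntegral.integral_of_le hP.le, intervalIntegral.integral_of_le (by linarith)]
    simp only [intervalIntegral.integral_of_le (by linarith : -(P / 2) ≤ P / 2)]
    rw [integral_integral_swap i1]
    simp only [hHx]
  have hI : IntervalIntegrable H volume (-(P / 2)) (P / 2) :=
    (intervalIntegrable_iff_integrableOn_Ioc_of_le (by linarith)).2 hHi
  have hI1 : IntervalIntegrable H volume (-(P / 2)) 0 := hI.mono_set (by
    rw [Set.uIcc_of_le (by linarith), Set.uIcc_of_le (by linarith)]
    exact Set.Icc_subset_Icc_right (by linarith))
  have hI2 : IntervalIntegrable H volume 0 (P / 2) := hI.mono_set (by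
    rw [Set.uIcc_of_le (by linarith), Set.uIcc_of_le (by linarith)]
    exact Set.Icc_subset_Icc_left (by linarith))
  have e2 : ∫ x in (-(P / 2))..0, H x = ∫ x in 0..(P / 2), H x := by
    have := intervalIntegral.integral_comp_neg (a := 0) (b := P / 2) H
    simp only [hHe, neg_zero] at this
    exact this.symm
  have e3 : ∫ x in 0..(P / 2), H x =
      ∫ p in window P (P / 2), F (p.1 + p.2 / 2) (p.1 - p.2 / 2) := by
    rw [intervalIntegral.integral_of_le (by linarith), window, Measure.volume_eq_prod,
      ← Measure.prod_restrict, integral_prod_symm _ i3]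
  rw [e1, ← intervalIntegral.integral_add_adjacent_intervals hI1 hI2, e2, e3, two_smul]

/-- A doubly periodic function with an integrable singularity on the diagonal. -/
theorem integral_torus (hP : 0 < P) (hl : ∀ s t, F (s + P) t = F s t)
    (hr : ∀ s t, F s (t + P) = F s t)
    (hsymm : ∀ s t, F t s = F s t) (hm : StronglyMeasurable fun p : ℝ × ℝ => F p.1 p.2)
    (hσ : -1 < σ) (hF : ∀ s t, s ≠ t → |s - t| ≤ P / 2 → ‖F s t‖ ≤ C * |s - t| ^ σ) :
    ∫ p, F p.1 p.2 ∂((volume.restrict (Set.Ioc 0 P)).prod (volume.restrict (Set.Ioc 0 P))) =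
      (2 : ℝ) • ∫ p in window P (P / 2), F (p.1 + p.2 / 2) (p.1 - p.2 / 2) := by
  have i1 := integrable_shear (u := fun s _ => s) (v := fun s x => s + x) hP.le subset_rfl
    measurableSet_Ioc (fun s x => Or.inl rfl)
    (hm.comp_measurable (g := fun p : ℝ × ℝ => (p.1, p.1 + p.2)) (by fun_prop)) hσ hF
  have hi : Integrable (fun p : ℝ × ℝ => F p.1 p.2)
      ((volume.restrict (Set.Ioc 0 P)).prod (volume.restrict (Set.Ioc 0 P))) := by
    obtain ⟨j1, j2⟩ := (integrable_prod_iff i1.aestronglyMeasurable).1 i1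
    refine (integrable_prod_iff hm.aestronglyMeasurable).2 ⟨?_, ?_⟩
    · filter_upwards [j1] with s hs
      have h1 : IntervalIntegrable (fun x => F s (s + x)) volume (-(P / 2)) (P / 2) :=
        (intervalIntegrable_iff_integrableOn_Ioc_of_le (by linarith)).2 hs
      have h2 : IntervalIntegrable (F s) volume (s - P / 2) (s - P / 2 + P) := by
        have := h1.comp_add_left (-s)
        simp only [add_neg_cancel_left] at this
        convert this using 1 <;> ring
      have hper : Function.Periodic (F s) P := hr s
      exact (intervalIntegrable_iff_integrableOn_Ioc_of_le hP.le).1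
        (hper.intervalIntegrable hP.ne' h2 0 P)
    · refine j2.congr (Eventually.of_forall fun s => ?_)
      exact (integral_period_shift hP (f := fun t => ‖F s t‖) (fun t => by simp only [hr]) s).symm
  rw [integral_prod _ hi, ← integral_symmetric hP (fun s t => by rw [hl, hr]) hsymm hm hσ hF,
    intervalIntegral.integral_of_le hP.le]
  refine integral_congr_ae (Eventually.of_forall fun s => ?_)
  simp only
  rw [integral_period_shift hP (f := F s) (hr s) s, intervalIntegral.integral_of_le (by linarith)]

end Torus

/-- Uniqueness of the value of a meromorphic continuation. -/
theorem eq_of_meromorphic_of_eq_on_halfPlane {B₁ B₂ : ℂ → ℂ} (h1 : MeromorphicOn B₁ Set.univ)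
    (h2 : MeromorphicOn B₂ Set.univ) {σ : ℝ} (he : ∀ ζ : ℂ, σ < ζ.re → B₁ ζ = B₂ ζ) {ζ₀ : ℂ}
    (a1 : AnalyticAt ℂ B₁ ζ₀) (a2 : AnalyticAt ℂ B₂ ζ₀) : B₁ ζ₀ = B₂ ζ₀ := by
  have hd : MeromorphicOn (B₁ - B₂) Set.univ := h1.sub h2
  have htop : meromorphicOrderAt (B₁ - B₂) ((σ + 1 : ℝ) : ℂ) = ⊤ := by
    rw [meromorphicOrderAt_eq_top_iff]
    refine nhdsWithin_le_nhds ?_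
    have ho : IsOpen {ζ : ℂ | σ < ζ.re} := isOpen_lt continuous_const Complex.continuous_re
    filter_upwards [ho.mem_nhds (show ((σ + 1 : ℝ) : ℂ) ∈ {ζ : ℂ | σ < ζ.re} by
      simp only [Set.mem_ofPred_eq, Complex.ofReal_re]; linarith)] with ζ hζ
    exact sub_eq_zero.2 (he ζ hζ)
  have htop' : meromorphicOrderAt (B₁ - B₂) ζ₀ = ⊤ := by
    by_contra hne
    exact hd.meromorphicOrderAt_ne_top_of_isPreconnected isPreconnected_univ (Set.mem_univ ζ₀)
      (Set.mem_univ _) hne htop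
  rw [meromorphicOrderAt_eq_top_iff] at htop'
  have hc : ContinuousAt (B₁ - B₂) ζ₀ := (a1.sub a2).continuousAt
  have := tendsto_nhds_unique (hc.tendsto.mono_left nhdsWithin_le_nhds)
    (tendsto_const_nhds.congr' (htop'.mono fun _ h => h.symm))
  exact sub_eq_zero.1 this

/-! ### The energy of a closed knot -/

theorem quotDist_comm (γ : ℝ → ℂ × ℂ) (s t : ℝ) :
    quotDist γ (s, t) = quotDist γ (t, s) := by
  simp only [quotDist]
  rw [gapQuot_comm, RCLike.norm_conj, mul_comm ‖1 - (γ t).2‖]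

namespace LegendrianLoop

variable {γ : ℝ → ℂ × ℂ} {P : ℝ}

theorem contDiffAt_arcSpeed (h : LegendrianLoop γ P) {t : ℝ} (ht : (γ t).2 ≠ 1) :
    ContDiffAt ℝ ∞ (arcSpeed γ) t :=
  (h.contDiff_speed.contDiffAt.norm ℝ (h.speed_ne_zero t)).div (h.contDiffAt_norm_one_sub ht)
    (norm_ne_zero_iff.2 (sub_ne_zero.2 ht.symm))

theorem arcSpeed_pos (h : LegendrianLoop γ P) {t : ℝ} (ht : (γ t).2 ≠ 1) : 0 < arcSpeed γ t :=
  div_pos (norm_pos_iff.2 (h.speed_ne_zero t)) (norm_pos_iff.2 (sub_ne_zero.2 ht.symm))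

/-- The density `1 / d²` minus its singular part integrates to the loop energy plus a constant,
which is the finite part of the integral of `-1 / x²`. -/
theorem integral_norm_cross_sub (h : LegendrianLoop γ P) :
    2 * ∫ p in window P (P / 2), (‖cross γ (p.1 + p.2 / 2) (p.1 - p.2 / 2)‖ - 1 / p.2 ^ 2) =
      loopEnergy γ P + 4 := by
  have hP := h.period_pos
  set F : ℝ → ℝ → ℝ := fun s t => ‖cross γ s t‖ - 1 / (s - t) ^ 2 with hFdef
  have hsplit : ∀ s t, s ≠ t → |s - t| ≤ P / 2 → F s t = density γ s t +
      (regCross γ (s, t)).re := by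
    intro s t hne hst
    have h1 := h.cross_eq (s := s) (t := t) (by
      simp only [strip, Set.mem_ofPred_eq]; linarith) hne
    have e : (1 : ℂ) / ((s : ℂ) - t) ^ 2 = ((1 / (s - t) ^ 2 : ℝ) : ℂ) := by push_cast; rfl
    have h2 := congrArg Complex.re h1
    rw [e, Complex.add_re, Complex.ofReal_re] at h2
    simp only [hFdef, density]
    linarith
  have hper : ∀ s t, F (s + P) (t + P) = F s t := fun s t => by
    simp only [hFdef, h.cross_periodic_left, h.cross_periodic_right, add_sub_add_right_eq_sub]
  have hsymm : ∀ s t, F t s = F s t := fun s t => by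
    simp only [hFdef, cross_comm γ s t, RCLike.norm_conj, ← neg_sub s t, neg_sq]
  have hmeas : StronglyMeasurable fun p : ℝ × ℝ => F p.1 p.2 := by
    have h1 : Measurable fun p : ℝ × ℝ => cross γ p.1 p.2 := by
      have hs := h.contDiff_speed.continuous
      have hg := h.contDiff_gap.continuous.measurable
      unfold cross
      refine Measurable.div ?_ (hg.pow_const 2)
      exact ((measurable_const.mul (hs.comp continuous_fst).measurable).mul
        (Complex.continuous_conj.comp (hs.comp continuous_snd)).measurable).mul
        (Complex.continuous_conj.measurable.comp hg)
    exact (h1.norm.sub (by fun_prop)).stronglyMeasurable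
  have hWc : ContinuousOn (fun p : ℝ × ℝ => |density γ p.1 p.2 + (regCross γ p).re|) (strip P) :=
    (h.continuous_density.continuousOn.add
      (Complex.continuous_re.comp_continuousOn h.continuousOn_regCross)).abs
  obtain ⟨C, hC⟩ := exists_bound_of_periodic (F := F) (σ := 0) hP hper hWc fun s t hne hst => by
    rw [hsplit s t hne hst, Real.rpow_zero, mul_one, Real.norm_eq_abs]
  have key := integral_symmetric hP hper hsymm hmeas (by norm_num) hC
  have e1 : ∀ p : ℝ × ℝ, F (p.1 + p.2 / 2) (p.1 - p.2 / 2) =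
      ‖cross γ (p.1 + p.2 / 2) (p.1 - p.2 / 2)‖ - 1 / p.2 ^ 2 := fun p => by
    simp only [hFdef]
    rw [show p.1 + p.2 / 2 - (p.1 - p.2 / 2) = p.2 by ring]
  simp only [e1, smul_eq_mul] at key
  rw [← key]
  have e2 : ∀ s, ∫ x in (-(P / 2))..(P / 2), F s (s + x) =
      (∫ t in (0 : ℝ)..P, density γ s t) + 4 / P := by
    intro s
    rw [← h.integral_density_shift s, ← h.integral_regCross s, ← intervalIntegral.integral_add]
    · refine intervalIntegral.integral_congr_ae ?_
      have hne : ∀ᵐ x : ℝ, x ≠ 0 := compl_mem_ae_iff.2 (by simp : volume {(0 : ℝ)} = 0)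
      filter_upwards [hne] with x hx0 hx
      rw [Set.uIoc_of_le (by linarith)] at hx
      refine hsplit s (s + x) (fun e => hx0 (by linarith)) ?_
      rw [sub_add_cancel_left, abs_neg]
      exact abs_le.2 ⟨hx.1.le, hx.2⟩
    · exact ((h.continuous_density_right s).comp (by fun_prop : Continuous fun x : ℝ => s + x)
        ).intervalIntegrable _ _
    · refine ContinuousOn.intervalIntegrable ?_
      refine Complex.continuous_re.comp_continuousOn (h.continuousOn_regCross.comp
        (Continuous.continuousOn (by fun_prop)) fun x hx => ?_)
      rw [Set.uIcc_of_le (by linarith)] at hx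
      have : |x| ≤ P / 2 := abs_le.2 hx
      simp only [strip, Set.mem_ofPred_eq, sub_add_cancel_left, abs_neg]
      linarith
  simp only [e2]
  rw [intervalIntegral.integral_add (h.continuous_integral_density.intervalIntegrable _ _)
    (by simp), loopEnergy]
  simp only [intervalIntegral.integral_const, sub_zero, smul_eq_mul]
  field_simp

end LegendrianLoop

namespace LegendrianKnot

variable (K : LegendrianKnot)

theorem betaIntegral_eq_torus (ζ : ℂ) : K.betaIntegral ζ =
    ∫ p : ℝ × ℝ, (arcSpeed K.loop p.1 * arcSpeed K.loop p.2) •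
      ((koranyiDist (sphereToHeis (K.loop p.1)) (sphereToHeis (K.loop p.2)) : ℝ) : ℂ) ^ ζ
      ∂((volume.restrict (Set.Ioc 0 K.period)).prod (volume.restrict (Set.Ioc 0 K.period))) := by
  have hf := K.measurable_sphereToHeis_loop
  have hm : Measurable fun x : Heis × Heis => ((koranyiDist x.1 x.2 : ℝ) : ℂ) ^ ζ :=
    (Complex.measurable_ofReal.comp continuous_koranyiDist.measurable).pow_const ζ
  rw [betaIntegral, arcLength_eq, Measure.map_prod_map _ _ hf hf,
    integral_map (hf.prodMap hf).aemeasurable hm.aestronglyMeasurable, paramLength,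
    prod_withDensity K.measurable_ofReal_arcSpeed K.measurable_ofReal_arcSpeed,
    integral_withDensity_eq_integral_toReal_smul (f := fun z : ℝ × ℝ =>
        ENNReal.ofReal (arcSpeed K.loop z.1) * ENNReal.ofReal (arcSpeed K.loop z.2))
      ((K.measurable_ofReal_arcSpeed.comp measurable_fst).mul
        (K.measurable_ofReal_arcSpeed.comp measurable_snd)) (by
      refine Eventually.of_forall fun p => ?_
      exact ENNReal.mul_lt_top ENNReal.ofReal_lt_top ENNReal.ofReal_lt_top),
    restrict_Ico_eq_restrict_Ioc]
  simp [ENNReal.toReal_ofReal (arcSpeed_nonneg _ _)]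

/-- The logarithm of the distance minus that of the parameter difference, in symmetric
coordinates. -/
def logQuot (p : ℝ × ℝ) : ℝ := Real.log (quotDist K.loop (p.1 + p.2 / 2, p.1 - p.2 / 2))

/-- The density of `dp dq` in symmetric coordinates. -/
def speedProd (p : ℝ × ℝ) : ℝ :=
  arcSpeed K.loop (p.1 + p.2 / 2) * arcSpeed K.loop (p.1 - p.2 / 2)

variable {K}

theorem loop_snd_ne_one (hK : OnePoint.infty ∉ K.carrier) (t : ℝ) : (K.loop t).2 ≠ 1 :=
  fun h => hK ⟨t, (K.loop_snd_eq_one_iff t).1 h⟩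

theorem symm_mem_strip {p : ℝ × ℝ} {b : ℝ} (hp : p ∈ slab b) :
    (p.1 + p.2 / 2, p.1 - p.2 / 2) ∈ strip b := by
  have e : p.1 + p.2 / 2 - (p.1 - p.2 / 2) = p.2 := by ring
  rw [strip, Set.mem_ofPred_eq, e]
  exact hp

theorem contDiffOn_logQuot (hK : OnePoint.infty ∉ K.carrier) :
    ContDiffOn ℝ ∞ K.logQuot (slab K.period) := by
  intro p hp
  have hs := symm_mem_strip hp
  have h1 := K.isLegendrianLoop.contDiffAt_quotDist hs (loop_snd_ne_one hK _)
    (loop_snd_ne_one hK _)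
  have h2 : ContDiffAt ℝ ∞ (fun p : ℝ × ℝ => (p.1 + p.2 / 2, p.1 - p.2 / 2)) p := by fun_prop
  have h3 : quotDist K.loop (p.1 + p.2 / 2, p.1 - p.2 / 2) ≠ 0 :=
    (K.isLegendrianLoop.quotDist_pos hs (loop_snd_ne_one hK _) (loop_snd_ne_one hK _)).ne'
  exact ((ContDiffAt.comp (g := quotDist K.loop) p h1 h2).log h3).contDiffWithinAt

theorem contDiffOn_speedProd (hK : OnePoint.infty ∉ K.carrier) :
    ContDiffOn ℝ ∞ K.speedProd (slab K.period) := by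
  intro p _
  have h1 : ContDiff ℝ ∞ (arcSpeed K.loop) := contDiff_iff_contDiffAt.2 fun t =>
    K.isLegendrianLoop.contDiffAt_arcSpeed (loop_snd_ne_one hK t)
  have h2 : ContDiff ℝ ∞ (fun p : ℝ × ℝ => p.1 + p.2 / 2) := by fun_prop
  have h3 : ContDiff ℝ ∞ (fun p : ℝ × ℝ => p.1 - p.2 / 2) := by fun_prop
  exact ((h1.comp h2).mul (h1.comp h3)).contDiffAt.contDiffWithinAt

theorem betaIntegral_eq_moment (hK : OnePoint.infty ∉ K.carrier) {ζ : ℂ} (hζ : -1 < ζ.re) :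
    K.betaIntegral ζ = 2 * moment K.period (K.period / 2) K.logQuot 0 K.speedProd ζ := by
  have h := K.isLegendrianLoop
  have hP := K.period_pos
  have hne := loop_snd_ne_one hK
  set F : ℝ → ℝ → ℂ := fun s t => (arcSpeed K.loop s * arcSpeed K.loop t) •
      ((koranyiDist (sphereToHeis (K.loop s)) (sphereToHeis (K.loop t)) : ℝ) : ℂ) ^ ζ with hFdef
  have hap : ∀ t, arcSpeed K.loop (t + K.period) = arcSpeed K.loop t := fun t => by
    simp only [arcSpeed, h.speed_periodic t, h.periodic t]
  have hl : ∀ s t, F (s + K.period) t = F s t := fun s t => by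
    simp only [hFdef, hap, h.periodic s]
  have hr : ∀ s t, F s (t + K.period) = F s t := fun s t => by
    simp only [hFdef, hap, h.periodic t]
  have hsymm : ∀ s t, F t s = F s t := fun s t => by
    have : koranyiDist (sphereToHeis (K.loop t)) (sphereToHeis (K.loop s)) =
        koranyiDist (sphereToHeis (K.loop s)) (sphereToHeis (K.loop t)) := by
      rw [← Real.sqrt_sq (koranyiDist_nonneg _ _), ← Real.sqrt_sq (koranyiDist_nonneg (sphereToHeis
        (K.loop s)) _), h.koranyiDist_sq (hne _) (hne _), h.koranyiDist_sq (hne _) (hne _),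
        gap_comm, RCLike.norm_conj, mul_comm ‖1 - (K.loop t).2‖]
    simp only [hFdef, this, mul_comm (arcSpeed K.loop t)]
  have hmeas : StronglyMeasurable fun p : ℝ × ℝ => F p.1 p.2 := by
    have hf := K.measurable_sphereToHeis_loop
    have h1 : Measurable fun p : ℝ × ℝ =>
        koranyiDist (sphereToHeis (K.loop p.1)) (sphereToHeis (K.loop p.2)) :=
      Measurable.comp (g := fun x : Heis × Heis => koranyiDist x.1 x.2)
        (f := fun p : ℝ × ℝ => (sphereToHeis (K.loop p.1), sphereToHeis (K.loop p.2)))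
        continuous_koranyiDist.measurable
        ((hf.comp measurable_fst).prodMk (hf.comp measurable_snd))
    have h2 := K.measurable_arcSpeed
    exact (((h2.comp measurable_fst).mul (h2.comp measurable_snd)).smul
      ((Complex.measurable_ofReal.comp h1).pow_const ζ)).stronglyMeasurable
  have hcont : Continuous (arcSpeed K.loop) := continuous_iff_continuousAt.2 fun t =>
    (h.contDiffAt_arcSpeed (hne t)).continuousAt
  have hW : ContinuousOn (fun p : ℝ × ℝ => arcSpeed K.loop p.1 * arcSpeed K.loop p.2 *
      quotDist K.loop p ^ ζ.re) (strip K.period) := by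
    refine ContinuousOn.mul (by fun_prop) ?_
    refine ContinuousOn.rpow_const (fun p hp => ?_) fun p hp => Or.inl ?_
    · exact (h.contDiffAt_quotDist hp (hne _) (hne _)).continuousAt.continuousWithinAt
    · exact (h.quotDist_pos hp (hne _) (hne _)).ne'
  obtain ⟨C, hC⟩ := exists_bound_of_periodic (F := F) (σ := ζ.re) hP
    (fun s t => by rw [hl, hr]) hW fun s t hst hle => by
      have hq := h.quotDist_pos (p := (s, t)) (by
        simp only [strip, Set.mem_ofPred_eq]; linarith) (hne _) (hne _)
      have hx : 0 < |s - t| := abs_pos.2 (sub_ne_zero.2 hst)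
      simp only [hFdef]
      rw [norm_smul, Real.norm_of_nonneg (mul_nonneg (arcSpeed_nonneg _ _) (arcSpeed_nonneg _ _)),
        h.koranyiDist_eq (hne _) (hne _), Complex.norm_cpow_eq_rpow_re_of_pos (by positivity),
        Real.mul_rpow hx.le hq.le]
      exact le_of_eq (by ring)
  have key := integral_torus hP hl hr hsymm hmeas hζ hC
  rw [K.betaIntegral_eq_torus ζ]
  refine key.trans ?_
  rw [moment, Complex.real_smul, Complex.ofReal_ofNat]
  congr 1
  refine setIntegral_congr_fun (measurableSet_window _ _) fun p hp => ?_
  have hx : 0 < p.2 := hp.2.1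
  have hmem : p ∈ slab K.period := by
    simp only [slab, Set.mem_ofPred_eq, abs_of_pos hx]
    linarith [hp.2.2]
  have hq := h.quotDist_pos (symm_mem_strip hmem) (hne _) (hne _)
  have e : p.1 + p.2 / 2 - (p.1 - p.2 / 2) = p.2 := by ring
  simp only [hFdef]
  rw [h.koranyiDist_eq (hne _) (hne _), e, abs_of_pos hx, Complex.cpow_def_of_ne_zero
    (by exact_mod_cast (mul_pos hx hq).ne'), ← Complex.ofReal_log (mul_pos hx hq).le,
    Real.log_mul hx.ne' hq.ne', pow_zero, one_mul, Complex.real_smul, mul_comm, mul_comm ζ]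
  rfl

theorem exp_logQuot_mul_speedProd (hK : OnePoint.infty ∉ K.carrier) {p : ℝ × ℝ}
    (hp : p ∈ slab K.period) (hx : p.2 ≠ 0) :
    Real.exp (-2 * K.logQuot p) * K.speedProd p =
      p.2 ^ 2 * ‖cross K.loop (p.1 + p.2 / 2) (p.1 - p.2 / 2)‖ := by
  have h := K.isLegendrianLoop
  have hne := loop_snd_ne_one hK
  have hq := h.quotDist_pos (symm_mem_strip hp) (hne _) (hne _)
  have e : p.1 + p.2 / 2 - (p.1 - p.2 / 2) = p.2 := by ring
  rw [h.norm_cross_eq (hne _) (hne _), h.koranyiDist_eq (hne _) (hne _), e, mul_pow, sq_abs,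
    logQuot, speedProd, neg_mul, Real.exp_neg, two_mul, Real.exp_add, Real.exp_log hq]
  field_simp

theorem hasEnergy_iff_of_notMem (hK : OnePoint.infty ∉ K.carrier) (e : ℝ) :
    K.HasEnergy e ↔ e = loopEnergy K.loop K.period := by
  have h := K.isLegendrianLoop
  have hP := K.period_pos
  have hne := loop_snd_ne_one hK
  obtain ⟨B, hB, hBm, hBa, hBv⟩ := exists_meromorphic_continuation (P := K.period)
    (a := K.period / 2) (b := K.period) hP.le (by linarith) (by linarith)
    (contDiffOn_logQuot hK) (contDiffOn_speedProd hK)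
    (fun τ x => by
      simp only [logQuot]
      rw [quotDist_comm, neg_div, sub_neg_eq_add, ← sub_eq_add_neg])
    (fun τ x => by
      simp only [speedProd]
      rw [mul_comm, neg_div, sub_neg_eq_add, ← sub_eq_add_neg])
    (fun τ => by
      have := h.arcSpeed_pos (hne τ)
      simp only [logQuot, speedProd, zero_div, add_zero, sub_zero, h.quotDist_self]
      rw [neg_mul, Real.exp_neg, two_mul, Real.exp_add, Real.exp_log this]
      field_simp)
  have hval : (2 : ℂ) * B (-2) = (loopEnergy K.loop K.period : ℂ) := by
    have e1 : ∫ p in window K.period (K.period / 2),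
        (Real.exp (-2 * K.logQuot p) * K.speedProd p - 1) / p.2 ^ 2 =
        ∫ p in window K.period (K.period / 2),
          (‖cross K.loop (p.1 + p.2 / 2) (p.1 - p.2 / 2)‖ - 1 / p.2 ^ 2) := by
      refine setIntegral_congr_fun (measurableSet_window _ _) fun p hp => ?_
      have hx : 0 < p.2 := hp.2.1
      have hmem : p ∈ slab K.period := by
        simp only [slab, Set.mem_ofPred_eq, abs_of_pos hx]
        linarith [hp.2.2]
      rw [exp_logQuot_mul_speedProd hK hmem hx.ne']
      field_simp
    have h2 := h.integral_norm_cross_sub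
    rw [hBv, e1, ← Complex.ofReal_ofNat, ← Complex.ofReal_mul]
    congr 1
    have h3 : K.period / (K.period / 2) = 2 := by field_simp
    rw [h3]
    linarith
  have hBeta : K.IsBetaFunction fun ζ => 2 * B ζ := by
    refine ⟨(MeromorphicOn.const 2).mul hB, fun ζ hζ => ?_⟩
    simp only [betaIntegral_eq_moment hK hζ, hBm ζ hζ]
  constructor
  · rintro (⟨-, B', hB', ha', hv'⟩ | ⟨h1, -⟩)
    · have := eq_of_meromorphic_of_eq_on_halfPlane hB'.1 hBeta.1 (σ := -1)
        (fun ζ hζ => (hB'.2 ζ hζ).trans (hBeta.2 ζ hζ).symm) ha' (analyticAt_const.mul hBa)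
      rw [hv', hval] at this
      exact_mod_cast this
    · exact absurd h1 hK
  · rintro rfl
    exact Or.inl ⟨hK, _, hBeta, analyticAt_const.mul hBa, hval⟩

/-- The energy is always the integral of the energy density over the torus. -/
theorem hasEnergy_iff (K : LegendrianKnot) (e : ℝ) :
    K.HasEnergy e ↔ e = loopEnergy K.loop K.period := by
  by_cases hK : OnePoint.infty ∈ K.carrier
  · exact K.hasEnergy_iff_of_mem hK e
  · exact hasEnergy_iff_of_notMem hK e

end LegendrianKnot

/-! ### Isometries of the complex hyperbolic plane -/

/-- The Hermitian form of signature `(2, 1)` on `ℂ² × ℂ`. -/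
def indef (v w : (ℂ × ℂ) × ℂ) : ℂ := herm v.1 w.1 - v.2 * conj w.2

/-- Membership in the indefinite unitary group. -/
def PreservesForm (A : ((ℂ × ℂ) × ℂ) ≃L[ℂ] ((ℂ × ℂ) × ℂ)) : Prop :=
  ∀ v w, indef (A v) (A w) = indef v w

/-- The denominator of the fractional linear transformation given by `A`. -/
def den (A : ((ℂ × ℂ) × ℂ) ≃L[ℂ] ((ℂ × ℂ) × ℂ)) (a : ℂ × ℂ) : ℂ := (A (a, 1)).2

/-- The fractional linear transformation given by `A`. -/
def ballMap (A : ((ℂ × ℂ) × ℂ) ≃L[ℂ] ((ℂ × ℂ) × ℂ)) (a : ℂ × ℂ) : ℂ × ℂ :=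
  (den A a)⁻¹ • (A (a, 1)).1

theorem indef_smul_left (c : ℂ) (v w : (ℂ × ℂ) × ℂ) : indef (c • v) w = c * indef v w := by
  simp only [indef, Prod.smul_fst, Prod.smul_snd, herm_smul_left, smul_eq_mul]; ring

theorem indef_smul_right (c : ℂ) (v w : (ℂ × ℂ) × ℂ) : indef v (c • w) = conj c * indef v w := by
  simp only [indef, Prod.smul_fst, Prod.smul_snd, herm_smul_right, smul_eq_mul, map_mul]; ring

theorem indef_add_left (u v w : (ℂ × ℂ) × ℂ) : indef (u + v) w = indef u w + indef v w := by
  simp only [indef, herm, Prod.fst_add, Prod.snd_add]; ring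

theorem indef_add_right (u v w : (ℂ × ℂ) × ℂ) : indef u (v + w) = indef u v + indef u w := by
  simp only [indef, herm, Prod.fst_add, Prod.snd_add, map_add]; ring

theorem conj_indef (v w : (ℂ × ℂ) × ℂ) : conj (indef v w) = indef w v := by
  simp only [indef, map_sub, conj_herm, map_mul, Complex.conj_conj]; ring

theorem indef_lift (a b : ℂ × ℂ) : indef (a, 1) (b, 1) = herm a b - 1 := by simp [indef]

theorem eq_zero_of_indef {v : (ℂ × ℂ) × ℂ} (h : ∀ w, indef v w = 0) : v = 0 := by
  have h1 := h ((1, 0), 0)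
  have h2 := h ((0, 1), 0)
  have h3 := h ((0, 0), 1)
  simp only [indef, herm, map_one, map_zero, mul_one, mul_zero, add_zero, zero_add, sub_zero,
    zero_sub, neg_eq_zero] at h1 h2 h3
  exact Prod.ext (Prod.ext h1 h2) h3

theorem isOpen_unitBall : IsOpen unitBall :=
  isOpen_lt (by unfold hermSq; fun_prop) continuous_const

namespace PreservesForm

variable {A B : ((ℂ × ℂ) × ℂ) ≃L[ℂ] ((ℂ × ℂ) × ℂ)}

theorem symm (hA : PreservesForm A) : PreservesForm A.symm := fun v w => by
  rw [← hA, A.apply_symm_apply, A.apply_symm_apply]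

theorem trans (hA : PreservesForm A) (hB : PreservesForm B) : PreservesForm (A.trans B) :=
  fun v w => by
    rw [ContinuousLinearEquiv.trans_apply, ContinuousLinearEquiv.trans_apply, hB, hA]

theorem den_ne_zero (hA : PreservesForm A) {a : ℂ × ℂ} (ha : hermSq a ≤ 1) : den A a ≠ 0 := by
  intro h
  have h0 : (A (a, 1)).2 = 0 := h
  have h1 := hA (a, 1) (a, 1)
  rw [indef_lift, indef, h0, zero_mul, sub_zero, ← hermSq_coe, ← hermSq_coe] at h1
  have h2 : hermSq (A (a, 1)).1 = hermSq a - 1 := by exact_mod_cast h1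
  have h3 : hermSq (A (a, 1)).1 = 0 := le_antisymm (by linarith) (hermSq_nonneg _)
  have h4 : A (a, 1) = 0 := Prod.ext (hermSq_eq_zero.1 h3) h0
  have h5 : ((a, 1) : (ℂ × ℂ) × ℂ) = 0 := A.map_eq_zero_iff.1 h4
  exact one_ne_zero (congrArg Prod.snd h5)

theorem map_lift (hA : PreservesForm A) {a : ℂ × ℂ} (ha : hermSq a ≤ 1) :
    A (a, 1) = den A a • (ballMap A a, (1 : ℂ)) := by
  refine Prod.ext ?_ ?_
  · simp only [ballMap, Prod.smul_fst]
    rw [smul_inv_smul₀ (hA.den_ne_zero ha)]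
  · simp [den]

/-- The transformation changes the kernel `1 - ⟨a, b⟩` by a conformal factor. -/
theorem one_sub_herm (hA : PreservesForm A) {a b : ℂ × ℂ} (ha : hermSq a ≤ 1)
    (hb : hermSq b ≤ 1) :
    (1 - herm (ballMap A a) (ballMap A b)) * (den A a * conj (den A b)) = 1 - herm a b := by
  have h := hA (a, 1) (b, 1)
  rw [hA.map_lift ha, hA.map_lift hb, indef_smul_left, indef_smul_right, indef_lift,
    indef_lift] at h
  linear_combination -h

theorem one_sub_hermSq (hA : PreservesForm A) {a : ℂ × ℂ} (ha : hermSq a ≤ 1) :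
    (1 - hermSq (ballMap A a)) * ‖den A a‖ ^ 2 = 1 - hermSq a := by
  have h := hA.one_sub_herm ha ha
  rw [← hermSq_coe, ← hermSq_coe, Complex.mul_conj, Complex.normSq_eq_norm_sq] at h
  exact_mod_cast h

theorem hermSq_eq_one (hA : PreservesForm A) {a : ℂ × ℂ} (ha : hermSq a = 1) :
    hermSq (ballMap A a) = 1 := by
  have h := hA.one_sub_hermSq ha.le
  have h1 : ‖den A a‖ ^ 2 ≠ 0 := pow_ne_zero 2 (norm_ne_zero_iff.2 (hA.den_ne_zero ha.le))
  rw [ha, sub_self] at h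
  linarith [(mul_eq_zero.1 h).resolve_right h1]

theorem mem_unitBall (hA : PreservesForm A) {a : ℂ × ℂ} (ha : a ∈ unitBall) :
    ballMap A a ∈ unitBall := by
  have ha' : hermSq a < 1 := ha
  have h := hA.one_sub_hermSq ha'.le
  have h1 : 0 < ‖den A a‖ ^ 2 := pow_pos (norm_pos_iff.2 (hA.den_ne_zero ha'.le)) 2
  have h2 : 0 < 1 - hermSq (ballMap A a) := by
    refine pos_of_mul_pos_left ?_ h1.le
    rw [h]; linarith
  change hermSq (ballMap A a) < 1
  linarith

theorem ballMap_ballMap (hA : PreservesForm A) {a : ℂ × ℂ}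
    (ha : hermSq a ≤ 1) : ballMap B (ballMap A a) = ballMap (A.trans B) a := by
  have h1 := hA.den_ne_zero ha
  have h2 : (A.trans B) (a, 1) = den A a • B (ballMap A a, 1) := by
    rw [ContinuousLinearEquiv.trans_apply, hA.map_lift ha, map_smul]
  have h3 : den (A.trans B) a = den A a * den B (ballMap A a) := by
    rw [den, h2, Prod.smul_snd, smul_eq_mul, den, den]
  have h4 : ballMap (A.trans B) a =
      (den A a * den B (ballMap A a))⁻¹ • (den A a • (B (ballMap A a, 1)).1) := by
    rw [ballMap, h3, h2, Prod.smul_fst]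
  rw [h4, ballMap, smul_smul]
  congr 1
  field_simp

theorem ballMap_symm_apply (hA : PreservesForm A) {a : ℂ × ℂ} (ha : hermSq a ≤ 1) :
    ballMap A.symm (ballMap A a) = a := by
  rw [hA.ballMap_ballMap ha]
  simp [ballMap, den]

theorem ballMap_apply_symm (hA : PreservesForm A) {a : ℂ × ℂ} (ha : hermSq a ≤ 1) :
    ballMap A (ballMap A.symm a) = a := hA.symm.ballMap_symm_apply ha

theorem contDiffAt_ballMap (hA : PreservesForm A) {a : ℂ × ℂ} (ha : hermSq a ≤ 1) :
    ContDiffAt ℂ ∞ (ballMap A) a := by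
  have h1 : ContDiff ℂ ∞ fun a : ℂ × ℂ => A (a, 1) :=
    A.contDiff.comp (contDiff_id.prodMk contDiff_const)
  have h2 : ContDiff ℂ ∞ (den A) := h1.snd
  exact (h2.contDiffAt.inv (hA.den_ne_zero ha)).smul h1.fst.contDiffAt

theorem hypDist_ballMap (hA : PreservesForm A) {a b : ℂ × ℂ} (ha : a ∈ unitBall)
    (hb : b ∈ unitBall) : hypDist (ballMap A a) (ballMap A b) = hypDist a b := by
  have ha' : hermSq a ≤ 1 := le_of_lt ha
  have hb' : hermSq b ≤ 1 := le_of_lt hb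
  have h1 := norm_pos_iff.2 (hA.den_ne_zero ha')
  have h2 := norm_pos_iff.2 (hA.den_ne_zero hb')
  rw [hypDist, hypDist, ← hA.one_sub_herm ha' hb', ← hA.one_sub_hermSq ha',
    ← hA.one_sub_hermSq hb', norm_mul, norm_mul, RCLike.norm_conj]
  have e : (1 - hermSq (ballMap A a)) * ‖den A a‖ ^ 2 *
      ((1 - hermSq (ballMap A b)) * ‖den A b‖ ^ 2) =
      (1 - hermSq (ballMap A a)) * (1 - hermSq (ballMap A b)) * (‖den A a‖ * ‖den A b‖) ^ 2 := by
    ring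
  rw [e, Real.sqrt_mul' (x := (1 - hermSq (ballMap A a)) * (1 - hermSq (ballMap A b)))
    (by positivity), Real.sqrt_sq (by positivity), mul_div_mul_right _ _ (by positivity)]

theorem isGeodesic_comp (hA : PreservesForm A) {σ : ℝ → ℂ × ℂ} (hσ : IsGeodesic σ) :
    IsGeodesic fun t => ballMap A (σ t) :=
  ⟨fun t => hA.mem_unitBall (hσ.1 t), fun s t => by
    rw [hA.hypDist_ballMap (hσ.1 s) (hσ.1 t), hσ.2]⟩

theorem isTotallyGeodesic_image (hA : PreservesForm A) {S : Set (ℂ × ℂ)} (hS : S ⊆ unitBall)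
    (h : IsTotallyGeodesic S) : IsTotallyGeodesic (ballMap A '' S) := by
  have key : ∀ a ∈ ballMap A '' S, ballMap A.symm a ∈ S := by
    rintro _ ⟨a, ha, rfl⟩
    rwa [hA.ballMap_symm_apply (le_of_lt (hS ha))]
  intro σ hσ s t hst hs ht r
  exact ⟨_, h _ (hA.symm.isGeodesic_comp hσ) s t hst (key _ hs) (key _ ht) r,
    hA.ballMap_apply_symm (le_of_lt (hσ.1 r))⟩

theorem isTotallyRealSurface_image (hA : PreservesForm A) {S : Set (ℂ × ℂ)} (hS : S ⊆ unitBall)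
    (h : IsTotallyRealSurface S) : IsTotallyRealSurface (ballMap A '' S) := by
  rintro _ ⟨p, hp, rfl⟩
  obtain ⟨W, f, hW, hpW, hf, hSW, hsurj, hreal⟩ := h p hp
  have hpb : p ∈ unitBall := hS hp
  have hqb := hA.mem_unitBall hpb
  have hpl : hermSq p ≤ 1 := le_of_lt hpb
  have hql : hermSq (ballMap A p) ≤ 1 := le_of_lt hqb
  have hinv := hA.ballMap_symm_apply hpl
  set ψ : ℂ × ℂ → ℂ × ℂ := ballMap A.symm with hψ
  have hψc : ∀ a ∈ unitBall, ContDiffAt ℂ ∞ ψ a := fun a ha =>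
    hA.symm.contDiffAt_ballMap (le_of_lt ha)
  have hψr : ContDiffOn ℝ ∞ ψ unitBall := fun a ha =>
    ((hψc a ha).restrict_scalars ℝ).contDiffWithinAt
  have hopen : IsOpen (unitBall ∩ ψ ⁻¹' W) :=
    hψr.continuousOn.isOpen_inter_preimage isOpen_unitBall hW
  -- the two derivatives are complex linear and inverse to each other
  obtain ⟨L, hL⟩ : ∃ L, HasFDerivAt ψ L (ballMap A p) :=
    ⟨_, ((hψc _ hqb).differentiableAt (by simp)).hasFDerivAt⟩
  obtain ⟨M, hM⟩ : ∃ M, HasFDerivAt (ballMap A) M p :=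
    ⟨_, ((hA.contDiffAt_ballMap hpl).differentiableAt (by simp)).hasFDerivAt⟩
  have hLM : L.comp M = ContinuousLinearMap.id ℂ (ℂ × ℂ) := by
    refine (hL.comp p hM).unique ((hasFDerivAt_id p).congr_of_eventuallyEq ?_)
    filter_upwards [isOpen_unitBall.mem_nhds hpb] with a ha
    exact hA.ballMap_symm_apply (le_of_lt ha)
  have hML : M.comp L = ContinuousLinearMap.id ℂ (ℂ × ℂ) := by
    rw [← hinv] at hM
    refine (hM.comp _ hL).unique ((hasFDerivAt_id _).congr_of_eventuallyEq ?_)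
    filter_upwards [isOpen_unitBall.mem_nhds hqb] with a ha
    exact hA.ballMap_apply_symm (le_of_lt ha)
  have hLM' : ∀ v, L (M v) = v := fun v => DFunLike.congr_fun hLM v
  have hML' : ∀ v, M (L v) = v := fun v => DFunLike.congr_fun hML v
  have hfd : HasFDerivAt (fun a => f (ψ a)) ((fderiv ℝ f p).comp (L.restrictScalars ℝ))
      (ballMap A p) := by
    have h1 : HasFDerivAt f (fderiv ℝ f p) (ψ (ballMap A p)) := by
      rw [hinv]
      exact ((hf.contDiffAt (hW.mem_nhds hpW)).differentiableAt (by simp)).hasFDerivAt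
    exact h1.comp _ (hL.restrictScalars ℝ)
  refine ⟨unitBall ∩ ψ ⁻¹' W, fun a => f (ψ a), hopen, ⟨hqb, by simpa [hinv] using hpW⟩,
    hf.comp (hψr.mono Set.inter_subset_left) fun a ha => ha.2, ?_, ?_, ?_⟩
  · ext a
    constructor
    · rintro ⟨⟨b, hb, rfl⟩, ha⟩
      refine ⟨ha, ?_⟩
      have e : ψ (ballMap A b) = b := hA.ballMap_symm_apply (le_of_lt (hS hb))
      have hbW : b ∈ S ∩ W := ⟨hb, by have := ha.2; rwa [Set.mem_preimage, e] at this⟩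
      rw [hSW] at hbW
      change f (ψ (ballMap A b)) = 0
      rw [e]
      exact hbW.2
    · rintro ⟨ha, hfa⟩
      have hbW : ψ a ∈ S ∩ W := by rw [hSW]; exact ⟨ha.2, hfa⟩
      exact ⟨⟨ψ a, hbW.1, hA.ballMap_apply_symm (le_of_lt ha.1)⟩, ha⟩
  · rw [hfd.fderiv]
    intro y
    obtain ⟨v, hv⟩ := hsurj y
    exact ⟨M v, by simp [hLM', hv]⟩
  · rw [hfd.fderiv]
    intro v hv hiv
    have h1 : L v = 0 := hreal (L v) hv (by
      have : L (Complex.I • v) = Complex.I • L v := map_smul _ _ _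
      rw [← this]; exact hiv)
    rw [← hML' v, h1, map_zero]

end PreservesForm

/-- A frame that is orthonormal for the indefinite form gives an element of the unitary group. -/
theorem exists_preservesForm {e₁ e₂ e₃ : (ℂ × ℂ) × ℂ} (h11 : indef e₁ e₁ = 1)
    (h22 : indef e₂ e₂ = 1) (h33 : indef e₃ e₃ = -1) (h12 : indef e₁ e₂ = 0)
    (h13 : indef e₁ e₃ = 0) (h23 : indef e₂ e₃ = 0) :
    ∃ A : ((ℂ × ℂ) × ℂ) ≃L[ℂ] ((ℂ × ℂ) × ℂ), PreservesForm A ∧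
      ∀ x, A x = x.1.1 • e₁ + x.1.2 • e₂ + x.2 • e₃ := by
  let L : ((ℂ × ℂ) × ℂ) →ₗ[ℂ] ((ℂ × ℂ) × ℂ) :=
    { toFun := fun x => x.1.1 • e₁ + x.1.2 • e₂ + x.2 • e₃
      map_add' := fun x y => by simp only [Prod.fst_add, Prod.snd_add]; module
      map_smul' := fun c x => by
        simp only [Prod.smul_fst, Prod.smul_snd, smul_eq_mul, RingHom.id_apply]; module }
  have h21 : indef e₂ e₁ = 0 := by rw [← conj_indef, h12, map_zero]
  have h31 : indef e₃ e₁ = 0 := by rw [← conj_indef, h13, map_zero]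
  have h32 : indef e₃ e₂ = 0 := by rw [← conj_indef, h23, map_zero]
  have hL : ∀ v w, indef (L v) (L w) = indef v w := fun v w => by
    change indef (v.1.1 • e₁ + v.1.2 • e₂ + v.2 • e₃) (w.1.1 • e₁ + w.1.2 • e₂ + w.2 • e₃) = _
    simp only [indef_add_left, indef_add_right, indef_smul_left, indef_smul_right, h11, h22, h33,
      h12, h13, h23, h21, h31, h32]
    simp only [indef, herm]
    ring
  have hinj : Function.Injective L := by
    rw [injective_iff_map_eq_zero]
    intro v hv
    refine eq_zero_of_indef fun w => ?_
    rw [← hL, hv]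
    simp [indef, herm]
  refine ⟨(LinearEquiv.ofInjectiveEndo L hinj).toContinuousLinearEquiv, fun v w => ?_,
    fun x => rfl⟩
  exact hL v w

theorem ballMap_zero (A : ((ℂ × ℂ) × ℂ) ≃L[ℂ] ((ℂ × ℂ) × ℂ)) :
    ballMap A 0 = ((A (0, 1)).2)⁻¹ • (A (0, 1)).1 := rfl

/-- The unitary group acts transitively on the ball. -/
theorem exists_ballMap_zero_eq {p : ℂ × ℂ} (hp : p ∈ unitBall) :
    ∃ A, PreservesForm A ∧ ballMap A 0 = p := by
  by_cases h0 : p = 0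
  · refine ⟨ContinuousLinearEquiv.refl ℂ _, fun _ _ => rfl, ?_⟩
    rw [h0]
    simp [ballMap]
  have hp1 : hermSq p < 1 := hp
  have hn : 0 < hermSq p :=
    lt_of_le_of_ne (hermSq_nonneg p) fun h => h0 (hermSq_eq_zero.1 h.symm)
  set n : ℝ := √(hermSq p) with hndef
  set s : ℝ := √(1 - hermSq p) with hsdef
  have hn0 : (n : ℂ) ≠ 0 := by exact_mod_cast (Real.sqrt_pos.2 hn).ne'
  have hs0 : (s : ℂ) ≠ 0 := by exact_mod_cast (Real.sqrt_pos.2 (by linarith)).ne'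
  have hn2 : (n : ℂ) ^ 2 = p.1 * conj p.1 + p.2 * conj p.2 := by
    rw [← Complex.ofReal_pow, Real.sq_sqrt hn.le, hermSq_coe, herm]
  have hs2 : (s : ℂ) ^ 2 = 1 - (n : ℂ) ^ 2 := by
    rw [← Complex.ofReal_pow, ← Complex.ofReal_pow, Real.sq_sqrt (by linarith),
      Real.sq_sqrt hn.le]
    push_cast; ring
  obtain ⟨A, hA, hAe⟩ := exists_preservesForm
    (e₁ := (n : ℂ)⁻¹ • ((-conj p.2, conj p.1), 0))
    (e₂ := ((n : ℂ)⁻¹ * (s : ℂ)⁻¹) • (p, (n : ℂ) ^ 2))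
    (e₃ := (s : ℂ)⁻¹ • (p, 1))
    (by
      rw [indef_smul_left, indef_smul_right, map_inv₀, Complex.conj_ofReal]
      simp only [indef, herm, map_neg, map_zero, Complex.conj_conj]
      field_simp
      linear_combination -hn2)
    (by
      rw [indef_smul_left, indef_smul_right, map_mul, map_inv₀, map_inv₀, Complex.conj_ofReal,
        Complex.conj_ofReal]
      simp only [indef, herm, map_pow, Complex.conj_ofReal]
      field_simp
      rw [← hn2, hs2]; ring)
    (by
      rw [indef_smul_left, indef_smul_right, map_inv₀, Complex.conj_ofReal]
      simp only [indef, herm, map_one]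
      field_simp
      rw [← hn2, hs2]; ring)
    (by
      rw [indef_smul_left, indef_smul_right]
      simp only [indef, herm]
      ring)
    (by
      rw [indef_smul_left, indef_smul_right]
      simp only [indef, herm]
      ring)
    (by
      rw [indef_smul_left, indef_smul_right]
      simp only [indef, herm, map_one]
      rw [← hn2]; ring)
  refine ⟨A, hA, ?_⟩
  rw [ballMap_zero, hAe]
  simp only [Prod.fst_zero, Prod.snd_zero, zero_smul, zero_add, one_smul, Prod.smul_fst,
    Prod.smul_snd, smul_eq_mul, mul_one, inv_inv]
  rw [smul_inv_smul₀ hs0]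

/-! ### Geodesics of the complex hyperbolic plane -/

theorem hermSq_mul_sub_normSq_herm (a b : ℂ × ℂ) :
    hermSq a * hermSq b - ‖herm a b‖ ^ 2 = ‖a.1 * b.2 - a.2 * b.1‖ ^ 2 := by
  simp only [hermSq, herm, ← Complex.normSq_eq_norm_sq, Complex.normSq_apply, Complex.add_re,
    Complex.add_im, Complex.sub_re, Complex.sub_im, Complex.mul_re, Complex.mul_im,
    Complex.conj_re, Complex.conj_im]
  ring

theorem norm_herm_sq_le (a b : ℂ × ℂ) : ‖herm a b‖ ^ 2 ≤ hermSq a * hermSq b := by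
  have := hermSq_mul_sub_normSq_herm a b
  have h2 := sq_nonneg ‖a.1 * b.2 - a.2 * b.1‖
  linarith

theorem hermSq_smul (c : ℂ) (a : ℂ × ℂ) : hermSq (c • a) = ‖c‖ ^ 2 * hermSq a := by
  simp only [hermSq, Prod.smul_fst, Prod.smul_snd, smul_eq_mul, norm_mul]; ring

theorem hermSq_sub (a b : ℂ × ℂ) :
    hermSq (a - b) = hermSq a + hermSq b - 2 * (herm a b).re := by
  simp only [hermSq, herm, ← Complex.normSq_eq_norm_sq, Complex.normSq_apply, Prod.fst_sub,
    Prod.snd_sub, Complex.sub_re, Complex.sub_im, Complex.add_re, Complex.mul_re,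
    Complex.conj_re, Complex.conj_im]
  ring

/-- The hyperbolic distance by its hyperbolic cosine; the reversed Cauchy-Schwarz inequality puts
the argument of `arcosh` in its domain. -/
theorem norm_one_sub_herm {a b : ℂ × ℂ} (ha : a ∈ unitBall) (hb : b ∈ unitBall) :
    ‖1 - herm a b‖ = Real.cosh (hypDist a b) * √((1 - hermSq a) * (1 - hermSq b)) := by
  have ha' : 0 < 1 - hermSq a := sub_pos.2 ha
  have hb' : 0 < 1 - hermSq b := sub_pos.2 hb
  have hpos : 0 < √((1 - hermSq a) * (1 - hermSq b)) := Real.sqrt_pos.2 (mul_pos ha' hb')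
  have hle : √((1 - hermSq a) * (1 - hermSq b)) ≤ ‖1 - herm a b‖ := by
    have h0 := norm_herm_sq_le a b
    have h1 : ‖herm a b‖ ≤ 1 := by
      have : ‖herm a b‖ ^ 2 ≤ 1 := h0.trans (by nlinarith [hermSq_nonneg a, hermSq_nonneg b])
      nlinarith [norm_nonneg (herm a b)]
    have h2 : 1 - ‖herm a b‖ ≤ ‖1 - herm a b‖ := by
      have := norm_sub_norm_le (1 : ℂ) (herm a b)
      rwa [norm_one] at this
    refine le_trans (Real.sqrt_le_iff.2 ⟨by linarith, ?_⟩) h2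
    -- `2 ρ ≤ 2 |a| |b| ≤ |a|² + |b|²` for `ρ = |⟨a, b⟩|`
    have h3 : 2 * ‖herm a b‖ ≤ hermSq a + hermSq b := by
      refine abs_le_of_sq_le_sq' ?_ (by linarith [hermSq_nonneg a, hermSq_nonneg b]) |>.2
      nlinarith [sq_nonneg (hermSq a - hermSq b)]
    nlinarith [sq_nonneg (hermSq a - hermSq b), norm_nonneg (herm a b), hermSq_nonneg a,
      hermSq_nonneg b, sq_nonneg (1 - ‖herm a b‖)]
  rw [hypDist, Real.cosh_arcosh ((one_le_div hpos).2 hle), div_mul_cancel₀ _ hpos.ne']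

/-- Equality case of the triangle inequality, in the form in which it occurs for geodesics. -/
theorem eq_ofReal_of_norm_one_sub {z : ℂ} {w : ℝ} (hz : ‖z‖ ≤ |w|) (hw : w < 1)
    (h : ‖1 - z‖ = 1 - w) : z = w := by
  have h1 : (1 - z.re) ^ 2 + z.im ^ 2 = (1 - w) ^ 2 := by
    rw [← h, ← Complex.normSq_eq_norm_sq, Complex.normSq_apply]
    simp only [Complex.sub_re, Complex.one_re, Complex.sub_im, Complex.one_im]
    ring
  have h2 : z.re ^ 2 + z.im ^ 2 ≤ w ^ 2 := by
    have h3 : ‖z‖ ^ 2 ≤ w ^ 2 := by rw [← sq_abs w]; gcongr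
    rw [← Complex.normSq_eq_norm_sq, Complex.normSq_apply] at h3
    linarith
  have h4 : z.re ≤ w := by linarith
  have h5 : w ≤ z.re := by
    by_contra! hlt
    nlinarith [sq_nonneg z.im, sq_nonneg (w - z.re)]
  have h6 : z.re = w := le_antisymm h4 h5
  have h7 : z.im = 0 := by
    rw [h6] at h1
    have : z.im ^ 2 = 0 := by linarith
    exact pow_eq_zero_iff two_ne_zero |>.1 this
  exact Complex.ext (by simpa using h6) (by simpa using h7)

theorem one_sub_tanh_mul_tanh (x y : ℝ) :
    1 - Real.tanh x * Real.tanh y = Real.cosh (x - y) / (Real.cosh x * Real.cosh y) := by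
  have hx := (Real.cosh_pos x).ne'
  have hy := (Real.cosh_pos y).ne'
  rw [Real.tanh_eq_sinh_div_cosh, Real.tanh_eq_sinh_div_cosh, Real.cosh_sub]
  field_simp

theorem one_sub_tanh_sq (x : ℝ) : 1 - Real.tanh x ^ 2 = 1 / Real.cosh x ^ 2 := by
  have := one_sub_tanh_mul_tanh x x
  rw [sub_self, Real.cosh_zero, ← sq, ← sq] at this
  exact this

theorem herm_zero_right (a : ℂ × ℂ) : herm a 0 = 0 := by simp [herm]

theorem hermSq_zero : hermSq 0 = 0 := by simp [hermSq]

/-- Geodesics through the origin are the real lines, with the parametrization by `tanh`. -/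
theorem IsGeodesic.tanh_smul_eq {σ : ℝ → ℂ × ℂ} (hσ : IsGeodesic σ) {s : ℝ} (hs : σ s = 0)
    (r t : ℝ) : (Real.tanh (t - s) : ℂ) • σ r = (Real.tanh (r - s) : ℂ) • σ t := by
  have h1 : ∀ r, 1 - hermSq (σ r) = 1 / Real.cosh (r - s) ^ 2 := fun r => by
    have hb : 0 < 1 - hermSq (σ r) := sub_pos.2 (hσ.1 r)
    have h := norm_one_sub_herm (hσ.1 r) (hσ.1 s)
    rw [hσ.2, hs, herm_zero_right, hermSq_zero, sub_zero, norm_one, Real.cosh_abs, sub_zero,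
      mul_one] at h
    have h2 := congrArg (· ^ 2) h
    simp only [mul_pow, Real.sq_sqrt hb.le, one_pow] at h2
    have := (Real.cosh_pos (r - s)).ne'
    field_simp
    linarith
  have hn : ∀ r, hermSq (σ r) = Real.tanh (r - s) ^ 2 := fun r => by
    linarith [h1 r, one_sub_tanh_sq (r - s)]
  have hherm : herm (σ r) (σ t) = ((Real.tanh (r - s) * Real.tanh (t - s) : ℝ) : ℂ) := by
    refine eq_ofReal_of_norm_one_sub ?_ ?_ ?_
    · have := norm_herm_sq_le (σ r) (σ t)
      rw [hn, hn, ← mul_pow, ← sq_abs (Real.tanh _ * _)] at this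
      exact abs_le_of_sq_le_sq' this (abs_nonneg _) |>.2
    · rw [← sub_pos, one_sub_tanh_mul_tanh]
      exact div_pos (Real.cosh_pos _) (mul_pos (Real.cosh_pos _) (Real.cosh_pos _))
    · have hr := Real.cosh_pos (r - s)
      have ht := Real.cosh_pos (t - s)
      have e : 1 / Real.cosh (r - s) ^ 2 * (1 / Real.cosh (t - s) ^ 2) =
          (1 / (Real.cosh (r - s) * Real.cosh (t - s))) ^ 2 := by field_simp
      rw [norm_one_sub_herm (hσ.1 r) (hσ.1 t), hσ.2, Real.cosh_abs, h1, h1, e,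
        Real.sqrt_sq (by positivity), one_sub_tanh_mul_tanh, sub_sub_sub_cancel_right]
      ring
  rw [← sub_eq_zero, ← hermSq_eq_zero, hermSq_sub, hermSq_smul, hermSq_smul, herm_smul_left,
    herm_smul_right, hherm, hn, hn, Complex.conj_ofReal, ← Complex.ofReal_mul,
    ← Complex.ofReal_mul, Complex.ofReal_re, Complex.norm_real, Complex.norm_real,
    Real.norm_eq_abs, Real.norm_eq_abs, sq_abs, sq_abs]
  ring

theorem tanh_ne_zero {x : ℝ} (hx : x ≠ 0) : Real.tanh x ≠ 0 := by
  rw [Real.tanh_eq_sinh_div_cosh]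
  exact div_ne_zero (Real.sinh_ne_zero.2 hx) (Real.cosh_pos x).ne'

/-- A geodesic is determined by two of its points. -/
theorem IsGeodesic.eq_of_eq {σ τ : ℝ → ℂ × ℂ} (hσ : IsGeodesic σ) (hτ : IsGeodesic τ) {s t : ℝ}
    (hst : s ≠ t) (hs : σ s = τ s) (ht : σ t = τ t) : σ = τ := by
  obtain ⟨A, hA, hA0⟩ := exists_ballMap_zero_eq (hσ.1 s)
  have h0 : ballMap A.symm (σ s) = 0 := by
    rw [← hA0]; exact hA.ballMap_symm_apply (by rw [hermSq_zero]; exact zero_le_one)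
  have h0' : ballMap A.symm (τ s) = 0 := hs ▸ h0
  funext r
  have h1 := (hA.symm.isGeodesic_comp hσ).tanh_smul_eq h0 r t
  have h2 := (hA.symm.isGeodesic_comp hτ).tanh_smul_eq h0' r t
  rw [ht, ← h2] at h1
  have hne : (Real.tanh (t - s) : ℂ) ≠ 0 := by
    exact_mod_cast tanh_ne_zero (sub_ne_zero.2 hst.symm)
  have h3 := smul_right_injective _ hne h1
  have h4 := congrArg (ballMap A) h3
  rwa [hA.ballMap_apply_symm (le_of_lt (hσ.1 r)), hA.ballMap_apply_symm (le_of_lt (hτ.1 r))] at h4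

theorem isGeodesic_line {u : ℂ × ℂ} (hu : hermSq u = 1) :
    IsGeodesic fun t => (Real.tanh t : ℂ) • u := by
  have hh : herm u u = 1 := by rw [← hermSq_coe, hu, Complex.ofReal_one]
  have hn : ∀ t, 1 - hermSq ((Real.tanh t : ℂ) • u) = 1 / Real.cosh t ^ 2 := fun t => by
    rw [hermSq_smul, hu, mul_one, Complex.norm_real, Real.norm_eq_abs, sq_abs, one_sub_tanh_sq]
  refine ⟨fun t => ?_, fun s t => ?_⟩
  · have h1 := hn t
    have h2 : 0 < 1 / Real.cosh t ^ 2 := one_div_pos.2 (pow_pos (Real.cosh_pos t) 2)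
    change hermSq _ < 1
    linarith
  · have hs := Real.cosh_pos s
    have ht := Real.cosh_pos t
    have e : 1 / Real.cosh s ^ 2 * (1 / Real.cosh t ^ 2) =
        (1 / (Real.cosh s * Real.cosh t)) ^ 2 := by field_simp
    have e2 : herm ((Real.tanh s : ℂ) • u) ((Real.tanh t : ℂ) • u) =
        ((Real.tanh s * Real.tanh t : ℝ) : ℂ) := by
      rw [herm_smul_left, herm_smul_right, hh, Complex.conj_ofReal, mul_one, Complex.ofReal_mul]
    have e3 := one_sub_tanh_mul_tanh s t
    have hpos : 0 < Real.cosh (s - t) / (Real.cosh s * Real.cosh t) :=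
      div_pos (Real.cosh_pos _) (mul_pos hs ht)
    rw [hypDist, hn, hn, e, Real.sqrt_sq (by positivity), e2, ← Complex.ofReal_one,
      ← Complex.ofReal_sub, Complex.norm_real, e3, Real.norm_of_nonneg hpos.le,
      div_div_div_cancel_right₀ (by positivity) , div_one, ← Real.cosh_abs,
      Real.arcosh_cosh (abs_nonneg _)]

/-! ### The standard totally real surface -/

/-- Complex conjugation of `ℂ²`. -/
def conjPt (a : ℂ × ℂ) : ℂ × ℂ := (conj a.1, conj a.2)

/-- The real points of the ball. -/
def realBall : Set (ℂ × ℂ) := {a | a ∈ unitBall ∧ conjPt a = a}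

theorem herm_conjPt (a b : ℂ × ℂ) : herm (conjPt a) (conjPt b) = conj (herm a b) := by
  simp [herm, conjPt]

theorem hermSq_conjPt (a : ℂ × ℂ) : hermSq (conjPt a) = hermSq a := by simp [hermSq, conjPt]

theorem conjPt_eq_iff {a : ℂ × ℂ} : conjPt a = a ↔ a.1.im = 0 ∧ a.2.im = 0 := by
  simp [conjPt, Prod.ext_iff, Complex.conj_eq_iff_im]

theorem IsGeodesic.conjPt {σ : ℝ → ℂ × ℂ} (hσ : IsGeodesic σ) :
    IsGeodesic fun t => conjPt (σ t) :=
  ⟨fun t => by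
    have := hσ.1 t
    simpa only [unitBall, Set.mem_ofPred_eq, hermSq_conjPt] using this, fun s t => by
    rw [← hσ.2 s t, hypDist, hypDist, herm_conjPt, hermSq_conjPt, hermSq_conjPt]
    congr 2
    rw [← RCLike.norm_conj]
    simp⟩

theorem isTotallyGeodesic_realBall : IsTotallyGeodesic realBall := by
  intro σ hσ s t hst hs ht r
  refine ⟨hσ.1 r, ?_⟩
  exact congrFun (hσ.conjPt.eq_of_eq hσ hst hs.2 ht.2) r

theorem isTotallyRealSurface_realBall : IsTotallyRealSurface realBall := by
  intro p hp
  set L : ℂ × ℂ →L[ℝ] ℝ × ℝ := Complex.imCLM.prodMap Complex.imCLM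
  have hL : ∀ a, L a = (a.1.im, a.2.im) := fun _ => rfl
  refine ⟨unitBall, L, isOpen_unitBall, hp.1, L.contDiff.contDiffOn, ?_, ?_, ?_⟩
  · ext a
    simp only [realBall, Set.mem_inter_iff, Set.mem_ofPred_eq, conjPt_eq_iff, hL,
      Prod.mk_eq_zero]
    tauto
  · rw [L.fderiv]
    exact fun y => ⟨(y.1 * Complex.I, y.2 * Complex.I), by simp [hL]⟩
  · rw [L.fderiv]
    intro v h1 h2
    simp only [hL, Prod.mk_eq_zero, Prod.smul_fst, Prod.smul_snd, smul_eq_mul,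
      Complex.I_mul_im] at h1 h2
    exact Prod.ext (Complex.ext h2.1 h1.1) (Complex.ext h2.2 h1.2)

/-! ### Classification of the totally real totally geodesic surfaces -/

theorem real_smul_eq (τ : ℝ) (a : ℂ × ℂ) : τ • a = (τ : ℂ) • a := rfl

theorem hermSq_real_smul (τ : ℝ) (a : ℂ × ℂ) : hermSq (τ • a) = τ ^ 2 * hermSq a := by
  rw [real_smul_eq, hermSq_smul, Complex.norm_real, Real.norm_eq_abs, sq_abs]

theorem IsTotallyGeodesic.smul_mem {S : Set (ℂ × ℂ)} (h : IsTotallyGeodesic S) (hS : S ⊆ unitBall)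
    (h0 : 0 ∈ S) {q : ℂ × ℂ} (hq : q ∈ S) {τ : ℝ} (hτ : hermSq (τ • q) < 1) : τ • q ∈ S := by
  by_cases hq0 : q = 0
  · simpa [hq0] using h0
  have hpos : 0 < hermSq q :=
    lt_of_le_of_ne (hermSq_nonneg q) fun h => hq0 (hermSq_eq_zero.1 h.symm)
  set n : ℝ := √(hermSq q) with hn
  have hn0 : 0 < n := Real.sqrt_pos.2 hpos
  have hn2 : n ^ 2 = hermSq q := Real.sq_sqrt hpos.le
  have hq1 : hermSq q < 1 := hS hq
  have hn1 : n ∈ Set.Ioo (-1 : ℝ) 1 := ⟨by linarith, by nlinarith⟩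
  have hτn : τ * n ∈ Set.Ioo (-1 : ℝ) 1 := by
    rw [hermSq_real_smul, ← hn2, ← mul_pow] at hτ
    exact abs_lt.1 ((sq_lt_one_iff_abs_lt_one _).1 hτ)
  have hu : hermSq (n⁻¹ • q) = 1 := by
    rw [hermSq_real_smul, ← hn2]; field_simp
  have hline := isGeodesic_line hu
  have hne : (0 : ℝ) ≠ Real.artanh n := fun h0 => by
    have := Real.tanh_artanh hn1
    rw [← h0, Real.tanh_zero] at this
    exact hn0.ne this
  have e : ∀ c : ℝ, ((c : ℝ) : ℂ) • (n⁻¹ • q) = (c * n⁻¹) • q := fun c => by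
    rw [← real_smul_eq, smul_smul]
  have h1 := h _ hline 0 (Real.artanh n) hne (by simpa using h0)
    (by simp only [Real.tanh_artanh hn1, e, mul_inv_cancel₀ hn0.ne', one_smul]; exact hq)
    (Real.artanh (τ * n))
  simp only [Real.tanh_artanh hτn, e, mul_assoc, mul_inv_cancel₀ hn0.ne', mul_one] at h1
  exact h1

/-- If a totally real real subspace contains `v ≠ 0` and a complex multiple of `v`, then the
multiple is a real one. -/
theorem im_eq_zero_of_totallyReal {L : ℂ × ℂ →L[ℝ] ℝ × ℝ}
    (hreal : ∀ v : ℂ × ℂ, L v = 0 → L (Complex.I • v) = 0 → v = 0) {v : ℂ × ℂ} (hv0 : v ≠ 0)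
    (hv : L v = 0) {κ : ℂ} (hκ : L (κ • v) = 0) : κ.im = 0 := by
  by_contra him
  have e : κ • v = κ.re • v + κ.im • (Complex.I • v) := by
    rw [real_smul_eq, real_smul_eq, smul_smul, ← add_smul, Complex.re_add_im]
  rw [e, map_add, map_smul, map_smul, hv, smul_zero, zero_add, smul_eq_zero] at hκ
  exact hv0 (hreal v hv (hκ.resolve_left him))

section ThroughZero

variable {S : Set (ℂ × ℂ)} {L : ℂ × ℂ →L[ℝ] ℝ × ℝ} {f : ℂ × ℂ → ℝ × ℝ} {W : Set (ℂ × ℂ)}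

/-- A totally geodesic surface through the origin lies in its tangent plane. -/
theorem map_eq_zero_of_mem (hTG : IsTotallyGeodesic S) (hS : S ⊆ unitBall) (h0 : 0 ∈ S)
    (hW : W ∈ 𝓝 (0 : ℂ × ℂ)) (hSW : S ∩ W = {a ∈ W | f a = 0}) (hf : HasFDerivAt f L 0)
    {q : ℂ × ℂ} (hq : q ∈ S) : L q = 0 := by
  have hc : Continuous fun τ : ℝ => τ • q := by fun_prop
  have h1 : HasDerivAt (fun τ : ℝ => f (τ • q)) (L q) 0 := by
    have h2 : HasDerivAt (fun τ : ℝ => τ • q) q 0 := by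
      simpa using (hasDerivAt_id (0 : ℝ)).smul_const q
    exact HasFDerivAt.comp_hasDerivAt (f := fun τ : ℝ => τ • q) 0 (by simpa using hf) h2
  have h2 : HasDerivAt (fun τ : ℝ => f (τ • q)) 0 0 := by
    refine (hasDerivAt_const (0 : ℝ) (0 : ℝ × ℝ)).congr_of_eventuallyEq ?_
    have hW' : ∀ᶠ τ : ℝ in 𝓝 0, τ • q ∈ W :=
      hc.continuousAt.eventually_mem (by simpa using hW)
    have hB : ∀ᶠ τ : ℝ in 𝓝 0, τ • q ∈ unitBall :=
      hc.continuousAt.eventually_mem (by simpa using isOpen_unitBall.mem_nhds (hS h0))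
    filter_upwards [hW', hB] with τ hτ hτB
    have : τ • q ∈ S ∩ W := ⟨hTG.smul_mem hS h0 hq hτB, hτ⟩
    rw [hSW] at this
    exact this.2
  exact h1.unique h2

/-- A totally geodesic surface through the origin fills its tangent plane: it does so near the
origin by the inverse function theorem, and it is a union of lines. -/
theorem mem_of_map_eq_zero (hTG : IsTotallyGeodesic S) (hS : S ⊆ unitBall) (h0 : 0 ∈ S)
    (hW : W ∈ 𝓝 (0 : ℂ × ℂ)) (hSW : S ∩ W = {a ∈ W | f a = 0}) (hf : HasStrictFDerivAt f L 0)
    (hsurj : Function.Surjective L) {v : ℂ × ℂ} (hv : L v = 0) (hvB : hermSq v < 1) : v ∈ S := by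
  have hf0 : f 0 = 0 := by
    have : (0 : ℂ × ℂ) ∈ S ∩ W := ⟨h0, mem_of_mem_nhds hW⟩
    rw [hSW] at this
    exact this.2
  obtain ⟨Q, hQ⟩ := L.ker_closedComplemented_of_finiteDimensional_range
  have hF : HasStrictFDerivAt (fun x => (f x, Q x)) (L.prod Q) 0 := hf.prodMk Q.hasStrictFDerivAt
  have hrange : (L.prod Q).range = ⊤ := by
    rw [LinearMap.range_eq_top]
    rintro ⟨a, k⟩
    obtain ⟨y, hy⟩ := hsurj a
    have hk : L (k : ℂ × ℂ) = 0 := k.2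
    have hQy : L (Q y : ℂ × ℂ) = 0 := (Q y).2
    refine ⟨y - Q y + k, ?_⟩
    change (L (y - Q y + k), Q (y - Q y + k)) = (a, k)
    rw [map_add, map_sub, map_add, map_sub, hy, hk, hQy, hQ, hQ]
    simp
  have hmap := hF.map_nhds_eq_of_surj hrange
  simp only [hf0, map_zero] at hmap
  have himg : (fun x => (f x, Q x)) '' W ∈ 𝓝 ((0 : ℝ × ℝ), (0 : L.ker)) := by
    rw [← hmap]; exact image_mem_map hW
  have hev : ∀ᶠ τ : ℝ in 𝓝[>] 0, ((0 : ℝ × ℝ), τ • (⟨v, hv⟩ : L.ker)) ∈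
      (fun x => (f x, Q x)) '' W := by
    have hc : Continuous fun τ : ℝ => ((0 : ℝ × ℝ), τ • (⟨v, hv⟩ : L.ker)) := by fun_prop
    exact (hc.continuousAt.eventually_mem (by simpa using himg)).filter_mono nhdsWithin_le_nhds
  obtain ⟨τ, ⟨x, hxW, hx⟩, hτ⟩ := (hev.and self_mem_nhdsWithin).exists
  have hτ' : (0 : ℝ) < τ := hτ
  obtain ⟨hfx, hQx⟩ := Prod.mk.inj hx
  have hxS : x ∈ S := by
    have : x ∈ S ∩ W := by rw [hSW]; exact ⟨hxW, hfx⟩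
    exact this.1
  have hxL : L x = 0 := map_eq_zero_of_mem hTG hS h0 hW hSW hf.hasFDerivAt hxS
  have e : x = τ • v := by
    have h1 : Q x = ⟨x, hxL⟩ := hQ ⟨x, hxL⟩
    rw [h1] at hQx
    exact congrArg Subtype.val hQx
  have e2 : v = τ⁻¹ • x := by rw [e, inv_smul_smul₀ hτ'.ne']
  rw [e2] at hvB ⊢
  exact hTG.smul_mem hS h0 hxS hvB

/-- The Hermitian products of the points of a totally geodesic piece of a totally real plane are
real: otherwise the geodesic through two points would leave the plane. -/
theorem herm_im_eq_zero (hTG : IsTotallyGeodesic S) (hS : S ⊆ unitBall)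
    (hSL : ∀ q ∈ S, L q = 0) (hreal : ∀ v : ℂ × ℂ, L v = 0 → L (Complex.I • v) = 0 → v = 0)
    {p q : ℂ × ℂ} (hp : p ∈ S) (hq : q ∈ S) : (herm q p).im = 0 := by
  by_cases hpq : q - p = 0
  · rw [sub_eq_zero.1 hpq, ← hermSq_coe, Complex.ofReal_im]
  obtain ⟨A, hA, hA0⟩ := exists_ballMap_zero_eq (hS hp)
  have hpl : hermSq p ≤ 1 := le_of_lt (hS hp)
  have hql : hermSq q ≤ 1 := le_of_lt (hS hq)
  have h0l : hermSq 0 ≤ 1 := by rw [hermSq_zero]; exact zero_le_one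
  have hS'B : ballMap A.symm '' S ⊆ unitBall := by
    rintro _ ⟨a, ha, rfl⟩
    exact hA.symm.mem_unitBall (hS ha)
  have hTG' := hA.symm.isTotallyGeodesic_image hS hTG
  have h0 : (0 : ℂ × ℂ) ∈ ballMap A.symm '' S :=
    ⟨p, hp, by rw [← hA0]; exact hA.ballMap_symm_apply h0l⟩
  set u := ballMap A.symm q with hu
  have huS : u ∈ ballMap A.symm '' S := ⟨q, hq, rfl⟩
  have huB : hermSq u < 1 := hS'B huS
  have hAu : ballMap A u = q := hA.ballMap_apply_symm hql
  -- the image of the midpoint of `0` and `u` is a third point of `S`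
  have hmB : hermSq ((1 / 2 : ℝ) • u) < 1 := by
    rw [hermSq_real_smul]; linarith [hermSq_nonneg u]
  obtain ⟨m, hm, hmu⟩ := hTG'.smul_mem hS'B h0 huS hmB
  have hAm : ballMap A ((1 / 2 : ℝ) • u) = m := by
    rw [← hmu]; exact hA.ballMap_apply_symm (le_of_lt (hS hm))
  set d₀ := den A 0 with hd0
  set d₁ := den A u with hd1
  have hd0n : d₀ ≠ 0 := hA.den_ne_zero h0l
  have hdmn : den A ((1 / 2 : ℝ) • u) ≠ 0 := hA.den_ne_zero hmB.le
  have hlin : A ((1 / 2 : ℝ) • u, 1) = (1 / 2 : ℂ) • A (u, 1) + (1 / 2 : ℂ) • A (0, 1) := by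
    rw [← map_smul, ← map_smul, ← map_add]
    congr 1
    refine Prod.ext ?_ ?_
    · simp [real_smul_eq]
    · simp; norm_num
  have hdm : den A ((1 / 2 : ℝ) • u) = (d₁ + d₀) / 2 := by
    rw [den, hlin, hd0, hd1, den, den]
    simp only [Prod.snd_add, Prod.smul_snd, smul_eq_mul]
    ring
  have hsum : d₁ + d₀ ≠ 0 := fun h => hdmn (by rw [hdm, h, zero_div])
  have hmeq : (d₁ + d₀) • m = d₁ • q + d₀ • p := by
    have h1 := congrArg Prod.fst hlin
    rw [hA.map_lift hmB.le, hA.map_lift huB.le, hA.map_lift h0l, hAm, hAu, hA0, hdm] at h1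
    simp only [Prod.smul_fst, Prod.fst_add, smul_smul] at h1
    have h2 := congrArg (fun x => (2 : ℂ) • x) h1
    simp only [smul_add, smul_smul] at h2
    convert h2 using 2
    · ring
    · congr 1; ring
    · congr 1; ring
  set κ := d₁ / (d₁ + d₀) with hκ
  have hκm : m - p = κ • (q - p) := by
    have : m = (d₁ + d₀)⁻¹ • (d₁ • q + d₀ • p) := by rw [← hmeq, inv_smul_smul₀ hsum]
    rw [this, hκ]
    have e1 : p = ((d₁ + d₀)⁻¹ * (d₁ + d₀)) • p := by rw [inv_mul_cancel₀ hsum, one_smul]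
    nth_rw 2 [e1]
    module
  have hκim : κ.im = 0 := by
    refine im_eq_zero_of_totallyReal hreal hpq ?_ ?_
    · rw [map_sub, hSL q hq, hSL p hp, sub_zero]
    · rw [← hκm, map_sub, hSL m hm, hSL p hp, sub_zero]
  have hκ1 : 1 - κ ≠ 0 := by
    have : 1 - κ = d₀ / (d₁ + d₀) := by rw [hκ]; field_simp; ring
    rw [this]; exact div_ne_zero hd0n hsum
  have hd1e : d₁ = κ / (1 - κ) * d₀ := by
    have : (1 - κ) * d₁ = κ * d₀ := by rw [hκ]; field_simp; ring
    field_simp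
    linear_combination this
  have hk := hA.one_sub_herm huB.le h0l
  rw [hAu, hA0, herm_zero_right, sub_zero, ← hd1, ← hd0, hd1e, mul_assoc, Complex.mul_conj] at hk
  have hκr : κ = (κ.re : ℂ) := Complex.ext (by simp) (by simp [hκim])
  have hκr' : κ / (1 - κ) = ((κ.re / (1 - κ.re) : ℝ) : ℂ) := by
    rw [hκr]; push_cast; simp
  rw [hκr', ← Complex.ofReal_mul] at hk
  have him := congrArg Complex.im hk
  have hre := congrArg Complex.re hk
  rw [Complex.im_mul_ofReal, Complex.one_im] at him
  rw [Complex.re_mul_ofReal, Complex.one_re] at hre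
  have hne : κ.re / (1 - κ.re) * Complex.normSq d₀ ≠ 0 := fun h => by
    rw [h, mul_zero] at hre; exact zero_ne_one hre
  have := (mul_eq_zero.1 him).resolve_right hne
  simpa using this

/-- A real plane on which the Hermitian product is real has a unitary basis. -/
theorem exists_unitary_basis (hsurj : Function.Surjective L)
    (hherm : ∀ p q, L p = 0 → L q = 0 → (herm q p).im = 0) :
    ∃ u₁ u₂ : ℂ × ℂ, hermSq u₁ = 1 ∧ hermSq u₂ = 1 ∧ herm u₁ u₂ = 0 ∧
      ∀ v, L v = 0 ↔ ∃ x y : ℝ, v = (x : ℂ) • u₁ + (y : ℂ) • u₂ := by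
  have hdim : Module.finrank ℝ (LinearMap.ker (L : ℂ × ℂ →ₗ[ℝ] ℝ × ℝ)) = 2 := by
    have h1 := LinearMap.finrank_range_add_finrank_ker (L : ℂ × ℂ →ₗ[ℝ] ℝ × ℝ)
    rw [LinearMap.range_eq_top.2 hsurj, finrank_top, Module.finrank_prod, Module.finrank_prod,
      Complex.finrank_real_complex, Module.finrank_self] at h1
    omega
  let b := Module.finBasisOfFinrankEq ℝ _ hdim
  have hspan : ∀ v (hv : L v = 0), ∃ x y : ℝ, v = x • (b 0 : ℂ × ℂ) + y • (b 1 : ℂ × ℂ) := by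
    intro v hv
    have := b.sum_repr ⟨v, hv⟩
    rw [Fin.sum_univ_two] at this
    exact ⟨_, _, (congrArg Subtype.val this).symm⟩
  have hind : ∀ x y : ℝ, x • (b 0 : ℂ × ℂ) + y • (b 1 : ℂ × ℂ) = 0 → x = 0 ∧ y = 0 := by
    intro x y hxy
    have h1 := b.linearIndependent
    have h2 := Fintype.linearIndependent_iff.1 h1 ![x, y] (by
      rw [Fin.sum_univ_two]
      exact Subtype.ext hxy)
    exact ⟨h2 0, h2 1⟩
  have hb0 : L (b 0 : ℂ × ℂ) = 0 := (b 0).2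
  have hb1 : L (b 1 : ℂ × ℂ) = 0 := (b 1).2
  set b₀ : ℂ × ℂ := (b 0).1
  set b₁ : ℂ × ℂ := (b 1).1
  have hpos : ∀ {w : ℂ × ℂ}, w ≠ 0 → 0 < √(hermSq w) := fun {w} hw =>
    Real.sqrt_pos.2 (lt_of_le_of_ne (hermSq_nonneg w) fun h => hw (hermSq_eq_zero.1 h.symm))
  have hunit : ∀ {w : ℂ × ℂ}, w ≠ 0 → hermSq ((√(hermSq w))⁻¹ • w) = 1 := fun {w} hw => by
    rw [hermSq_real_smul, inv_pow, Real.sq_sqrt (hermSq_nonneg w)]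
    exact inv_mul_cancel₀ fun h => hw (hermSq_eq_zero.1 h)
  have hb00 : b₀ ≠ 0 := fun h => one_ne_zero (hind 1 0 (by simp [h])).1
  set n : ℝ := √(hermSq b₀)
  set u₁ : ℂ × ℂ := n⁻¹ • b₀ with hu1
  have hu1L : L u₁ = 0 := by rw [hu1, map_smul, hb0, smul_zero]
  have hu1n : hermSq u₁ = 1 := hunit hb00
  set c : ℝ := (herm b₁ u₁).re
  have hc : herm b₁ u₁ = (c : ℂ) := Complex.ext (by simp [c]) (by simp [hherm u₁ b₁ hu1L hb1])
  set w : ℂ × ℂ := b₁ - c • u₁ with hw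
  have hwL : L w = 0 := by rw [hw, map_sub, map_smul, hb1, hu1L, smul_zero, sub_zero]
  have hw0 : w ≠ 0 := fun h => by
    refine one_ne_zero (hind (-(c * n⁻¹)) 1 ?_).2
    rw [← h, hw, hu1, smul_smul, neg_smul, one_smul]
    abel
  have hwu : herm u₁ w = 0 := by
    have : herm w u₁ = 0 := by
      have e : herm w u₁ = herm b₁ u₁ - c * herm u₁ u₁ := by
        simp only [hw, herm, Prod.fst_sub, Prod.snd_sub, real_smul_eq, Prod.smul_fst,
          Prod.smul_snd, smul_eq_mul]
        ring
      rw [e, hc, ← hermSq_coe, hu1n]; simp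
    rw [← conj_herm, this, map_zero]
  set k : ℝ := √(hermSq w)
  have hk : k ≠ 0 := (hpos hw0).ne'
  have hn : n ≠ 0 := (hpos hb00).ne'
  refine ⟨u₁, k⁻¹ • w, hu1n, hunit hw0, ?_, fun v => ⟨fun hv => ?_, ?_⟩⟩
  · rw [real_smul_eq, herm_smul_right, hwu, mul_zero]
  · obtain ⟨x, y, rfl⟩ := hspan v hv
    refine ⟨x * n + y * c, y * k, ?_⟩
    have e0 : b₀ = n • u₁ := (smul_inv_smul₀ hn b₀).symm
    have e1 : b₁ = k • (k⁻¹ • w) + c • u₁ := by rw [smul_inv_smul₀ hk, hw]; abel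
    rw [e0, e1, ← real_smul_eq, ← real_smul_eq]
    module
  · rintro ⟨x, y, rfl⟩
    have h1 : L (k⁻¹ • w) = 0 := by rw [map_smul, hwL, smul_zero]
    have h2 : ∀ (c : ℝ) (z : ℂ × ℂ), L z = 0 → L (c • z) = 0 := fun c z hz => by
      rw [map_smul, hz, smul_zero]
    rw [← real_smul_eq, ← real_smul_eq, map_add, h2 _ _ hu1L, h2 _ _ h1, add_zero]

end ThroughZero

theorem conjPt_eq_self_iff {a : ℂ × ℂ} :
    conjPt a = a ↔ ∃ x y : ℝ, a = ((x : ℂ), (y : ℂ)) := by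
  rw [conjPt_eq_iff]
  constructor
  · rintro ⟨h1, h2⟩
    exact ⟨a.1.re, a.2.re, Prod.ext (Complex.ext (by simp) (by simp [h1]))
      (Complex.ext (by simp) (by simp [h2]))⟩
  · rintro ⟨x, y, rfl⟩
    simp

theorem exists_eq_image_of_zero_mem {S : Set (ℂ × ℂ)} (h0 : 0 ∈ S) (hS : S ⊆ unitBall)
    (hTR : IsTotallyRealSurface S) (hTG : IsTotallyGeodesic S) :
    ∃ A, PreservesForm A ∧ S = ballMap A '' realBall := by
  obtain ⟨W, f, hW, h0W, hf, hSW, hsurj, hreal⟩ := hTR 0 h0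
  have hWn : W ∈ 𝓝 (0 : ℂ × ℂ) := hW.mem_nhds h0W
  have hfs : HasStrictFDerivAt f (fderiv ℝ f 0) 0 :=
    (hf.contDiffAt hWn).hasStrictFDerivAt (by simp)
  set L := fderiv ℝ f 0
  have hSL : ∀ q ∈ S, L q = 0 := fun q hq =>
    map_eq_zero_of_mem hTG hS h0 hWn hSW hfs.hasFDerivAt hq
  have hLS : ∀ v, L v = 0 → hermSq v < 1 → v ∈ S := fun v hv hvB =>
    mem_of_map_eq_zero hTG hS h0 hWn hSW hfs hsurj hv hvB
  -- by scaling, all products of vectors of the tangent plane are real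
  have hherm : ∀ p q, L p = 0 → L q = 0 → (herm q p).im = 0 := by
    intro p q hp hq
    have hshrink : ∀ v : ℂ × ℂ, hermSq ((1 + hermSq v)⁻¹ • v) < 1 := fun v => by
      have := hermSq_nonneg v
      rw [hermSq_real_smul, inv_pow, inv_mul_lt_iff₀ (by positivity)]
      nlinarith
    have h1 := herm_im_eq_zero hTG hS hSL hreal
      (hLS _ (by rw [map_smul, hp, smul_zero]) (hshrink p))
      (hLS _ (by rw [map_smul, hq, smul_zero]) (hshrink q))
    rw [real_smul_eq, real_smul_eq, herm_smul_left, herm_smul_right, Complex.conj_ofReal,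
      ← mul_assoc, ← Complex.ofReal_mul, Complex.im_ofReal_mul] at h1
    refine (mul_eq_zero.1 h1).resolve_left ?_
    have := hermSq_nonneg p
    have := hermSq_nonneg q
    positivity
  obtain ⟨u₁, u₂, h11, h22, h12, hspan⟩ := exists_unitary_basis hsurj hherm
  have hz : ∀ a : ℂ × ℂ, herm a 0 = 0 := herm_zero_right
  obtain ⟨A, hA, hAe⟩ := exists_preservesForm (e₁ := (u₁, 0)) (e₂ := (u₂, 0))
    (e₃ := ((0 : ℂ × ℂ), 1))
    (by simp [indef, ← hermSq_coe, h11]) (by simp [indef, ← hermSq_coe, h22])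
    (by simp [indef, hz]) (by simp [indef, h12]) (by simp [indef, hz]) (by simp [indef, hz])
  have hAb : ∀ a, ballMap A a = a.1 • u₁ + a.2 • u₂ := fun a => by
    simp [ballMap, den, hAe]
  refine ⟨A, hA, ?_⟩
  ext v
  constructor
  · intro hv
    obtain ⟨x, y, hxy⟩ := (hspan v).1 (hSL v hv)
    have hAx : ballMap A ((x : ℂ), (y : ℂ)) = v := by rw [hAb, hxy]
    have hB : ((x : ℂ), (y : ℂ)) ∈ unitBall := by
      have h1 : A (((x : ℂ), (y : ℂ)), 1) = (v, 1) := by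
        rw [hAe, hxy]; simp
      have h2 := hA (((x : ℂ), (y : ℂ)), 1) (((x : ℂ), (y : ℂ)), 1)
      rw [h1, indef_lift, indef_lift, ← hermSq_coe, ← hermSq_coe] at h2
      have h3 : hermSq v = hermSq ((x : ℂ), (y : ℂ)) := by
        have : hermSq v - 1 = hermSq ((x : ℂ), (y : ℂ)) - 1 := by exact_mod_cast h2
        linarith
      change hermSq _ < 1
      rw [← h3]
      exact hS hv
    exact ⟨_, ⟨hB, conjPt_eq_self_iff.2 ⟨x, y, rfl⟩⟩, hAx⟩
  · rintro ⟨a, ⟨haB, ha⟩, rfl⟩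
    obtain ⟨x, y, rfl⟩ := conjPt_eq_self_iff.1 ha
    exact hLS _ ((hspan _).2 ⟨x, y, hAb _⟩) (hA.mem_unitBall haB)

theorem exists_eq_image_realBall {S : Set (ℂ × ℂ)} (hne : S.Nonempty) (hS : S ⊆ unitBall)
    (hTR : IsTotallyRealSurface S) (hTG : IsTotallyGeodesic S) :
    ∃ A, PreservesForm A ∧ S = ballMap A '' realBall := by
  obtain ⟨p, hp⟩ := hne
  obtain ⟨A, hA, hA0⟩ := exists_ballMap_zero_eq (hS hp)
  have h0 : (0 : ℂ × ℂ) ∈ ballMap A.symm '' S :=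
    ⟨p, hp, by rw [← hA0]; exact hA.ballMap_symm_apply (by rw [hermSq_zero]; exact zero_le_one)⟩
  have hB : ballMap A.symm '' S ⊆ unitBall := by
    rintro _ ⟨a, ha, rfl⟩
    exact hA.symm.mem_unitBall (hS ha)
  obtain ⟨M, hM, hMe⟩ := exists_eq_image_of_zero_mem h0 hB
    (hA.symm.isTotallyRealSurface_image hS hTR) (hA.symm.isTotallyGeodesic_image hS hTG)
  refine ⟨M.trans A, hM.trans hA, ?_⟩
  ext v
  constructor
  · intro hv
    have h1 : ballMap A.symm v ∈ ballMap M '' realBall := by rw [← hMe]; exact ⟨v, hv, rfl⟩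
    obtain ⟨a, ha, hav⟩ := h1
    refine ⟨a, ha, ?_⟩
    rw [← hM.ballMap_ballMap (le_of_lt ha.1), hav, hA.ballMap_apply_symm (le_of_lt (hS hv))]
  · rintro ⟨a, ha, rfl⟩
    have h1 : ballMap M a ∈ ballMap A.symm '' S := by rw [hMe]; exact ⟨a, ha, rfl⟩
    obtain ⟨v, hv, hva⟩ := h1
    rw [← hM.ballMap_ballMap (le_of_lt ha.1), ← hva, hA.ballMap_apply_symm (le_of_lt (hS hv))]
    exact hv

/-! ### Circles at infinity -/

/-- The real points of the sphere. -/
def realCircle : Set (ℂ × ℂ) := {a | hermSq a = 1 ∧ conjPt a = a}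

theorem closure_image_realBall_inter {A : ((ℂ × ℂ) × ℂ) ≃L[ℂ] ((ℂ × ℂ) × ℂ)}
    (hA : PreservesForm A) {a : ℂ × ℂ} (ha : hermSq a = 1) :
    a ∈ closure (ballMap A '' realBall) ↔ a ∈ ballMap A '' realCircle := by
  set K : Set (ℂ × ℂ) := {a | hermSq a ≤ 1 ∧ conjPt a = a} with hK
  have hcont : ContinuousOn (ballMap A) K := fun x hx =>
    (hA.contDiffAt_ballMap hx.1).continuousAt.continuousWithinAt
  have hhs : Continuous hermSq := by unfold hermSq; fun_prop
  have hKclosed : IsClosed K := by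
    refine (isClosed_le hhs continuous_const).inter (isClosed_eq ?_ continuous_id)
    have hc : Continuous fun z : ℂ => conj z := Complex.continuous_conj
    unfold conjPt
    fun_prop
  have hKcomp : IsCompact K := by
    refine Metric.isCompact_of_isClosed_isBounded hKclosed ?_
    refine (Metric.isBounded_closedBall (x := (0 : ℂ × ℂ)) (r := 1)).subset fun x hx => ?_
    have h1 : ‖x.1‖ ^ 2 + ‖x.2‖ ^ 2 ≤ 1 := hx.1
    rw [mem_closedBall_zero_iff, Prod.norm_def]
    refine max_le ?_ ?_
    · nlinarith [norm_nonneg x.1, sq_nonneg ‖x.2‖]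
    · nlinarith [norm_nonneg x.2, sq_nonneg ‖x.1‖]
  constructor
  · intro h
    have hsub : ballMap A '' realBall ⊆ ballMap A '' K :=
      Set.image_mono fun x hx => ⟨le_of_lt hx.1, hx.2⟩
    obtain ⟨x, hx, rfl⟩ := closure_minimal hsub (hKcomp.image_of_continuousOn hcont).isClosed h
    refine ⟨x, ⟨?_, hx.2⟩, rfl⟩
    rw [← hA.ballMap_symm_apply hx.1]
    exact hA.symm.hermSq_eq_one ha
  · rintro ⟨x, hx, rfl⟩
    have hxl : hermSq x ≤ 1 := hx.1.le
    -- approximate `x` by `τ x` with `τ < 1`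
    have hlim : Tendsto (fun τ : ℝ => ballMap A (τ • x)) (𝓝[<] 1) (𝓝 (ballMap A x)) := by
      have hc : Tendsto (fun τ : ℝ => τ • x) (𝓝[<] 1) (𝓝 x) := by
        have : Continuous fun τ : ℝ => τ • x := by fun_prop
        simpa using (this.tendsto 1).mono_left nhdsWithin_le_nhds
      exact (hA.contDiffAt_ballMap hxl).continuousAt.tendsto.comp hc
    refine mem_closure_of_tendsto hlim ?_
    have h1 : ∀ᶠ τ : ℝ in 𝓝[<] 1, 0 < τ :=
      nhdsWithin_le_nhds (lt_mem_nhds zero_lt_one)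
    filter_upwards [h1, self_mem_nhdsWithin] with τ hτ hτ1
    have hτ1' : τ < 1 := hτ1
    refine ⟨τ • x, ⟨?_, ?_⟩, rfl⟩
    · change hermSq (τ • x) < 1
      rw [hermSq_real_smul, hx.1]
      nlinarith
    · have := hx.2
      rw [conjPt_eq_iff] at this ⊢
      simp [this.1, this.2]

/-- The circles in question are the images of the real points of the sphere under the projective
unitary group. -/
theorem isRCircle_iff (C : Set (OnePoint Heis)) :
    IsRCircle C ↔ ∃ A, PreservesForm A ∧ C = {p | toSphere p ∈ ballMap A '' realCircle} := by
  constructor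
  · rintro ⟨S, hne, hS, hTR, hTG, rfl⟩
    obtain ⟨A, hA, rfl⟩ := exists_eq_image_realBall hne hS hTR hTG
    refine ⟨A, hA, ?_⟩
    ext p
    exact closure_image_realBall_inter hA (hermSq_toSphere p)
  · rintro ⟨A, hA, rfl⟩
    have hRB : realBall ⊆ unitBall := fun a ha => ha.1
    refine ⟨ballMap A '' realBall, ⟨_, 0, ⟨?_, ?_⟩, rfl⟩, ?_,
      hA.isTotallyRealSurface_image hRB isTotallyRealSurface_realBall,
      hA.isTotallyGeodesic_image hRB isTotallyGeodesic_realBall, ?_⟩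
    · change hermSq 0 < 1
      rw [hermSq_zero]; exact zero_lt_one
    · simp [conjPt]
    · rintro _ ⟨a, ha, rfl⟩
      exact hA.mem_unitBall ha.1
    · ext p
      exact (closure_image_realBall_inter hA (hermSq_toSphere p)).symm

/-! ### Loops of zero energy -/

/-- A continuous injective loop in the circle is surjective: the stereographic projection from an
omitted point would be a periodic continuous function that is injective on a period. -/
theorem exists_eq_of_injective_loop {x y : ℝ → ℝ} {P : ℝ} (hP : 0 < P) (hx : Continuous x)
    (hy : Continuous y) (hxp : Function.Periodic x P) (hyp : Function.Periodic y P)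
    (hxy : ∀ t, x t ^ 2 + y t ^ 2 = 1)
    (hinj : ∀ s t, |s - t| < P → x s = x t → y s = y t → s = t) {a b : ℝ}
    (hab : a ^ 2 + b ^ 2 = 1) : ∃ t, x t = a ∧ y t = b := by
  by_contra! hcon
  set X : ℝ → ℝ := fun t => a * x t + b * y t with hX
  set Y : ℝ → ℝ := fun t => a * y t - b * x t with hY
  have hXY : ∀ t, X t ^ 2 + Y t ^ 2 = 1 := fun t => by
    simp only [hX, hY]
    linear_combination (x t ^ 2 + y t ^ 2) * hab + hxy t
  have hx' : ∀ t, x t = a * X t - b * Y t := fun t => by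
    simp only [hX, hY]; linear_combination (-x t) * hab
  have hy' : ∀ t, y t = b * X t + a * Y t := fun t => by
    simp only [hX, hY]; linear_combination (-y t) * hab
  have hX1 : ∀ t, 1 - X t ≠ 0 := fun t h => by
    have h1 : X t = 1 := by linarith
    have h2 : Y t = 0 := by
      have := hXY t
      rw [h1] at this
      exact pow_eq_zero_iff two_ne_zero |>.1 (by linarith)
    exact hcon t (by rw [hx', h1, h2]; ring) (by rw [hy', h1, h2]; ring)
  set k : ℝ → ℝ := fun t => Y t / (1 - X t) with hk
  have hkc : Continuous k := by
    refine Continuous.div (by fun_prop) (by fun_prop) hX1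
  have hkp : ∀ t, k (t + P) = k t := fun t => by simp only [hk, hX, hY, hxp t, hyp t]
  have hkinj : ∀ s t, |s - t| < P → k s = k t → s = t := by
    intro s t hst e
    have h1 : ∀ t, k t ^ 2 * (1 - X t) = 1 + X t := fun t => by
      have := hX1 t
      have h2 := hXY t
      simp only [hk]
      field_simp
      linarith
    have h2 : X s = X t := by
      have hs := h1 s
      have ht := h1 t
      rw [e] at hs
      have : (k t ^ 2 + 1) * (X s - X t) = 0 := by linear_combination ht - hs
      rcases mul_eq_zero.1 this with h | h
      · nlinarith [sq_nonneg (k t)]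
      · linarith
    have h3 : Y s = Y t := by
      have hs : Y s = k s * (1 - X s) := by simp only [hk]; rw [div_mul_cancel₀ _ (hX1 s)]
      have ht : Y t = k t * (1 - X t) := by simp only [hk]; rw [div_mul_cancel₀ _ (hX1 t)]
      rw [hs, ht, e, h2]
    exact hinj s t hst (by rw [hx', hx', h2, h3]) (by rw [hy', hy', h2, h3])
  set g : ℝ → ℝ := fun t => k t - k (t + P / 2) with hg
  have hgc : Continuous g := by fun_prop
  have hg2 : g (P / 2) = -g 0 := by
    simp only [hg]
    rw [add_halves, zero_add]
    have := hkp 0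
    rw [zero_add] at this
    rw [this]; ring
  have h0 : (0 : ℝ) ∈ Set.uIcc (g 0) (g (P / 2)) := by
    rw [hg2, Set.mem_uIcc]
    rcases le_total (g 0) 0 with h | h
    · exact Or.inl ⟨h, by linarith⟩
    · exact Or.inr ⟨by linarith, h⟩
  obtain ⟨t, -, ht⟩ := intermediate_value_uIcc (hgc.continuousOn) h0
  have := hkinj t (t + P / 2) (by
    rw [sub_add_cancel_left, abs_neg, abs_of_pos (by linarith)]; linarith) (sub_eq_zero.1 ht)
  linarith

/-- Three null vectors with negative real products span an orthonormal frame over `ℝ`. -/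
theorem exists_real_frame {V₁ V₂ V₃ : (ℂ × ℂ) × ℂ} {a b d : ℝ}
    (ha : 0 < a) (hb : 0 < b) (hd : 0 < d) (h11 : indef V₁ V₁ = 0) (h22 : indef V₂ V₂ = 0)
    (h33 : indef V₃ V₃ = 0) (h12 : indef V₁ V₂ = ((-a : ℝ) : ℂ))
    (h13 : indef V₁ V₃ = ((-b : ℝ) : ℂ)) (h23 : indef V₂ V₃ = ((-d : ℝ) : ℂ)) :
    ∃ A, PreservesForm A ∧ ∀ v, (indef v V₁).im = 0 → (indef v V₂).im = 0 →
      (indef v V₃).im = 0 → (A.symm v).1.1.im = 0 ∧ (A.symm v).1.2.im = 0 ∧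
        (A.symm v).2.im = 0 := by
  have h21 : indef V₂ V₁ = ((-a : ℝ) : ℂ) := by rw [← conj_indef, h12, Complex.conj_ofReal]
  have h31 : indef V₃ V₁ = ((-b : ℝ) : ℂ) := by rw [← conj_indef, h13, Complex.conj_ofReal]
  have h32 : indef V₃ V₂ = ((-d : ℝ) : ℂ) := by rw [← conj_indef, h23, Complex.conj_ofReal]
  obtain ⟨α, hα⟩ : ∃ α : ℝ, α ^ 2 = 1 / (2 * a) := ⟨√(1 / (2 * a)), Real.sq_sqrt (by positivity)⟩
  obtain ⟨β, hβ⟩ : ∃ β : ℝ, β ^ 2 = a / (2 * b * d) :=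
    ⟨√(a / (2 * b * d)), Real.sq_sqrt (by positivity)⟩
  -- a vector of the real span
  set R : ℝ → ℝ → ℝ → (ℂ × ℂ) × ℂ := fun x y z => (x : ℂ) • V₁ + (y : ℂ) • V₂ + (z : ℂ) • V₃
    with hR
  have hRR : ∀ x y z x' y' z', indef (R x y z) (R x' y' z') =
      ((-a * (x * y' + y * x') - b * (x * z' + z * x') - d * (y * z' + z * y') : ℝ) : ℂ) := by
    intro x y z x' y' z'
    simp only [hR, indef_add_left, indef_add_right, indef_smul_left, indef_smul_right, h11, h22,
      h33, h12, h13, h23, h21, h31, h32, Complex.conj_ofReal]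
    push_cast
    ring
  have hRv : ∀ x y z v, (indef v V₁).im = 0 → (indef v V₂).im = 0 → (indef v V₃).im = 0 →
      (indef v (R x y z)).im = 0 := by
    intro x y z v h1 h2 h3
    simp only [hR, indef_add_right, indef_smul_right, Complex.conj_ofReal, Complex.add_im,
      Complex.im_ofReal_mul, h1, h2, h3, mul_zero, add_zero]
  have hα' : α * α = 1 / (2 * a) := by rw [← hα]; ring
  have hβ' : β * β = a / (2 * b * d) := by rw [← hβ]; ring
  obtain ⟨A, hA, hAe⟩ := exists_preservesForm (e₁ := R α (-α) 0)
    (e₂ := R (-(β * (d / a))) (-(β * (b / a))) β) (e₃ := R α α 0)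
    (by
      rw [hRR, ← Complex.ofReal_one]; congr 1
      have : 2 * a * (α * α) = 1 := by rw [hα']; field_simp
      linear_combination this)
    (by
      rw [hRR, ← Complex.ofReal_one]; congr 1
      have : 2 * b * d / a * (β * β) = 1 := by rw [hβ']; field_simp
      rw [← this]
      field_simp
      ring)
    (by
      rw [hRR, ← Complex.ofReal_one, ← Complex.ofReal_neg]; congr 1
      have : 2 * a * (α * α) = 1 := by rw [hα']; field_simp
      linear_combination -this)
    (by
      rw [hRR, ← Complex.ofReal_zero]; congr 1
      field_simp
      ring)
    (by
      rw [hRR, ← Complex.ofReal_zero]; congr 1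
      ring)
    (by
      rw [hRR, ← Complex.ofReal_zero]; congr 1
      field_simp
      ring)
  refine ⟨A, hA, fun v h1 h2 h3 => ?_⟩
  have key : ∀ w, indef (A.symm v) w = indef v (A w) := fun w => by
    rw [← hA, A.apply_symm_apply]
  have k1 := key ((1, 0), 0)
  have k2 := key ((0, 1), 0)
  have k3 := key ((0, 0), 1)
  simp only [hAe, one_smul, zero_smul, add_zero, zero_add] at k1 k2 k3
  simp only [indef, herm, map_one, map_zero, mul_one, mul_zero, add_zero, zero_add, sub_zero,
    zero_sub] at k1 k2 k3
  refine ⟨?_, ?_, ?_⟩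
  · rw [k1]; exact hRv _ _ _ v h1 h2 h3
  · rw [k2]; exact hRv _ _ _ v h1 h2 h3
  · have := congrArg Complex.im k3
    rw [Complex.neg_im] at this
    rw [← neg_eq_zero, this]
    exact hRv _ _ _ v h1 h2 h3

namespace LegendrianLoop

variable {γ : ℝ → ℂ × ℂ} {P : ℝ}

theorem gapQuot_re_pos (h : LegendrianLoop γ P) {p : ℝ × ℝ} (hp : p ∈ strip P) :
    0 < (gapQuot γ p).re := by
  obtain ⟨s, t⟩ := p
  by_cases hst : s = t
  · subst hst
    rw [h.gapQuot_self, Complex.ofReal_re]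
    have := norm_pos_iff.2 (h.speed_ne_zero s)
    positivity
  · have h1 := h.gap_re_pos (fun e => hst (h.eq_of_abs_sub_lt hp e))
    rw [h.gap_eq, ← Complex.ofReal_sub, ← Complex.ofReal_pow, Complex.re_ofReal_mul] at h1
    exact pos_of_mul_pos_right h1 (sq_nonneg _)

theorem hasDerivAt_arg_gapQuot (h : LegendrianLoop γ P) {s t : ℝ} (hst : (s, t) ∈ strip P) :
    HasDerivAt (fun s => (gapQuot γ (s, t)).arg) (2 * (regLogDeriv γ (s, t)).im) s := by
  have h2 : HasDerivAt (fun s : ℝ => (s, t)) ((1 : ℝ), (0 : ℝ)) s :=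
    (hasDerivAt_id s).prodMk (hasDerivAt_const s t)
  have h3 : HasDerivAt (fun s : ℝ => gapQuot γ (s, t)) (fderiv ℝ (gapQuot γ) (s, t) (1, 0)) s :=
    ((h.contDiff_gapQuot.differentiable (by simp)) (s, t)).hasFDerivAt.comp_hasDerivAt
      (f := fun s : ℝ => (s, t)) s h2
  have h4 := h3.clog_real (Or.inl (h.gapQuot_re_pos hst))
  have h5 := Complex.imCLM.hasFDerivAt.comp_hasDerivAt s h4
  have e : (2 * (regLogDeriv γ (s, t)).im) =
      Complex.imCLM (fderiv ℝ (gapQuot γ) (s, t) (1, 0) / gapQuot γ (s, t)) := by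
    rw [regLogDeriv, Complex.imCLM_apply, mul_div_assoc]
    have : (1 / 2 : ℂ) = ((1 / 2 : ℝ) : ℂ) := by push_cast; rfl
    rw [this, Complex.im_ofReal_mul]
    ring
  have e' : (fun s => (gapQuot γ (s, t)).arg) =
      Complex.imCLM ∘ fun s => Complex.log (gapQuot γ (s, t)) :=
    funext fun _ => (Complex.log_im _).symm
  rw [e, e']
  exact h5

/-- When the density vanishes, `cross` is real, and so is its regular part. -/
theorem regCross_im (h : LegendrianLoop γ P) (h0 : ∀ s t, density γ s t = 0) {p : ℝ × ℝ}
    (hp : p ∈ strip P) : (regCross γ p).im = 0 := by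
  have hcross : ∀ s t, (cross γ s t).im = 0 := fun s t => by
    have h1 : ‖cross γ s t‖ = (cross γ s t).re := sub_eq_zero.1 (h0 s t)
    have h2 : ‖cross γ s t‖ ^ 2 = (cross γ s t).re ^ 2 + (cross γ s t).im ^ 2 := by
      rw [← Complex.normSq_eq_norm_sq, Complex.normSq_apply]; ring
    rw [h1] at h2
    exact pow_eq_zero_iff two_ne_zero |>.1 (by linarith)
  have hoff : ∀ s t, (s, t) ∈ strip P → s ≠ t → (regCross γ (s, t)).im = 0 := by
    intro s t hst hne
    have h1 := congrArg Complex.im (h.cross_eq hst hne)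
    have e : (1 : ℂ) / ((s : ℂ) - t) ^ 2 = ((1 / (s - t) ^ 2 : ℝ) : ℂ) := by push_cast; rfl
    rw [hcross, e, Complex.add_im, Complex.ofReal_im, zero_add] at h1
    exact h1.symm
  obtain ⟨s, t⟩ := p
  by_cases hst : s = t
  · subst hst
    have hc : ContinuousAt (fun t => (regCross γ (s, t)).im) s := by
      refine Complex.continuous_im.continuousAt.comp ?_
      exact ContinuousAt.comp (g := regCross γ) (f := fun t : ℝ => (s, t))
        (h.continuousOn_regCross.continuousAt ((isOpen_strip P).mem_nhds hp))
        (Continuous.continuousAt (by fun_prop))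
    have h1 : Tendsto (fun t => (regCross γ (s, t)).im) (𝓝[≠] s) (𝓝 (regCross γ (s, s)).im) :=
      hc.tendsto.mono_left nhdsWithin_le_nhds
    refine tendsto_nhds_unique (h1.congr' ?_) tendsto_const_nhds
    have ho : IsOpen {t : ℝ | (s, t) ∈ strip P} := (isOpen_strip P).preimage (by fun_prop)
    filter_upwards [nhdsWithin_le_nhds (ho.mem_nhds hp), self_mem_nhdsWithin] with t ht hne
    exact hoff s t ht (Ne.symm hne)
  · exact hoff s t hp hst

theorem regLogDeriv_im_eq (h : LegendrianLoop γ P) (h0 : ∀ s t, density γ s t = 0) {s t t' : ℝ}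
    (ht : (s, t) ∈ strip P) (ht' : (s, t') ∈ strip P) :
    (regLogDeriv γ (s, t)).im = (regLogDeriv γ (s, t')).im := by
  have hmem : ∀ u ∈ Set.Ioo (s - P) (s + P), (s, u) ∈ strip P := fun u hu => by
    simp only [strip, Set.mem_ofPred_eq]
    exact abs_lt.2 ⟨by linarith [hu.2], by linarith [hu.1]⟩
  have hmem' : ∀ u, (s, u) ∈ strip P → u ∈ Set.Ioo (s - P) (s + P) := fun u hu => by
    simp only [strip, Set.mem_ofPred_eq] at hu
    obtain ⟨h1, h2⟩ := abs_lt.1 hu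
    exact ⟨by linarith, by linarith⟩
  have hd : ∀ u ∈ Set.Ioo (s - P) (s + P),
      HasDerivAt (fun u => (regLogDeriv γ (s, u)).im) 0 u := fun u hu => by
    have h1 := Complex.imCLM.hasFDerivAt.comp_hasDerivAt u (h.hasDerivAt_regLogDeriv (hmem u hu))
    rw [Complex.imCLM_apply, h.regCross_im h0 (hmem u hu)] at h1
    exact h1
  exact isOpen_Ioo.is_const_of_deriv_eq_zero isPreconnected_Ioo
    (fun u hu => (hd u hu).differentiableAt.differentiableWithinAt) (fun u hu => (hd u hu).deriv)
    (hmem' t ht) (hmem' t' ht')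

/-- When the density vanishes, the mixed derivative of `arg gap` vanishes, so that `arg gap` is a
difference of functions of one variable, and the points of the loop have lifts with real indefinite
products. -/
theorem exists_phase (h : LegendrianLoop γ P) (h0 : ∀ s t, density γ s t = 0) :
    ∃ c : ℝ → ℂ, (∀ t, c t ≠ 0) ∧ ∀ s ∈ Set.Ico 0 P, ∀ t ∈ Set.Ico 0 P,
      c s * conj (c t) * gap γ s t = ‖gap γ s t‖ := by
  have hP := h.period_pos
  set G : ℝ → ℝ → ℝ := fun s t => (gapQuot γ (s, t)).arg with hG
  have hadd : ∀ s ∈ Set.Ico 0 P, ∀ t ∈ Set.Ico 0 P, G s t = G s 0 - G t 0 := by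
    intro s hs t ht
    have hd : ∀ u ∈ Set.Ioo (t - P) P, HasDerivAt (fun u => G u t - G u 0) 0 u := fun u hu => by
      have m1 : (u, t) ∈ strip P := by
        simp only [strip, Set.mem_ofPred_eq]
        exact abs_lt.2 ⟨by linarith [hu.1], by linarith [hu.2, ht.1]⟩
      have m2 : (u, 0) ∈ strip P := by
        simp only [strip, Set.mem_ofPred_eq, sub_zero]
        exact abs_lt.2 ⟨by linarith [hu.1, ht.1], hu.2⟩
      have := (h.hasDerivAt_arg_gapQuot m1).sub (h.hasDerivAt_arg_gapQuot m2)
      rw [h.regLogDeriv_im_eq h0 m1 m2, sub_self] at this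
      exact this
    have h1 := isOpen_Ioo.is_const_of_deriv_eq_zero isPreconnected_Ioo
      (fun u hu => (hd u hu).differentiableAt.differentiableWithinAt) (fun u hu => (hd u hu).deriv)
      (show s ∈ Set.Ioo (t - P) P from ⟨by linarith [hs.1, ht.2], hs.2⟩)
      (show t ∈ Set.Ioo (t - P) P from ⟨by linarith, ht.2⟩)
    have h2 : G t t = 0 := by
      simp only [hG, h.gapQuot_self]
      exact Complex.arg_ofReal_of_nonneg (by positivity)
    simp only [h2, zero_sub] at h1
    linarith
  refine ⟨fun t => Complex.exp (-(G t 0 * Complex.I)), fun t => Complex.exp_ne_zero _,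
    fun s hs t ht => ?_⟩
  have e1 : Complex.exp (-(G s 0 * Complex.I)) * conj (Complex.exp (-(G t 0 * Complex.I))) *
      Complex.exp ((G s t : ℂ) * Complex.I) = 1 := by
    rw [← Complex.exp_conj, ← Complex.exp_add, ← Complex.exp_add, hadd s hs t ht, map_neg,
      map_mul, Complex.conj_ofReal, Complex.conj_I]
    push_cast
    ring_nf
    exact Complex.exp_zero
  have e2 : gapQuot γ (s, t) = ‖gapQuot γ (s, t)‖ * Complex.exp ((G s t : ℂ) * Complex.I) :=
    (Complex.norm_mul_exp_arg_mul_I _).symm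
  have e3 : gap γ s t = (((s - t) ^ 2 * ‖gapQuot γ (s, t)‖ : ℝ) : ℂ) *
      Complex.exp ((G s t : ℂ) * Complex.I) := by
    rw [h.gap_eq]
    conv_lhs => rw [e2]
    push_cast; ring
  have e4 : ‖gap γ s t‖ = (s - t) ^ 2 * ‖gapQuot γ (s, t)‖ := by
    rw [e3, norm_mul, Complex.norm_exp_ofReal_mul_I, mul_one, Complex.norm_real,
      Real.norm_of_nonneg (by positivity)]
  rw [e4]
  conv_lhs => rw [e3]
  linear_combination (((s - t) ^ 2 * ‖gapQuot γ (s, t)‖ : ℝ) : ℂ) * e1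

/-- A loop of zero energy runs through a real circle. -/
theorem exists_range_eq (h : LegendrianLoop γ P) (h0 : ∀ s t, density γ s t = 0) :
    ∃ A, PreservesForm A ∧ Set.range γ = ballMap A '' realCircle := by
  have hP := h.period_pos
  obtain ⟨c, hc0, hc⟩ := h.exists_phase h0
  set V : ℝ → (ℂ × ℂ) × ℂ := fun t => c t • (γ t, (1 : ℂ)) with hV
  have hVV : ∀ s ∈ Set.Ico 0 P, ∀ t ∈ Set.Ico 0 P,
      indef (V s) (V t) = ((-‖gap γ s t‖ : ℝ) : ℂ) := by
    intro s hs t ht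
    rw [hV, indef_smul_left, indef_smul_right, indef_lift, Complex.ofReal_neg, ← hc s hs t ht, gap]
    ring
  have m1 : (0 : ℝ) ∈ Set.Ico 0 P := ⟨le_rfl, hP⟩
  have m2 : P / 3 ∈ Set.Ico 0 P := ⟨by linarith, by linarith⟩
  have m3 : 2 * P / 3 ∈ Set.Ico 0 P := ⟨by linarith, by linarith⟩
  have hpos : ∀ s ∈ Set.Ico 0 P, ∀ t ∈ Set.Ico 0 P, s ≠ t → 0 < ‖gap γ s t‖ :=
    fun s hs t ht hne => norm_pos_iff.2 (h.gap_ne_zero fun e => hne (h.injOn hs ht e))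
  have hzero : ∀ s ∈ Set.Ico 0 P, indef (V s) (V s) = 0 := fun s hs => by
    rw [hVV s hs s hs, h.gap_self]; simp
  obtain ⟨A, hA, hAr⟩ := exists_real_frame
    (hpos _ m1 _ m2 (by linarith)) (hpos _ m1 _ m3 (by linarith)) (hpos _ m2 _ m3 (by linarith))
    (hzero _ m1) (hzero _ m2) (hzero _ m3) (hVV _ m1 _ m2) (hVV _ m1 _ m3) (hVV _ m2 _ m3)
  have hle : ∀ t, hermSq (γ t) ≤ 1 := fun t => (h.onSphere t).le
  set r : ℝ → ℂ × ℂ := fun t => ballMap A.symm (γ t) with hr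
  have hrs : ∀ t, hermSq (r t) = 1 := fun t => hA.symm.hermSq_eq_one (h.onSphere t)
  have hrp : Function.Periodic r P := fun t => by simp only [hr, h.periodic t]
  have hr0 : ∀ t ∈ Set.Ico 0 P, conjPt (r t) = r t := by
    intro t ht
    have him : ∀ s ∈ Set.Ico 0 P, (indef (V t) (V s)).im = 0 := fun s hs => by
      rw [hVV t ht s hs, Complex.ofReal_im]
    obtain ⟨i1, i2, i3⟩ := hAr (V t) (him _ m1) (him _ m2) (him _ m3)
    have hX : A.symm (V t) = c t • A.symm (γ t, 1) := map_smul _ _ _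
    have e : r t = ((A.symm (V t)).2)⁻¹ • (A.symm (V t)).1 := by
      rw [hX, Prod.smul_snd, Prod.smul_fst, smul_eq_mul, smul_smul, mul_inv, mul_right_comm,
        inv_mul_cancel₀ (hc0 t), one_mul]
      rfl
    have hx : ∀ z w : ℂ, z.im = 0 → w.im = 0 → (z⁻¹ * w).im = 0 := fun z w hz hw => by
      simp [Complex.mul_im, hz, hw]
    rw [conjPt_eq_iff, e]
    exact ⟨hx _ _ i3 i1, hx _ _ i3 i2⟩
  have hrr : ∀ t, conjPt (r t) = r t := fun t => by
    obtain ⟨t', ht', e⟩ := hrp.exists_mem_Ico₀ hP t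
    rw [e]; exact hr0 t' ht'
  have hγ : ∀ t, ballMap A (r t) = γ t := fun t => hA.ballMap_apply_symm (hle t)
  refine ⟨A, hA, Set.Subset.antisymm ?_ ?_⟩
  · rintro _ ⟨t, rfl⟩
    exact ⟨r t, ⟨hrs t, hrr t⟩, hγ t⟩
  · rintro _ ⟨a, ⟨has, har⟩, rfl⟩
    have hrc : Continuous r := continuous_iff_continuousAt.2 fun t =>
      ContinuousAt.comp (g := ballMap A.symm) (hA.symm.contDiffAt_ballMap (hle t)).continuousAt
        h.smooth.continuous.continuousAt
    have hreal : ∀ {z : ℂ × ℂ}, hermSq z = 1 → conjPt z = z → z.1.re ^ 2 + z.2.re ^ 2 = 1 := by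
      intro z hz hzr
      obtain ⟨x, y, rfl⟩ := conjPt_eq_self_iff.1 hzr
      simpa [hermSq] using hz
    obtain ⟨t, h1, h2⟩ := exists_eq_of_injective_loop (x := fun t => (r t).1.re)
      (y := fun t => (r t).2.re) hP (Complex.continuous_re.comp hrc.fst)
      (Complex.continuous_re.comp hrc.snd) (fun t => by simp only [hrp t])
      (fun t => by simp only [hrp t]) (fun t => hreal (hrs t) (hrr t))
      (fun s t hst e1 e2 => by
        refine h.eq_of_abs_sub_lt hst ?_
        rw [← hγ s, ← hγ t]
        congr 1
        have i1 := conjPt_eq_iff.1 (hrr s)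
        have i2 := conjPt_eq_iff.1 (hrr t)
        exact Prod.ext (Complex.ext e1 (by rw [i1.1, i2.1])) (Complex.ext e2 (by rw [i1.2, i2.2])))
      (hreal has har)
    refine ⟨t, ?_⟩
    rw [← hγ t]
    congr 1
    have i1 := conjPt_eq_iff.1 (hrr t)
    have i2 := conjPt_eq_iff.1 har
    exact Prod.ext (Complex.ext h1 (by rw [i1.1, i2.1])) (Complex.ext h2 (by rw [i1.2, i2.2]))

/-- On a real circle, `gap` is real up to factors that depend on one of the variables only. -/
theorem cross_im_of_subset (h : LegendrianLoop γ P)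
    {A : ((ℂ × ℂ) × ℂ) ≃L[ℂ] ((ℂ × ℂ) × ℂ)} (hA : PreservesForm A)
    (hγ : ∀ t, γ t ∈ ballMap A '' realCircle) {s t : ℝ} (hst : γ s ≠ γ t) :
    (cross γ s t).im = 0 := by
  have hle : ∀ t, hermSq (γ t) ≤ 1 := fun t => (h.onSphere t).le
  set r : ℝ → ℂ × ℂ := fun t => ballMap A.symm (γ t) with hr
  have hrr : ∀ t, conjPt (r t) = r t := fun t => by
    obtain ⟨a, ha, e⟩ := hγ t
    have : r t = a := by simp only [hr]; rw [← e]; exact hA.ballMap_symm_apply ha.1.le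
    rw [this]; exact ha.2
  have hrd : Differentiable ℝ r := fun t =>
    (((hA.symm.contDiffAt_ballMap (hle t)).restrict_scalars ℝ).differentiableAt
      (by simp)).comp t (h.hasDerivAt t).differentiableAt
  set D : ℝ → ℂ := fun t => den A.symm (γ t) with hD
  have hDd : Differentiable ℝ D := by
    have h1 : ContDiff ℝ ∞ fun t => A.symm (γ t, (1 : ℂ)) :=
      (A.symm.contDiff.restrict_scalars ℝ).comp (h.smooth.prodMk contDiff_const)
    exact (h1.snd).differentiable (by simp)
  have hD0 : ∀ t, D t ≠ 0 := fun t => hA.symm.den_ne_zero (hle t)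
  have hgap : ∀ s t, gap γ s t = (1 - herm (r s) (r t)) * (D s * conj (D t)) := fun s t =>
    (hA.symm.one_sub_herm (hle s) (hle t)).symm
  have hq : ∀ s t, (1 - herm (r s) (r t)).im = 0 := fun s t => by
    rw [← Complex.conj_eq_iff_im, map_sub, map_one, ← herm_conjPt, hrr, hrr]
  have hconst : ∀ u, γ s ≠ γ u →
      (halfLogDeriv γ s u).im = (1 / 2 * (deriv D s / D s)).im := by
    intro u hu
    have h1 : HasDerivAt (fun s => 1 - herm (r s) (r u)) (-herm (deriv r s) (r u)) s :=
      (hasDerivAt_herm_left (hrd s).hasDerivAt (r u)).const_sub 1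
    have hq' : (-herm (deriv r s) (r u)).im = 0 := by
      have h2 := Complex.imCLM.hasFDerivAt.comp_hasDerivAt s h1
      have e : (Complex.imCLM ∘ fun s => 1 - herm (r s) (r u)) = fun _ => (0 : ℝ) :=
        funext fun s => hq s u
      rw [e] at h2
      exact h2.unique (hasDerivAt_const s 0)
    have h3 := h1.mul ((hDd s).hasDerivAt.mul_const (conj (D u)))
    have e : (fun s => gap γ s u) =
        (fun s => 1 - herm (r s) (r u)) * fun s => D s * conj (D u) :=
      funext fun s => hgap s u
    have h4 := h.hasDerivAt_gap_left s u
    rw [e] at h4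
    have h5 := h4.unique h3
    have hg0 := h.gap_ne_zero hu
    rw [hgap] at hg0
    have hq0 := left_ne_zero_of_mul hg0
    have hDu : conj (D u) ≠ 0 := (map_ne_zero _).2 (hD0 u)
    have hDs := hD0 s
    have e2 : halfLogDeriv γ s u = 1 / 2 * (-herm (deriv r s) (r u) / (1 - herm (r s) (r u))) +
        1 / 2 * (deriv D s / D s) := by
      have h6 : halfLogDeriv γ s u = 1 / 2 * (-herm (deriv γ s) (γ u)) / gap γ s u := by
        rw [halfLogDeriv]; ring
      rw [h6, h5, hgap]
      field_simp
    have e3 : (1 / 2 * (-herm (deriv r s) (r u) / (1 - herm (r s) (r u)))).im = 0 := by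
      have : ∀ z w : ℂ, z.im = 0 → w.im = 0 → (1 / 2 * (z / w)).im = 0 := fun z w hz hw => by
        obtain ⟨x, rfl⟩ : ∃ x : ℝ, z = x := ⟨z.re, Complex.ext (by simp) (by simp [hz])⟩
        obtain ⟨y, rfl⟩ : ∃ y : ℝ, w = y := ⟨w.re, Complex.ext (by simp) (by simp [hw])⟩
        have : (1 / 2 * ((x : ℂ) / y)) = ((1 / 2 * (x / y) : ℝ) : ℂ) := by push_cast; rfl
        rw [this, Complex.ofReal_im]
      exact this _ _ hq' (hq s u)
    rw [e2, Complex.add_im, e3, zero_add]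
  have h1 := Complex.imCLM.hasFDerivAt.comp_hasDerivAt t (h.hasDerivAt_halfLogDeriv hst)
  have h2 : HasDerivAt (Complex.imCLM ∘ fun t => halfLogDeriv γ s t) 0 t := by
    refine (hasDerivAt_const t (1 / 2 * (deriv D s / D s)).im).congr_of_eventuallyEq ?_
    have ho : IsOpen {u | γ s ≠ γ u} := isOpen_ne_fun continuous_const h.smooth.continuous
    filter_upwards [ho.mem_nhds hst] with u hu
    exact hconst u hu
  exact h1.unique h2

/-- A loop in a real circle has zero energy: `cross` is real and does not vanish, and it is positive
near the diagonal. -/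
theorem density_eq_zero_of_subset (h : LegendrianLoop γ P)
    {A : ((ℂ × ℂ) × ℂ) ≃L[ℂ] ((ℂ × ℂ) × ℂ)} (hA : PreservesForm A)
    (hγ : ∀ t, γ t ∈ ballMap A '' realCircle) (s t : ℝ) : density γ s t = 0 := by
  have hP := h.period_pos
  obtain ⟨v, hv, e⟩ := (h.density_periodic_right s).exists_mem_Ico hP t s
  rw [e]
  rcases hv.1.eq_or_lt with hsv | hsv
  · rw [← hsv, density, h.cross_self]; simp
  have hne : ∀ u ∈ Set.Ioc s v, γ s ≠ γ u := fun u hu e => by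
    have := h.eq_of_abs_sub_lt (s := s) (t := u) (by
      rw [abs_sub_comm, abs_of_pos (by linarith [hu.1])]; linarith [hu.2, hv.2]) e
    linarith [hu.1]
  have him : ∀ u ∈ Set.Ioc s v, (cross γ s u).im = 0 := fun u hu =>
    h.cross_im_of_subset hA hγ (hne u hu)
  have hre : ∀ u ∈ Set.Ioc s v, (cross γ s u).re ≠ 0 := fun u hu h0 =>
    h.cross_ne_zero (hne u hu) (Complex.ext h0 (him u hu))
  have hpos : 0 ≤ (cross γ s v).re := by
    by_contra! hneg
    -- `x² * cross` tends to `1` at the diagonal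
    have hlim : Tendsto (fun u => 1 + (s - u) ^ 2 * (regCross γ (s, u)).re) (𝓝[>] s) (𝓝 1) := by
      have hc : ContinuousAt (fun u => 1 + (s - u) ^ 2 * (regCross γ (s, u)).re) s := by
        refine continuousAt_const.add (ContinuousAt.mul (Continuous.continuousAt (by fun_prop)) ?_)
        refine Complex.continuous_re.continuousAt.comp ?_
        exact ContinuousAt.comp (g := regCross γ) (f := fun t : ℝ => (s, t))
          (h.continuousOn_regCross.continuousAt ((isOpen_strip P).mem_nhds (by
            simpa [strip] using hP)))
          (Continuous.continuousAt (by fun_prop))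
      simpa using hc.tendsto.mono_left nhdsWithin_le_nhds
    have hev : ∀ᶠ u in 𝓝[>] s, u < v := nhdsWithin_le_nhds (gt_mem_nhds hsv)
    obtain ⟨u, ⟨hu1, huv⟩, hsu⟩ :=
      (((hlim.eventually_const_lt zero_lt_one).and hev).and self_mem_nhdsWithin).exists
    have hsu' : s < u := hsu
    have hup : 0 < (cross γ s u).re := by
      rw [h.cross_eq (s := s) (t := u) (by
        simp only [strip, Set.mem_ofPred_eq]
        rw [abs_sub_comm, abs_of_pos (by linarith)]; linarith [hv.2]) hsu'.ne]
      have e : (1 : ℂ) / ((s : ℂ) - u) ^ 2 = ((1 / (s - u) ^ 2 : ℝ) : ℂ) := by push_cast; rfl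
      rw [e, Complex.add_re, Complex.ofReal_re]
      have hx : 0 < (s - u) ^ 2 := by
        have : s - u ≠ 0 := by linarith
        positivity
      have : 1 / (s - u) ^ 2 + (regCross γ (s, u)).re =
          (1 + (s - u) ^ 2 * (regCross γ (s, u)).re) / (s - u) ^ 2 := by
        rw [eq_div_iff hx.ne', add_mul, one_div, inv_mul_cancel₀ hx.ne', mul_comm (_ ^ 2)]
      rw [this]
      exact div_pos hu1 hx
    have hcont : ContinuousOn (fun u => (cross γ s u).re) (Set.Icc u v) := fun w hw => by
      refine ContinuousAt.continuousWithinAt (Complex.continuous_re.continuousAt.comp ?_)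
      exact ContinuousAt.comp (g := fun p : ℝ × ℝ => cross γ p.1 p.2) (f := fun t : ℝ => (s, t))
        (h.continuousAt_cross (p := (s, w)) (hne w ⟨by linarith [hw.1], hw.2⟩))
        (Continuous.continuousAt (by fun_prop))
    obtain ⟨w, hw, hw0⟩ := intermediate_value_Icc' huv.le hcont ⟨hneg.le, hup.le⟩
    exact hre w ⟨by linarith [hw.1], hw.2⟩ hw0
  have hmem : v ∈ Set.Ioc s v := ⟨hsv, le_rfl⟩
  have e2 : cross γ s v = ((cross γ s v).re : ℂ) := Complex.ext (by simp) (by simp [him v hmem])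
  rw [density, e2, Complex.norm_real, Real.norm_of_nonneg hpos, Complex.ofReal_re, sub_self]

end LegendrianLoop

/-! ### `ℝ`-circles as Legendrian knots -/

/-- The standard parametrization of the real points of the sphere. -/
def circlePt (t : ℝ) : ℂ × ℂ := ((Real.cos t : ℂ), (Real.sin t : ℂ))

theorem hermSq_circlePt (t : ℝ) : hermSq (circlePt t) = 1 := by
  simp only [hermSq, circlePt, Complex.norm_real, Real.norm_eq_abs, sq_abs]
  exact Real.cos_sq_add_sin_sq t

theorem mem_realCircle_iff {a : ℂ × ℂ} : a ∈ realCircle ↔ ∃ t, circlePt t = a := by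
  constructor
  · rintro ⟨h1, h2⟩
    obtain ⟨x, y, rfl⟩ := conjPt_eq_self_iff.1 h2
    have hxy : x ^ 2 + y ^ 2 = 1 := by simpa [hermSq] using h1
    set z : ℂ := ⟨x, y⟩
    have hz : ‖z‖ = 1 := by
      rw [Complex.norm_def, Complex.normSq_apply, ← sq, ← sq, hxy, Real.sqrt_one]
    have hz0 : z ≠ 0 := norm_ne_zero_iff.1 (by rw [hz]; exact one_ne_zero)
    refine ⟨z.arg, ?_⟩
    rw [circlePt, Complex.cos_arg hz0, Complex.sin_arg, hz, div_one, div_one]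
  · rintro ⟨t, rfl⟩
    exact ⟨hermSq_circlePt t, conjPt_eq_self_iff.2 ⟨_, _, rfl⟩⟩

theorem hasDerivAt_circlePt (t : ℝ) :
    HasDerivAt circlePt ((-(Real.sin t : ℂ)), (Real.cos t : ℂ)) t := by
  have h1 := (Real.hasDerivAt_cos t).ofReal_comp
  have h2 := (Real.hasDerivAt_sin t).ofReal_comp
  rw [Complex.ofReal_neg] at h1
  exact h1.prodMk h2

theorem contDiff_circlePt : ContDiff ℝ ∞ circlePt :=
  (Complex.ofRealCLM.contDiff.comp Real.contDiff_cos).prodMk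
    (Complex.ofRealCLM.contDiff.comp Real.contDiff_sin)

theorem circlePt_injOn : Set.InjOn circlePt (Set.Ico 0 (2 * Real.pi)) := by
  intro s hs t ht e
  have h1 : Real.cos s = Real.cos t := Complex.ofReal_injective (congrArg Prod.fst e)
  have h2 : Real.sin s = Real.sin t := Complex.ofReal_injective (congrArg Prod.snd e)
  have h3 : Real.cos (s - t) = 1 := by
    rw [Real.cos_sub, h1, h2, ← sq, ← sq, Real.cos_sq_add_sin_sq]
  have h4 := (Real.cos_eq_one_iff_of_lt_of_lt (by linarith [hs.1, ht.2])
    (by linarith [hs.2, ht.1])).1 h3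
  linarith

section Circle

variable {A : ((ℂ × ℂ) × ℂ) ≃L[ℂ] ((ℂ × ℂ) × ℂ)}

theorem contDiff_ballMap_circlePt (hA : PreservesForm A) :
    ContDiff ℝ ∞ fun t => ballMap A (circlePt t) := contDiff_iff_contDiffAt.2 fun t =>
  ((hA.contDiffAt_ballMap (hermSq_circlePt t).le).restrict_scalars ℝ).comp t
    contDiff_circlePt.contDiffAt

theorem deriv_ballMap_circlePt_ne_zero (hA : PreservesForm A) (t : ℝ) :
    deriv (fun t => ballMap A (circlePt t)) t ≠ 0 := by
  intro h0
  have h1 : HasDerivAt (fun t => ballMap A (circlePt t)) 0 t := by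
    rw [← h0]
    exact ((contDiff_ballMap_circlePt hA).differentiable (by simp) t).hasDerivAt
  have h2 : DifferentiableAt ℝ (ballMap A.symm) (ballMap A (circlePt t)) :=
    ((hA.symm.contDiffAt_ballMap (hA.hermSq_eq_one (hermSq_circlePt t)).le).restrict_scalars
      ℝ).differentiableAt (by simp)
  have h3 := h2.hasFDerivAt.comp_hasDerivAt t h1
  have e : (ballMap A.symm ∘ fun t => ballMap A (circlePt t)) = circlePt :=
    funext fun t => hA.ballMap_symm_apply (hermSq_circlePt t).le
  rw [e, map_zero] at h3
  have h4 := h3.unique (hasDerivAt_circlePt t)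
  have h5 : (0 : ℂ) = -(Real.sin t : ℂ) := congrArg Prod.fst h4
  have h6 : (0 : ℂ) = (Real.cos t : ℂ) := congrArg Prod.snd h4
  have h7 : Real.sin t = 0 := by exact_mod_cast neg_eq_zero.1 h5.symm
  have h8 : Real.cos t = 0 := by exact_mod_cast h6.symm
  have := Real.cos_sq_add_sin_sq t
  rw [h7, h8] at this
  norm_num at this

/-- The kernel `1 - ⟨r s, r t⟩` of a real curve in the sphere has a double zero on the diagonal,
also after multiplication by a nonvanishing factor; hence the image curve is Legendrian. -/
theorem herm_deriv_ballMap_circlePt (hA : PreservesForm A) (t : ℝ) :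
    herm (deriv (fun t => ballMap A (circlePt t)) t) (ballMap A (circlePt t)) = 0 := by
  set γ : ℝ → ℂ × ℂ := fun t => ballMap A (circlePt t) with hγ
  have hle : ∀ t, hermSq (circlePt t) ≤ 1 := fun t => (hermSq_circlePt t).le
  have hd : HasDerivAt γ (deriv γ t) t :=
    ((contDiff_ballMap_circlePt hA).differentiable (by simp) t).hasDerivAt
  have hD : DifferentiableAt ℝ (fun s => den A (circlePt s)) t := by
    have h1 : ContDiff ℝ ∞ fun t => A (circlePt t, (1 : ℂ)) :=
      (A.contDiff.restrict_scalars ℝ).comp (contDiff_circlePt.prodMk contDiff_const)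
    exact (h1.snd).differentiable (by simp) t
  have h1 := ((hasDerivAt_herm_left hd (γ t)).const_sub 1).mul
    (hD.hasDerivAt.mul_const (conj (den A (circlePt t))))
  have h2 := (hasDerivAt_herm_left (hasDerivAt_circlePt t) (circlePt t)).const_sub 1
  have e : ((fun s => 1 - herm (γ s) (γ t)) * fun s =>
      den A (circlePt s) * conj (den A (circlePt t))) =
      fun s => 1 - herm (circlePt s) (circlePt t) :=
    funext fun s => hA.one_sub_herm (hle s) (hle t)
  rw [e] at h1
  have h3 := h1.unique h2
  have h4 : herm (γ t) (γ t) = 1 := by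
    rw [← hermSq_coe, hA.hermSq_eq_one (hermSq_circlePt t), Complex.ofReal_one]
  have h5 : herm (-(Real.sin t : ℂ), (Real.cos t : ℂ)) (circlePt t) = 0 := by
    simp only [herm, circlePt, Complex.conj_ofReal]; ring
  rw [h4, h5, sub_self, zero_mul, add_zero, neg_zero] at h3
  have h6 := hA.den_ne_zero (hle t)
  have h7 := (mul_eq_zero.1 h3).resolve_right (mul_ne_zero h6 ((map_ne_zero _).2 h6))
  exact neg_eq_zero.1 h7

end Circle

/-- Every `ℝ`-circle is a Legendrian knot. -/
theorem IsRCircle.exists_knot {C : Set (OnePoint Heis)} (hC : IsRCircle C) :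
    ∃ K : LegendrianKnot, K.carrier = C := by
  obtain ⟨A, hA, rfl⟩ := (isRCircle_iff C).1 hC
  have hsph : ∀ t, hermSq (ballMap A (circlePt t)) = 1 := fun t =>
    hA.hermSq_eq_one (hermSq_circlePt t)
  choose c hc using fun t => exists_toSphere_eq (hsph t)
  have hcf : (fun t => toSphere (c t)) = fun t => ballMap A (circlePt t) := funext hc
  have hper : ∀ t, circlePt (t + 2 * Real.pi) = circlePt t := fun t => by
    simp only [circlePt, Real.cos_add_two_pi, Real.sin_add_two_pi]
  refine ⟨⟨c, 2 * Real.pi, Real.two_pi_pos, fun t => ?_, fun s hs t ht e => ?_, ?_, fun t => ?_,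
    fun t ht => ?_⟩, ?_⟩
  · exact toSphere_injective (by rw [hc, hc, hper])
  · have h1 : ballMap A (circlePt s) = ballMap A (circlePt t) := by rw [← hc, ← hc, e]
    have h2 := congrArg (ballMap A.symm) h1
    rw [hA.ballMap_symm_apply (hermSq_circlePt s).le,
      hA.ballMap_symm_apply (hermSq_circlePt t).le] at h2
    exact circlePt_injOn hs ht h2
  · rw [hcf]; exact contDiff_ballMap_circlePt hA
  · rw [hcf]; exact deriv_ballMap_circlePt_ne_zero hA t
  · set γ : ℝ → ℂ × ℂ := fun t => ballMap A (circlePt t) with hγ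
    have hγd : DifferentiableAt ℝ γ t :=
      (contDiff_ballMap_circlePt hA).differentiable (by simp) t
    have hne : (γ t).2 ≠ 1 := fun h => ht ((toSphere_snd_eq_one_iff _).1 (by rw [hc]; exact h))
    have hfp : (fun s => finitePart (c s)) = fun s => sphereToHeis (γ s) := funext fun s => by
      rw [finitePart_eq, hc]
    have hd := (differentiableAt_sphereToHeis hγd hne).hasDerivAt
    have hev : ∀ᶠ s in 𝓝 t, γ s = heisToSphere (sphereToHeis (γ s)) := by
      have ho : IsOpen {s | (γ s).2 ≠ 1} :=
        isOpen_ne_fun (continuous_snd.comp (contDiff_ballMap_circlePt hA).continuous)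
          continuous_const
      filter_upwards [ho.mem_nhds hne] with s hs
      exact (heisToSphere_sphereToHeis (hsph s) hs).symm
    have h1 := herm_deriv_heisToSphere hγd.hasDerivAt hd hev
    rw [herm_deriv_ballMap_circlePt hA t, zero_mul, eq_comm, neg_eq_zero] at h1
    have h2 := (mul_eq_zero.1 h1).resolve_left (mul_ne_zero (by norm_num) Complex.I_ne_zero)
    rw [hfp, congrFun hfp t]
    exact_mod_cast h2
  · ext p
    constructor
    · rintro ⟨t, rfl⟩
      exact ⟨circlePt t, mem_realCircle_iff.2 ⟨t, rfl⟩, (hc t).symm⟩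
    · rintro ⟨a, ha, e⟩
      obtain ⟨t, rfl⟩ := mem_realCircle_iff.1 ha
      exact ⟨t, toSphere_injective (by rw [hc, e])⟩

/-- The knots of zero energy are the `ℝ`-circles. -/
theorem LegendrianKnot.loopEnergy_eq_zero_iff_isRCircle (K : LegendrianKnot) :
    loopEnergy K.loop K.period = 0 ↔ IsRCircle K.carrier := by
  have h := K.isLegendrianLoop
  rw [h.loopEnergy_eq_zero_iff, isRCircle_iff]
  constructor
  · intro h0
    obtain ⟨A, hA, hrange⟩ := h.exists_range_eq h0
    refine ⟨A, hA, ?_⟩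
    ext p
    rw [Set.mem_ofPred_eq, ← hrange]
    constructor
    · rintro ⟨t, rfl⟩
      exact ⟨t, rfl⟩
    · rintro ⟨t, ht⟩
      exact ⟨t, toSphere_injective ht⟩
  · rintro ⟨A, hA, hC⟩ s t
    refine h.density_eq_zero_of_subset hA (fun t => ?_) s t
    have : K.curve t ∈ K.carrier := ⟨t, rfl⟩
    rw [hC] at this
    exact this

end LegendrianEnergy

end

theorem mainTheorem2 :
    (∀ K : LegendrianEnergy.LegendrianKnot,
      (∃! e : ℝ, K.HasEnergy e) ∧
      ∀ e : ℝ, K.HasEnergy e →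
        0 ≤ e ∧ (e = 0 ↔ LegendrianEnergy.IsRCircle K.carrier)) ∧
    (∀ C : Set (OnePoint LegendrianEnergy.Heis), LegendrianEnergy.IsRCircle C →
      ∃ K : LegendrianEnergy.LegendrianKnot, K.carrier = C) := by
  refine ⟨fun K => ⟨⟨_, (K.hasEnergy_iff _).2 rfl, fun e he => (K.hasEnergy_iff e).1 he⟩,
    fun e he => ?_⟩, fun C hC => hC.exists_knot⟩
  rw [(K.hasEnergy_iff e).1 he]
  exact ⟨K.isLegendrianLoop.loopEnergy_nonneg, K.loopEnergy_eq_zero_iff_isRCircle⟩
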